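/- **Setting.** Let $(\Omega,\mathscr F,\mathbb P)$ be a probability space, $(J,\mathscr J,\nu)$ a $\sigma$-finite measure space, $E=\mathbb R_+\times J$ with measure $\mu=dt\times\nu$, and $N$ a Poisson random measure on $E$ with intensity measure $\mu$: $N(\omega,\cdot)$ is an $\overline{\mathbb N}$-valued measure, $N(B)$ is a Poisson random variable with parameter $\mu(B)$ ($N(B)=\infty$ a.s. if $\mu(B)=\infty$), and $N(B_1),\dots,N(B_n)$ are independent for pairwise disjoint $B_1,\dots,B_n$. Put $\mathscr E_\mu=\{B:\mu(B)<\infty\}$, $\tilde N(B)=N(B)-\mu(B)$ for $B\in\mathscr E_\mu$, $\mathscr G=\sigma(\tilde N(B):B\in\mathscr E_\mu)$ and $\mathscr F_t=\sigma(N((s,u]\times A):0\le s<u\le t,\ A\in\mathscr J)$. All Banach spaces are real. *The spaces $\nu_p$.* For a Banach space $Y$ and $1\le r<\infty$, $\nu_r(E;Y)$ is the completion of the space of simple functions $f=\sum_j \mathbf 1_{B_j}\otimes y_j$ ($B_j\in\mathscr E_\mu$ pairwise disjoint, $y_j\in Y$) in the norm $\|f\|_{\nu_r(E;Y)}=(\mathbb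 E\|\tilde N(f)\|_Y^r)^{1/r}$, $\tilde N(f)=\sum_j\tilde N(B_j)y_j$. Via $f\mapsto\tilde N(f)$ it is identified with a closed subspace of $L^r(\Omega;Y)$. *Malliavin derivative.* A $Y$-valued cylindrical function is $F=\sum_{i=1}^n f_i(N(B_1),\dots,N(B_M))\otimes y_i$ with $f_i:\mathbb N^M\to\mathbb R$, $B_1,\dots,B_M\in\mathscr E_\mu$ pairwise disjoint, $y_i\in Y$; its derivative is $DF=\sum_{i}\sum_{m}\big(f_i(N(\mathbf B)+\mathbf e_m)-f_i(N(\mathbf B))\big)\otimes(\mathbf 1_{B_m}\otimes y_i)$. For $1<r<\infty$, $D_r^Y$ is the closure, as an operator from $L^r(\Omega,\mathscr G;Y)$ to $L^r(\Omega;\nu_r(E;Y))$, of $D$ on the cylindrical functions $F\in L^r(\Omega;Y)$ with $DF\in L^r(\Omega;\nu_r(E;Y))$. *Divergence.* Let $1<p<\infty$ and $\frac1p+\frac1q=1$. The divergence $\delta=\delta_p^X$, from $L^p(\Omega;\nu_p(E;X))$ to $L^p(\Omega,\mathscr G;X)$, is the adjoint of $D_q^{X^*}$: $\phi\in\mathrm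 D(\delta)$ and $\delta(\phi)=\psi$ mean that $\psi\in L^p(\Omega,\mathscr G;X)$ and $\langle\!\langle \phi,DG\rangle\!\rangle=\mathbb E\langle\psi,G\rangle$ for all $G$ in the domain of $D_q^{X^*}$, where $\langle\!\langle\phi,\Psi\rangle\!\rangle=\int_\Omega\int_\Omega\langle\phi(\omega)(\omega'),\Psi(\omega)(\omega')\rangle\,d\mathbb P(\omega')\,d\mathbb P(\omega)$ is the duality of $L^p(\Omega;L^p(\Omega;X))$ and $L^q(\Omega;L^q(\Omega;X^*))$ under the identification above. *Itô integral.* A simple adapted process is $\phi=\sum_{i,j,k}F_{ijk}\mathbf 1_{(t_i,t_{i+1}]}\mathbf 1_{A_j}x_{ijk}$ (finite sum) with $0=t_1<\dots<t_{l+1}<\infty$, $F_{ijk}\in L^\infty(\Omega,\mathscr F_{t_i})$, $A_j\in\mathscr J$ pairwise disjoint with $\nu(A_j)<\infty$, $x_{ijk}\in X$; its integral is $I(\phi)=\sum_{i,j,k}F_{ijk}\tilde N((t_i,t_{i+1}]\times A_j)x_{ijk}$. Let $L^p_{\mathbb F}(\Omega;\nu_p(\mathbb R_+\times J;X))$ be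 the closure of the simple adapted processes in $L^p(\Omega;\nu_p(\mathbb R_+\times J;X))$. **Theorem.** Let $1<p<\infty$ and let $X$ be a UMD Banach space, i.e. for some $r\in(1,\infty)$ there is $\beta\ge0$ with $\mathbb E\|\sum_{n\le m}\epsilon_nd_n\|^r\le\beta^r\,\mathbb E\|\sum_{n\le m}d_n\|^r$ for all $X$-valued $L^r$-martingale difference sequences $(d_n)$, all signs $\epsilon_n=\pm1$ and all $m$. Then $I$ extends uniquely to a bounded linear operator $I:L^p_{\mathbb F}(\Omega;\nu_p(\mathbb R_+\times J;X))\to L^p(\Omega;X)$; moreover $L^p_{\mathbb F}(\Omega;\nu_p(\mathbb R_+\times J;X))$ is contained in the domain $\mathrm D(\delta)$ of $\delta=\delta_p^X$, and $$\delta(\phi)=I(\phi)\qquad\text{for all }\phi\in L^p_{\mathbb F}(\Omega;\nu_p(\mathbb R_+\times J;X)).$$ -/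

import Mathlib

open MeasureTheory ProbabilityTheory
open scoped NNReal ENNReal

universe u v w

namespace PoissonSkorokhod

noncomputable section

/-! ### UMD spaces -/

/-- The UMD property: for some `p ∈ (1, ∞)`, martingale differences in `L^p(Ω; X)` are unconditional
with a constant `β` that depends neither on the martingale nor on the signs. The probability spaces
range over the universe `u`; every universe contains an atomless probability space, on which the
best constant is attained, so that the property does not depend on `u`. -/
def IsUMD (X : Type v) [NormedAddCommGroup X] [NormedSpace ℝ X] : Prop :=
  ∃ p : ℝ≥0∞, 1 < p ∧ p < ∞ ∧ ∃ β : ℝ≥0,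
    ∀ (Ω : Type u) [m : MeasurableSpace Ω] (P : Measure Ω) [IsProbabilityMeasure P]
      (ℱ : Filtration ℕ m) (d : ℕ → Ω → X),
      (∀ n, StronglyMeasurable[ℱ n] (d n)) → (∀ n, MemLp (d n) p P) →
      (∀ n, P[d (n + 1) | ℱ n] =ᵐ[P] 0) →
      ∀ ε : ℕ → ℝ, (∀ n, ε n = 1 ∨ ε n = -1) → ∀ n : ℕ,
        eLpNorm (fun ω => ∑ k ∈ Finset.range n, ε k • d k ω) p P
          ≤ β * eLpNorm (fun ω => ∑ k ∈ Finset.range n, d k ω) p P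

/-! ### Poisson random measures -/

section General

variable {Ω : Type u} [MeasurableSpace Ω] {E : Type w} [MeasurableSpace E]

/-- `N` is a Poisson random measure on `E` with intensity measure `μ`. -/
structure IsPoissonRandomMeasure (N : Ω → Measure E) (μ : Measure E) (P : Measure Ω) : Prop where
  measurable_apply : ∀ B, MeasurableSet B → Measurable fun ω => N ω B
  integer_valued : ∀ ω B, MeasurableSet B → ∃ n : ℕ∞, N ω B = (n : ℝ≥0∞)
  law_of_lt_top : ∀ B, MeasurableSet B → μ B < ∞ →
    P.map (fun ω => N ω B) = (poissonMeasure (μ B).toNNReal).map (fun n : ℕ => (n : ℝ≥0∞))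
  ae_eq_top : ∀ B, MeasurableSet B → μ B = ∞ → ∀ᵐ ω ∂P, N ω B = ∞
  indep : ∀ (n : ℕ) (B : Fin n → Set E), (∀ i, MeasurableSet (B i)) →
    Pairwise (fun i j => Disjoint (B i) (B j)) → iIndepFun (fun i ω => N ω (B i)) P

/-- The compensated random measure `Ñ(B) = N(B) - μ(B)`, used for `μ(B) < ∞`. -/
def compensated (N : Ω → Measure E) (μ : Measure E) (B : Set E) (ω : Ω) : ℝ :=
  (N ω B).toReal - (μ B).toReal

/-- The value `N(B)` as a natural number, used for `μ(B) < ∞`, where `N(B)` is almost surely a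
finite integer. -/
def count (N : Ω → Measure E) (B : Set E) (ω : Ω) : ℕ := ⌊(N ω B).toReal⌋₊

/-- The σ-algebra `𝒢` generated by the variables `Ñ(B)`, `μ(B) < ∞`. -/
@[reducible] def noiseSigma (N : Ω → Measure E) (μ : Measure E) : MeasurableSpace Ω :=
  ⨆ (B : Set E) (_ : MeasurableSet B ∧ μ B < ∞),
    MeasurableSpace.comap (compensated N μ B) inferInstance

/-- The variables `Ñ(B)`, `μ(B) < ∞`, have moments of all orders. -/
theorem memLp_compensated {N : Ω → Measure E} {μ : Measure E} {P : Measure Ω}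
    [IsProbabilityMeasure P] (hN : IsPoissonRandomMeasure N μ P) {B : Set E}
    (hB : MeasurableSet B) (hμ : μ B < ∞) {p : ℝ≥0∞} (hp : p ≠ ∞) :
    MemLp (compensated N μ B) p P := by
  set r : ℝ≥0 := (μ B).toNNReal with hr
  have hcast : Measurable (fun n : ℕ => (n : ℝ≥0∞)) := measurable_of_countable _
  have hexp : ∀ t : ℝ, Integrable (fun n : ℕ => Real.exp (t * (n : ℝ))) (poissonMeasure r) := by
    intro t
    rw [integrable_poissonMeasure_iff]
    have hs := (Real.summable_pow_div_factorial (r * Real.exp t)).mul_left (Real.exp (-r))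
    refine hs.congr fun n => ?_
    rw [Real.norm_eq_abs, Real.abs_exp, mul_pow, ← Real.exp_nat_mul, mul_comm (n : ℝ) t]
    ring
  have h1 : MemLp (fun n : ℕ => (n : ℝ)) p (poissonMeasure r) := by
    lift p to ℝ≥0 using hp
    refine memLp_of_mem_interior_integrableExpSet ?_ p
    have : integrableExpSet (fun n : ℕ => (n : ℝ)) (poissonMeasure r) = Set.univ :=
      Set.eq_univ_of_forall hexp
    simp [this]
  have h2 : MemLp ENNReal.toReal p (P.map fun ω => N ω B) := by
    rw [hN.law_of_lt_top B hB hμ,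
      memLp_map_measure_iff ENNReal.measurable_toReal.aestronglyMeasurable hcast.aemeasurable]
    simpa [Function.comp_def] using h1
  rw [memLp_map_measure_iff ENNReal.measurable_toReal.aestronglyMeasurable
    (hN.measurable_apply B hB).aemeasurable] at h2
  exact h2.sub (memLp_const _)

/-! ### The spaces `ν_p(E; X)` -/

section Nu

variable (N : Ω → Measure E) (μ : Measure E) (P : Measure Ω)
variable (p : ℝ≥0∞) [Fact (1 ≤ p)]
variable (X : Type v) [NormedAddCommGroup X] [NormedSpace ℝ X]

/-- `ν_p(E; X)`, the completion of the simple functions `f = ∑ j, 1_{B j} ⊗ x j` (with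
`μ (B j) < ∞`) in the Poisson `p`-norm `(𝔼 ‖∑ j, Ñ(B j) x j‖ ^ p) ^ (1 / p)`. Since `f ↦ Ñ(f)` is
isometric from the simple functions with this norm into `L^p(Ω; X)`, the completion is the closure
of its range. -/
def nuSpace : Submodule ℝ (Lp X p P) :=
  (Submodule.span ℝ {g : Lp X p P | ∃ (B : Set E) (x : X), MeasurableSet B ∧ μ B < ∞ ∧
    g =ᵐ[P] fun ω => compensated N μ B ω • x}).topologicalClosure

variable {X}

open Classical in
/-- The element `1_B ⊗ x` of `ν_p(E; X)`, for `B` measurable with `μ(B) < ∞`. The last condition of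
the case distinction is automatic for a Poisson random measure and `p < ∞`. -/
def nuIndicator (B : Set E) (x : X) : nuSpace N μ P p X :=
  if h : MeasurableSet B ∧ μ B < ∞ ∧ MemLp (fun ω => compensated N μ B ω • x) p P then
    ⟨h.2.2.toLp _, subset_closure (Submodule.subset_span ⟨B, x, h.1, h.2.1, h.2.2.coeFn_toLp⟩)⟩
  else 0

variable {N μ P p} in
theorem coeFn_nuIndicator [IsProbabilityMeasure P] (hN : IsPoissonRandomMeasure N μ P)
    (hp : p ≠ ∞) {B : Set E} (hB : MeasurableSet B) (hμ : μ B < ∞) (x : X) :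
    ((nuIndicator N μ P p B x : Lp X p P) : Ω → X) =ᵐ[P] fun ω => compensated N μ B ω • x := by
  have h : MemLp (fun ω => compensated N μ B ω • x) p P :=
    (ContinuousLinearMap.toSpanSingleton ℝ x).comp_memLp' (memLp_compensated hN hB hμ hp)
  rw [nuIndicator, dif_pos ⟨hB, hμ, h⟩]
  exact h.coeFn_toLp

variable {N μ P p} in
/-- The norm of a simple function in `ν_p(E; X)` is its Poisson `p`-norm. -/
theorem norm_sum_nuIndicator [IsProbabilityMeasure P] (hN : IsPoissonRandomMeasure N μ P)
    (hp : p ≠ ∞) {m : ℕ} (B : Fin m → Set E) (hB : ∀ j, MeasurableSet (B j))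
    (hμ : ∀ j, μ (B j) < ∞) (x : Fin m → X) :
    ‖∑ j, nuIndicator N μ P p (B j) (x j)‖
      = (∫ ω, ‖∑ j, compensated N μ (B j) ω • x j‖ ^ p.toReal ∂P) ^ (p.toReal)⁻¹ := by
  have h0 : p ≠ 0 := (zero_lt_one.trans_le (Fact.out : 1 ≤ p)).ne'
  have hae : (((∑ j, nuIndicator N μ P p (B j) (x j) : nuSpace N μ P p X) : Lp X p P) : Ω → X)
      =ᵐ[P] fun ω => ∑ j, compensated N μ (B j) ω • x j := by
    rw [Submodule.coe_sum]
    filter_upwards [Lp.coeFn_finsetSum Finset.univ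
      (fun j => (nuIndicator N μ P p (B j) (x j) : Lp X p P)),
      ae_all_iff.2 fun j => coeFn_nuIndicator hN hp (hB j) (hμ j) (x j)] with ω h1 h2
    rw [h1, Finset.sum_apply]
    exact Finset.sum_congr rfl fun j _ => h2 j
  rw [Submodule.coe_norm, Lp.norm_def, eLpNorm_congr_ae hae,
    ((memLp_congr_ae hae).1 (Lp.memLp _)).eLpNorm_eq_integral_rpow_norm h0 hp,
    ENNReal.toReal_ofReal (by positivity)]

end Nu

/-! ### The Malliavin derivative -/

/-- The data of a `Y`-valued cylindrical function `∑ i, f i (N(B 1), …, N(B M)) ⊗ x i`, the sets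
`B 1, …, B M` being pairwise disjoint and of finite measure. -/
structure CylindricalData (μ : Measure E) (Y : Type v) where
  M : ℕ
  B : Fin M → Set E
  measurableSet_B : ∀ m, MeasurableSet (B m)
  measure_B_lt_top : ∀ m, μ (B m) < ∞
  disjoint_B : Pairwise fun m m' => Disjoint (B m) (B m')
  n : ℕ
  f : Fin n → (Fin M → ℕ) → ℝ
  x : Fin n → Y

namespace CylindricalData

variable {Y : Type v} [NormedAddCommGroup Y] [NormedSpace ℝ Y] {μ : Measure E}

/-- The cylindrical function itself. -/
def toFun (c : CylindricalData μ Y) (N : Ω → Measure E) (ω : Ω) : Y :=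
  ∑ i, c.f i (fun m => count N (c.B m) ω) • c.x i

/-- Its Malliavin derivative
`∑ i, ∑ m, (f i (N(B) + e m) - f i (N(B))) ⊗ (1_{B m} ⊗ x i)`, with values in `ν_r(E; Y)`. -/
def deriv (c : CylindricalData μ Y) (N : Ω → Measure E) (P : Measure Ω) (r : ℝ≥0∞)
    [Fact (1 ≤ r)] (ω : Ω) : nuSpace N μ P r Y :=
  ∑ i, ∑ m, (c.f i ((fun l => count N (c.B l) ω) + Pi.single m 1)
    - c.f i (fun l => count N (c.B l) ω)) • nuIndicator N μ P r (c.B m) (c.x i)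

end CylindricalData

section Operators

variable (N : Ω → Measure E) (μ : Measure E) (P : Measure Ω)

/-- The graph of the Malliavin derivative on the cylindrical functions `F` that satisfy
`F ∈ L^r(Ω; Y)` and `DF ∈ L^r(Ω; ν_r(E; Y))`. These pairs form a linear space; the span turns it
into a bundled subspace. -/
def malliavinGraph₀ (r : ℝ≥0∞) [Fact (1 ≤ r)] (Y : Type v) [NormedAddCommGroup Y]
    [NormedSpace ℝ Y] : Submodule ℝ (Lp Y r P × Lp (nuSpace N μ P r Y) r P) :=
  Submodule.span ℝ {G | ∃ c : CylindricalData μ Y,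
    G.1 =ᵐ[P] c.toFun N ∧ G.2 =ᵐ[P] c.deriv N P r}

/-- The graph of the Malliavin derivative `D = D_r^Y`, the closure of the operator above. -/
def malliavinGraph (r : ℝ≥0∞) [Fact (1 ≤ r)] (Y : Type v) [NormedAddCommGroup Y]
    [NormedSpace ℝ Y] : Submodule ℝ (Lp Y r P × Lp (nuSpace N μ P r Y) r P) :=
  (malliavinGraph₀ N μ P r Y).topologicalClosure

variable (p q : ℝ≥0∞) [Fact (1 ≤ p)] [Fact (1 ≤ q)]
variable (X : Type v) [NormedAddCommGroup X] [NormedSpace ℝ X]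

variable {N μ P p q X} in
/-- The duality of `L^p(Ω; L^p(Ω; X))` and `L^q(Ω; L^q(Ω; X*))`, restricted to
`L^p(Ω; ν_p(E; X))` and `L^q(Ω; ν_q(E; X*))`. -/
def pairing (φ : Lp (nuSpace N μ P p X) p P)
    (Ψ : Lp (nuSpace N μ P q (StrongDual ℝ X)) q P) : ℝ :=
  ∫ ω, ∫ ω', ((Ψ ω : Lp (StrongDual ℝ X) q P) ω') ((φ ω : Lp X p P) ω') ∂P ∂P

variable {N μ P p X} in
/-- `φ ∈ D(δ)` and `δ φ = ψ`, where `δ = δ_p^X` from `L^p(Ω; ν_p(E; X))` to `L^p(Ω, 𝒢; X)` is the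
adjoint of `D = D_q^{X*}`. -/
def IsDivergence (φ : Lp (nuSpace N μ P p X) p P) (ψ : Lp X p P) : Prop :=
  ψ ∈ lpMeas X ℝ (noiseSigma N μ) p P ∧
    ∀ G ∈ malliavinGraph N μ P q (StrongDual ℝ X),
      pairing φ G.2 = ∫ ω, (G.1 ω) (ψ ω) ∂P

/-- The domain of the divergence operator `δ = δ_p^X`. -/
def divergenceDomain : Set (Lp (nuSpace N μ P p X) p P) :=
  {φ | ∃ ψ : Lp X p P, IsDivergence q φ ψ}

end Operators

end General

/-! ### Simple adapted processes and the stochastic integral -/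

section Ito

variable {Ω : Type u} [MeasurableSpace Ω] {J : Type w} [MeasurableSpace J]

/-- The σ-algebra `ℱ_t` generated by the variables `N((s, u] × A)`, `0 ≤ s < u ≤ t`. -/
@[reducible] def pastSigma (N : Ω → Measure (ℝ≥0 × J)) (t : ℝ≥0) : MeasurableSpace Ω :=
  ⨆ (s : ℝ≥0) (u : ℝ≥0) (A : Set J) (_ : s < u ∧ u ≤ t ∧ MeasurableSet A),
    MeasurableSpace.comap (fun ω => N ω (Set.Ioc s u ×ˢ A)) inferInstance

/-- The intensity measure `dt × ν` on `ℝ₊ × J`. -/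
def timeProd (ν : Measure J) : Measure (ℝ≥0 × J) :=
  (Measure.comap ((↑) : ℝ≥0 → ℝ) volume).prod ν

/-- The data of a simple adapted process
`∑ i, ∑ j, ∑ k, F i j k 1_{(t i, t (i + 1)]} 1_{A j} x i j k`, with `F i j k` bounded and
`ℱ_{t i}`-measurable. -/
structure SimpleAdapted (N : Ω → Measure (ℝ≥0 × J)) (ν : Measure J) (X : Type v) where
  l : ℕ
  m : ℕ
  n : ℕ
  t : Fin (l + 1) → ℝ≥0
  t_zero : t 0 = 0
  strictMono_t : StrictMono t
  A : Fin m → Set J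
  measurableSet_A : ∀ j, MeasurableSet (A j)
  measure_A_lt_top : ∀ j, ν (A j) < ∞
  disjoint_A : Pairwise fun j j' => Disjoint (A j) (A j')
  F : Fin l → Fin m → Fin n → Ω → ℝ
  measurable_F : ∀ i j k, Measurable[pastSigma N (t i.castSucc)] (F i j k)
  bounded_F : ∀ i j k, ∃ C : ℝ, ∀ ω, |F i j k ω| ≤ C
  x : Fin l → Fin m → Fin n → X

namespace SimpleAdapted

variable {N : Ω → Measure (ℝ≥0 × J)} {ν : Measure J} {X : Type v} [NormedAddCommGroup X]
  [NormedSpace ℝ X]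

/-- The cell `(t i, t (i + 1)] × A j`. -/
def cell (s : SimpleAdapted N ν X) (i : Fin s.l) (j : Fin s.m) : Set (ℝ≥0 × J) :=
  Set.Ioc (s.t i.castSucc) (s.t i.succ) ×ˢ s.A j

/-- The process, as a random variable with values in `ν_p(ℝ₊ × J; X)`. -/
def process (s : SimpleAdapted N ν X) (P : Measure Ω) (p : ℝ≥0∞) [Fact (1 ≤ p)] (ω : Ω) :
    nuSpace N (timeProd ν) P p X :=
  ∑ i, ∑ j, ∑ k, s.F i j k ω • nuIndicator N (timeProd ν) P p (s.cell i j) (s.x i j k)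

/-- The compensated Poisson integral
`∑ i, ∑ j, ∑ k, F i j k Ñ((t i, t (i + 1)] × A j) x i j k` of the process over `ℝ₊ × J`. -/
def integral (s : SimpleAdapted N ν X) (ω : Ω) : X :=
  ∑ i, ∑ j, ∑ k, (s.F i j k ω * compensated N (timeProd ν) (s.cell i j) ω) • s.x i j k

end SimpleAdapted

variable (N : Ω → Measure (ℝ≥0 × J)) (ν : Measure J) (P : Measure Ω)
variable (p : ℝ≥0∞) [Fact (1 ≤ p)]
variable (X : Type v) [NormedAddCommGroup X] [NormedSpace ℝ X]

/-- `L^p_𝔽(Ω; ν_p(ℝ₊ × J; X))`, the closure of the simple adapted processes. These form a linear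
space; the span turns it into a bundled subspace. -/
def adaptedSpace : Submodule ℝ (Lp (nuSpace N (timeProd ν) P p X) p P) :=
  (Submodule.span ℝ {φ : Lp (nuSpace N (timeProd ν) P p X) p P |
    ∃ s : SimpleAdapted N ν X, φ =ᵐ[P] s.process P p}).topologicalClosure

variable {N ν P p X} in
/-- The bounded operator `I` on `L^p_𝔽(Ω; ν_p(ℝ₊ × J; X))` extends the stochastic integral of the
simple adapted processes. -/
def ExtendsSimpleIntegral (I : adaptedSpace N ν P p X →L[ℝ] Lp X p P) : Prop :=
  ∀ (s : SimpleAdapted N ν X) (φ : adaptedSpace N ν P p X),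
    (φ : Lp (nuSpace N (timeProd ν) P p X) p P) =ᵐ[P] s.process P p → I φ =ᵐ[P] s.integral

end Ito

end

end PoissonSkorokhod

open PoissonSkorokhod

/-! On elementary adapted processes the Itô integral is bounded in the norm of `L^p(Ω; ν_p)` and
satisfies the adjoint relation that defines the divergence. The divergence is closed and
single-valued, so both facts pass to the closure of the simple adapted processes.

Boundedness is decoupling. By the definition of `ν_p` and Fubini, the norm of the process is the
`L^p(Ω × Ω)` norm of `∑ F a (ω) Ñ(cell a)(ω') x a`, in which the noise is an independent copy; the
Itô integral has `ω' = ω`. On a common time grid, the half sums and half differences of the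
increments of the two copies form one martingale difference sequence. Its sum is the decoupled
integral, and its transform by alternating signs is the Itô integral, so UMD compares the two
(`UMDAt.exists_decoupling`, `AdaptedFamily.exists_eLpNorm_integral_le`).

UMD is assumed at one exponent but is needed at `p`; this is `IsUMD.umdAt`. Passing to a larger
exponent (`UMDAt.mono`) uses a tail estimate: the given exponent controls the part of the martingale
after its transform has first reached a level `t`. Passing to a smaller exponent goes through the
dual space (`UMDAt.of_norming`).

Adjointness rests on Stein's identity `𝔼[Z h(Z)] = r 𝔼[h(Z + 1)]` for a Poisson variable, applied to
`N` on pieces of a cell with the noise off that piece held fixed (`integral_compensated_mul`). An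
adapted coefficient depends only on `N` before the cell, so an extra point in the cell does not
change it, and only the difference operator on the test function appears.

The divergence is single-valued because the indicators of cylinder events, tensored with
functionals, lie in the domain of the derivative and determine a `𝒢`-measurable variable
(`IsDivergence.unique`).

Elementary processes are handled as `AdaptedFamily`, whose rectangles may overlap: sums are then
juxtapositions, and a common refinement is needed only for the norm estimate. -/

namespace PoissonSkorokhod

/-! ### Moment bounds from tail bounds. -/

/-- A layer cake estimate: a weighted tail bound for `U` in terms of `M` gives a moment bound. -/
theorem lintegral_rpow_le_of_tail_le {Ω : Type*} [MeasurableSpace Ω] {P : Measure Ω}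
    {U M : Ω → ℝ} {W : Ω → ℝ≥0∞}
    (hU0 : 0 ≤ U) (hM0 : 0 ≤ M) (hU : Measurable U) (hM : Measurable M) (hW : AEMeasurable W P)
    {r p c : ℝ} (hr : 0 ≤ r) (hrp : r < p) (hc : 0 < c)
    (h : ∀ t : ℝ, 0 < t →
      ENNReal.ofReal (t ^ r) * P {ω | c * t ≤ U ω} ≤ ∫⁻ ω in {ω | t ≤ M ω}, W ω ∂P) :
    ∫⁻ ω, ENNReal.ofReal (U ω) ^ p ∂P
      ≤ ENNReal.ofReal (c ^ p * p / (p - r)) *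
        ∫⁻ ω, W ω * ENNReal.ofReal (M ω) ^ (p - r) ∂P := by
  have hp : 0 < p := hr.trans_lt hrp
  have hpr : 0 < p - r := sub_pos.2 hrp
  have h1 := lintegral_rpow_eq_lintegral_meas_le_mul P (f := fun ω => U ω / c)
    (ae_of_all _ fun ω => div_nonneg (hU0 ω) hc.le) (hU.div_const c).aemeasurable hp
  -- The weight is absorbed into the measure, so the right-hand side is again a layer cake integral,
  -- with exponent `p - r` because `t ^ r` has been spent in the tail bound.
  have h2 := lintegral_rpow_eq_lintegral_meas_le_mul (P.withDensity W) (f := M)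
    (ae_of_all _ hM0) hM.aemeasurable hpr
  have hMm : ∀ t : ℝ, MeasurableSet {ω | t ≤ M ω} := fun t => measurableSet_le measurable_const hM
  have h3 : ∫⁻ t in Set.Ioi (0 : ℝ), P {ω | t ≤ U ω / c} * ENNReal.ofReal (t ^ (p - 1))
      ≤ ∫⁻ t in Set.Ioi (0 : ℝ),
        (P.withDensity W) {ω | t ≤ M ω} * ENNReal.ofReal (t ^ (p - r - 1)) := by
    refine setLIntegral_mono' measurableSet_Ioi fun t ht => ?_
    have ht' : 0 < t := ht
    rw [withDensity_apply _ (hMm t)]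
    have e1 : {ω | t ≤ U ω / c} = {ω | c * t ≤ U ω} := by
      ext ω; simp only [Set.mem_ofPred_eq, le_div_iff₀ hc, mul_comm]
    have e2 : t ^ (p - 1) = t ^ r * t ^ (p - r - 1) := by
      rw [← Real.rpow_add ht']; ring_nf
    rw [e1, e2, ENNReal.ofReal_mul (by positivity), ← mul_assoc, mul_comm (P _)]
    gcongr
    exact h t ht'
  have e3 : ∀ ω, ENNReal.ofReal (U ω) ^ p
      = ENNReal.ofReal (c ^ p) * ENNReal.ofReal ((U ω / c) ^ p) := by
    intro ω
    rw [← ENNReal.ofReal_mul (by positivity), Real.div_rpow (hU0 ω) hc.le,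
      mul_div_cancel₀ _ (by positivity), ENNReal.ofReal_rpow_of_nonneg (hU0 ω) hp.le]
  have e4 : ∫⁻ ω, W ω * ENNReal.ofReal (M ω) ^ (p - r) ∂P
      = ∫⁻ ω, ENNReal.ofReal (M ω ^ (p - r)) ∂(P.withDensity W) := by
    rw [lintegral_withDensity_eq_lintegral_mul₀ hW (by fun_prop)]
    refine lintegral_congr fun ω => ?_
    rw [Pi.mul_apply, ENNReal.ofReal_rpow_of_nonneg (hM0 ω) hpr.le]
  simp_rw [e3]
  rw [lintegral_const_mul _ (by fun_prop), h1, e4, h2, ← mul_assoc, ← mul_assoc,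
    ← ENNReal.ofReal_mul (by positivity), ← ENNReal.ofReal_mul (by positivity)]
  have e5 : c ^ p * p / (p - r) * (p - r) = c ^ p * p := by field_simp
  rw [e5]
  gcongr

/-- Absorbing a power of a finite quantity into the left-hand side. -/
theorem le_rpow_mul_of_le_mul_rpow {A a K : ℝ≥0∞} (hA : A ≠ ∞) {θ : ℝ} (h0 : 0 < θ)
    (h : A ≤ K * (a ^ θ * A ^ (1 - θ))) : A ≤ K ^ θ⁻¹ * a := by
  rcases eq_or_ne A 0 with rfl | hA0
  · exact zero_le
  have h1 : A ^ θ ≤ K * a ^ θ := by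
    have h2 : A ^ θ * A ^ (1 - θ) ≤ K * a ^ θ * A ^ (1 - θ) := by
      rw [← ENNReal.rpow_add _ _ hA0 hA]
      simpa [mul_assoc] using h
    exact (ENNReal.mul_le_mul_iff_left (by simp [hA0, hA]) (by simp [hA0, hA])).1 h2
  calc A = (A ^ θ) ^ θ⁻¹ := by rw [← ENNReal.rpow_mul, mul_inv_cancel₀ h0.ne', ENNReal.rpow_one]
    _ ≤ (K * a ^ θ) ^ θ⁻¹ := by gcongr
    _ = K ^ θ⁻¹ * a := by
      rw [ENNReal.mul_rpow_of_nonneg _ _ (by positivity), ← ENNReal.rpow_mul,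
        mul_inv_cancel₀ h0.ne', ENNReal.rpow_one]

/-! ### Doob's maximal inequality. -/

section Maximal

variable {Ω : Type*} {X : Type*} [NormedAddCommGroup X]

/-- The running maximum `max_{k ≤ n} ‖f k‖`. -/
noncomputable def runMax (f : ℕ → Ω → X) (n : ℕ) (ω : Ω) : ℝ :=
  (Finset.range (n + 1)).sup' Finset.nonempty_range_add_one fun k => ‖f k ω‖

theorem norm_le_runMax (f : ℕ → Ω → X) {k n : ℕ} (hk : k ≤ n) (ω : Ω) :
    ‖f k ω‖ ≤ runMax f n ω :=
  Finset.le_sup' (fun k => ‖f k ω‖) (Finset.mem_range.2 (Nat.lt_succ_of_le hk))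

theorem runMax_nonneg (f : ℕ → Ω → X) (n : ℕ) (ω : Ω) : 0 ≤ runMax f n ω :=
  (norm_nonneg _).trans (norm_le_runMax f (Nat.zero_le n) ω)

theorem le_runMax_iff (f : ℕ → Ω → X) (n : ℕ) (ω : Ω) (t : ℝ) :
    t ≤ runMax f n ω ↔ ∃ k ≤ n, t ≤ ‖f k ω‖ := by
  simp [runMax, Finset.le_sup'_iff]

theorem measurable_runMax [m : MeasurableSpace Ω] {f : ℕ → Ω → X}
    {n : ℕ} (hf : ∀ k ≤ n, StronglyMeasurable (f k)) : Measurable (runMax f n) :=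
  Finset.measurable_range_sup'' fun k hk => (hf k hk).norm.measurable

theorem runMax_rpow_le (f : ℕ → Ω → X) (n : ℕ) (ω : Ω) {p : ℝ} (hp : 0 ≤ p) :
    ENNReal.ofReal (runMax f n ω) ^ p ≤ ∑ k ∈ Finset.range (n + 1), ‖f k ω‖ₑ ^ p := by
  obtain ⟨k, hk, h⟩ := (le_runMax_iff f n ω _).1 le_rfl
  refine le_trans ?_ (Finset.single_le_sum (f := fun k => ‖f k ω‖ₑ ^ p) (fun _ _ => zero_le)
    (Finset.mem_range.2 (Nat.lt_succ_of_le hk)))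
  simp only [← ofReal_norm]
  gcongr

/-- Only finiteness matters here: Doob's inequality absorbs a power of this moment into the
left-hand side, which is legitimate once the moment is finite. -/
theorem lintegral_runMax_lt_top [MeasurableSpace Ω] {P : Measure Ω} {f : ℕ → Ω → X} {p : ℝ}
    (hp : 0 < p) (n : ℕ) (hf : ∀ k, StronglyMeasurable (f k))
    (hfin : ∀ k, ∫⁻ ω, ‖f k ω‖ₑ ^ p ∂P < ∞) :
    ∫⁻ ω, ENNReal.ofReal (runMax f n ω) ^ p ∂P < ∞ := by
  refine (lintegral_mono fun ω => runMax_rpow_le f n ω hp.le).trans_lt ?_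
  rw [lintegral_finsetSum _ fun k _ => (hf k).enorm.pow_const p]
  exact ENNReal.sum_lt_top.2 fun k _ => hfin k

variable [NormedSpace ℝ X] [CompleteSpace X]

theorem submartingale_norm {m : MeasurableSpace Ω} {P : Measure Ω} [IsFiniteMeasure P]
    {ℱ : Filtration ℕ m} {f : ℕ → Ω → X} (hf : Martingale f ℱ P) :
    Submartingale (fun n ω => ‖f n ω‖) ℱ P := by
  refine ⟨fun n => (hf.1 n).norm, fun i j hij => ?_, fun n => (hf.integrable n).norm⟩
  filter_upwards [hf.2 i j hij, norm_condExp_le (m := ℱ i) (μ := P) (f j)] with ω h1 h2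
  rw [h1] at h2
  exact h2

/-- **Doob's `L^p` inequality** for vector-valued martingales. -/
theorem lintegral_runMax_rpow_le [m : MeasurableSpace Ω] {P : Measure Ω} [IsFiniteMeasure P]
    {ℱ : Filtration ℕ m} {f : ℕ → Ω → X} (hf : Martingale f ℱ P) {p : ℝ} (hp : 1 < p)
    (hfin : ∀ k, ∫⁻ ω, ‖f k ω‖ₑ ^ p ∂P < ∞) (n : ℕ) :
    ∫⁻ ω, ENNReal.ofReal (runMax f n ω) ^ p ∂P
      ≤ ENNReal.ofReal (p / (p - 1)) ^ p * ∫⁻ ω, ‖f n ω‖ₑ ^ p ∂P := by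
  have hp0 : 0 < p := zero_lt_one.trans hp
  have hsm : ∀ k, StronglyMeasurable (f k) := fun k => (hf.1 k).mono (ℱ.le k)
  have hM : Measurable (runMax f n) := measurable_runMax fun k _ => hsm k
  -- The case `r = c = 1` and `W = ‖f n‖`, whose hypothesis is the weak-type maximal inequality.
  -- Hölder's inequality then produces a power of the left-hand side on the right, to be absorbed.
  have key := lintegral_rpow_le_of_tail_le (P := P) (U := runMax f n) (M := runMax f n)
    (W := fun ω => ‖f n ω‖ₑ) (fun ω => runMax_nonneg f n ω) (fun ω => runMax_nonneg f n ω) hM hM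
    (hsm n).enorm.aemeasurable zero_le_one hp one_pos ?_
  · have hH : ∫⁻ ω, ‖f n ω‖ₑ * ENNReal.ofReal (runMax f n ω) ^ (p - 1) ∂P
        ≤ (∫⁻ ω, ‖f n ω‖ₑ ^ p ∂P) ^ p⁻¹ *
          (∫⁻ ω, ENNReal.ofReal (runMax f n ω) ^ p ∂P) ^ (1 - p⁻¹) := by
      have h1 : 0 ≤ 1 - p⁻¹ := sub_nonneg.2 (inv_le_one_of_one_le₀ hp.le)
      refine le_trans (le_of_eq ?_) (ENNReal.lintegral_mul_norm_pow_le
        ((hsm n).enorm.pow_const p).aemeasurable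
        (hM.ennreal_ofReal.pow_const p).aemeasurable (by positivity) h1 (by ring))
      refine lintegral_congr fun ω => ?_
      rw [← ENNReal.rpow_mul, ← ENNReal.rpow_mul, mul_inv_cancel₀ hp0.ne', ENNReal.rpow_one,
        mul_sub, mul_inv_cancel₀ hp0.ne', mul_one]
    have h2 := key.trans (mul_le_mul_right hH _)
    have h3 := le_rpow_mul_of_le_mul_rpow
      (lintegral_runMax_lt_top hp0 n hsm hfin).ne (inv_pos.2 hp0) h2
    simpa using h3
  · intro t ht
    have h1 := maximal_ineq (submartingale_norm hf) (fun n ω => norm_nonneg _)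
      (ε := t.toNNReal) n
    rw [Real.coe_toNNReal t ht.le] at h1
    rw [Real.rpow_one, one_mul]
    refine h1.trans (le_of_eq ?_)
    rw [ofReal_integral_eq_lintegral_ofReal ((hf.integrable n).norm.integrableOn)
      (ae_of_all _ fun _ => norm_nonneg _)]
    simp only [ofReal_norm]
    rfl

end Maximal

/-! ### Martingale differences and UMD at a fixed exponent. -/

/-- `d` is a martingale difference sequence in `L^p`. -/
structure IsMartingaleDiff {Ω : Type*} {m : MeasurableSpace Ω} {X : Type*} [NormedAddCommGroup X]
    [NormedSpace ℝ X] (P : Measure Ω) (ℱ : Filtration ℕ m) (p : ℝ≥0∞) (d : ℕ → Ω → X) :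
    Prop where
  stronglyMeasurable : ∀ n, StronglyMeasurable[ℱ n] (d n)
  memLp : ∀ n, MemLp (d n) p P
  condExp_eq : ∀ n, P[d (n + 1) | ℱ n] =ᵐ[P] 0

/-- The UMD property at the exponent `p`. -/
def UMDAt (X : Type v) [NormedAddCommGroup X] [NormedSpace ℝ X] (p : ℝ≥0∞) : Prop :=
  ∃ β : ℝ≥0, ∀ (Ω : Type u) [m : MeasurableSpace Ω] (P : Measure Ω) [IsProbabilityMeasure P]
    (ℱ : Filtration ℕ m) (d : ℕ → Ω → X), IsMartingaleDiff P ℱ p d →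
      ∀ ε : ℕ → ℝ, (∀ n, ε n = 1 ∨ ε n = -1) → ∀ n : ℕ,
        eLpNorm (fun ω => ∑ k ∈ Finset.range n, ε k • d k ω) p P
          ≤ β * eLpNorm (fun ω => ∑ k ∈ Finset.range n, d k ω) p P

theorem IsUMD.exists_umdAt {X : Type v} [NormedAddCommGroup X] [NormedSpace ℝ X]
    (hX : IsUMD.{u, v} X) : ∃ p : ℝ≥0∞, 1 < p ∧ p < ∞ ∧ UMDAt.{u, v} X p := by
  obtain ⟨p, h1, h2, β, hβ⟩ := hX
  exact ⟨p, h1, h2, β, fun Ω m P _ ℱ d hd => hβ Ω P ℱ d hd.1 hd.2 hd.3⟩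

section

variable {Ω : Type*} {m : MeasurableSpace Ω} {X : Type*} [NormedAddCommGroup X] [NormedSpace ℝ X]
  {P : Measure Ω} {ℱ : Filtration ℕ m} {p : ℝ≥0∞} {d : ℕ → Ω → X}

theorem IsMartingaleDiff.mono_exponent [IsFiniteMeasure P] (hd : IsMartingaleDiff P ℱ p d)
    {r : ℝ≥0∞} (h : r ≤ p) : IsMartingaleDiff P ℱ r d :=
  ⟨hd.1, fun n => (hd.2 n).mono_exponent h, hd.3⟩

theorem IsMartingaleDiff.integrable [IsFiniteMeasure P] (hd : IsMartingaleDiff P ℱ p d)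
    (hp : 1 ≤ p) (n : ℕ) : Integrable (d n) P :=
  (hd.2 n).integrable hp

theorem IsMartingaleDiff.smul [CompleteSpace X] (hd : IsMartingaleDiff P ℱ p d) (ε : ℕ → ℝ) :
    IsMartingaleDiff P ℱ p (fun n ω => ε n • d n ω) := by
  refine ⟨fun n => (hd.1 n).const_smul _, fun n => (hd.2 n).const_smul _, fun n => ?_⟩
  refine (condExp_smul (ε (n + 1)) (d (n + 1)) (ℱ n)).trans ?_
  filter_upwards [hd.3 n] with ω h
  simp [h]

/-- The factor of `d (k + 1)` is `ℱ k`-measurable, so it comes out of the conditional expectation.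
The initial term is dropped, since no earlier σ-algebra is available for its factor. -/
theorem IsMartingaleDiff.indicator [CompleteSpace X] [IsFiniteMeasure P]
    (hd : IsMartingaleDiff P ℱ p d) (hp : 1 ≤ p) {A : ℕ → Set Ω}
    (hA : ∀ n, MeasurableSet[ℱ n] (A n)) :
    IsMartingaleDiff P ℱ p
      (fun n => n.casesOn (fun _ => 0) fun k => (A k).indicator (d (k + 1))) := by
  refine ⟨fun n => ?_, fun n => ?_, fun n => ?_⟩
  · cases n with
    | zero => exact stronglyMeasurable_zero
    | succ k => exact (hd.1 (k + 1)).indicator (ℱ.mono (Nat.le_succ k) _ (hA k))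
  · cases n with
    | zero => exact MemLp.zero
    | succ k => exact (hd.2 (k + 1)).indicator (ℱ.le k _ (hA k))
  · refine (condExp_indicator (hd.integrable hp (n + 1)) (hA n)).trans ?_
    filter_upwards [hd.3 n] with ω h
    by_cases hω : ω ∈ A n <;> simp [hω, h]

theorem IsMartingaleDiff.stronglyMeasurable_sum (hd : IsMartingaleDiff P ℱ p d) {n k : ℕ}
    (hk : k ≤ n + 1) :
    StronglyMeasurable[ℱ n] (fun ω => ∑ k ∈ Finset.range k, d k ω) :=
  Finset.stronglyMeasurable_fun_sum _ fun j hj => (hd.1 j).mono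
    (ℱ.mono (Nat.le_of_lt_succ ((Finset.mem_range.1 hj).trans_le hk)))

theorem IsMartingaleDiff.memLp_sum (hd : IsMartingaleDiff P ℱ p d) (n : ℕ) :
    MemLp (fun ω => ∑ k ∈ Finset.range n, d k ω) p P :=
  memLp_finsetSum _ fun j _ => hd.2 j

theorem IsMartingaleDiff.martingale [CompleteSpace X] [IsFiniteMeasure P]
    (hd : IsMartingaleDiff P ℱ p d) (hp : 1 ≤ p) :
    Martingale (fun n ω => ∑ k ∈ Finset.range (n + 1), d k ω) ℱ P := by
  refine martingale_nat (fun n => hd.stronglyMeasurable_sum le_rfl)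
    (fun n => (hd.memLp_sum _).integrable hp) fun n => ?_
  have h1 : (fun ω => ∑ k ∈ Finset.range (n + 1 + 1), d k ω)
      = (fun ω => ∑ k ∈ Finset.range (n + 1), d k ω) + d (n + 1) := by
    ext ω; simp [Finset.sum_range_succ]
  have h2 := condExp_add ((hd.memLp_sum (n + 1)).integrable hp) (hd.integrable hp (n + 1)) (ℱ n)
  have h3 : P[fun ω => ∑ k ∈ Finset.range (n + 1), d k ω | ℱ n]
      = fun ω => ∑ k ∈ Finset.range (n + 1), d k ω :=
    condExp_of_stronglyMeasurable (ℱ.le n) (hd.stronglyMeasurable_sum le_rfl)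
      ((hd.memLp_sum (n + 1)).integrable hp)
  simp only [h1]
  filter_upwards [h2, hd.3 n] with ω h4 h5
  rw [h4, Pi.add_apply, h5, h3]
  simp

theorem lintegral_enorm_rpow_le_iff {Ω : Type*} [MeasurableSpace Ω] {P : Measure Ω} {Y Z : Type*}
    [NormedAddCommGroup Y] [NormedAddCommGroup Z] {f : Ω → Y} {g : Ω → Z} {p : ℝ≥0∞} (h0 : p ≠ 0)
    (h1 : p ≠ ∞) (c : ℝ≥0∞) :
    eLpNorm f p P ≤ c * eLpNorm g p P ↔
      ∫⁻ ω, ‖f ω‖ₑ ^ p.toReal ∂P ≤ c ^ p.toReal * ∫⁻ ω, ‖g ω‖ₑ ^ p.toReal ∂P := by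
  have hp : 0 < p.toReal := ENNReal.toReal_pos h0 h1
  rw [eLpNorm_eq_lintegral_rpow_enorm_toReal h0 h1, eLpNorm_eq_lintegral_rpow_enorm_toReal h0 h1,
    ← ENNReal.rpow_le_rpow_iff hp, ENNReal.mul_rpow_of_nonneg _ _ hp.le, ← ENNReal.rpow_mul,
    ← ENNReal.rpow_mul, one_div, inv_mul_cancel₀ hp.ne', ENNReal.rpow_one, ENNReal.rpow_one]

end

/-! ### Extrapolation of UMD to larger exponents. -/

/-- The pointwise estimate behind the extrapolation: `e` is the part of `d` after the transform
has reached the level `t`. -/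
theorem exists_after_level {Ω X : Type*} [NormedAddCommGroup X] [NormedSpace ℝ X] (d : ℕ → Ω → X)
    (ε : ℕ → ℝ) (hε : ∀ n, ε n = 1 ∨ ε n = -1) {t : ℝ} (ht0 : 0 ≤ t) (n : ℕ) (ω : Ω)
    (e : ℕ → X)
    (A : ℕ → Set Ω)
    (hA : A = fun k => {ω | t ≤ runMax (fun n ω => ∑ k ∈ Finset.range (n + 1), ε k • d k ω) k ω})
    (he : e = fun n => n.casesOn 0 fun k => (A k).indicator (d (k + 1)) ω) :
    (ω ∉ A n → ∑ k ∈ Finset.range (n + 1), e k = 0 ∧ ∑ k ∈ Finset.range (n + 1), ε k • e k = 0) ∧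
    (ω ∈ A n → ‖∑ k ∈ Finset.range (n + 1), e k‖
      ≤ 2 * runMax (fun n ω => ∑ k ∈ Finset.range (n + 1), d k ω) n ω ∧
      ‖∑ k ∈ Finset.range (n + 1), ε k • d k ω‖ ≤ t +
        2 * runMax (fun n ω => ∑ k ∈ Finset.range (n + 1), d k ω) n ω +
        ‖∑ k ∈ Finset.range (n + 1), ε k • e k‖) := by
  classical
  set S : ℕ → Ω → X := fun n ω => ∑ k ∈ Finset.range (n + 1), d k ω with hS
  set T : ℕ → Ω → X := fun n ω => ∑ k ∈ Finset.range (n + 1), ε k • d k ω with hT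
  have hmem : ∀ k, ω ∈ A k ↔ ∃ j ≤ k, t ≤ ‖T j ω‖ := fun k => by
    rw [hA]; exact le_runMax_iff T k ω t
  have hmono : ∀ {j k}, j ≤ k → ω ∈ A j → ω ∈ A k := fun {j k} hjk h => by
    obtain ⟨i, hi, h⟩ := (hmem j).1 h
    exact (hmem k).2 ⟨i, hi.trans hjk, h⟩
  have e0 : e 0 = 0 := by simp [he]
  have e1 : ∀ k, ω ∉ A k → e (k + 1) = 0 := fun k hk => by simp [he, hk]
  have e2 : ∀ k, ω ∈ A k → e (k + 1) = d (k + 1) ω := fun k hk => by simp [he, hk]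
  have hz : ∀ k, ω ∉ A k → ∀ j ≤ k + 1, e j = 0 := fun k hk j hj => by
    cases j with
    | zero => exact e0
    | succ j => exact e1 j fun h => hk (hmono (Nat.le_of_succ_le_succ hj) h)
  have hz' : ∀ k, ω ∉ A k → (∑ j ∈ Finset.range (k + 1), e j = 0) ∧
      ∑ j ∈ Finset.range (k + 1), ε j • e j = 0 := fun k hk =>
    ⟨Finset.sum_eq_zero fun j hj => hz k hk j (Finset.mem_range.1 hj).le,
      Finset.sum_eq_zero fun j hj => by rw [hz k hk j (Finset.mem_range.1 hj).le, smul_zero]⟩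
  refine ⟨hz' n, fun hn => ?_⟩
  have hex : ∃ k, ω ∈ A k := ⟨n, hn⟩
  -- `τ` is the first time at which `‖T‖` reaches `t`. Since `A k` governs `d (k + 1)`, the sequence
  -- `e` starts at `τ + 1`.
  set τ := Nat.find hex with hτ
  have hτn : τ ≤ n := Nat.find_min' hex hn
  have hτA : ω ∈ A τ := Nat.find_spec hex
  have hτmin : ∀ k < τ, ω ∉ A k := fun k hk => Nat.find_min hex hk
  -- From `τ` on, the partial sums of `e` and of its transform are the increments of `S` and `T`
  -- after `τ`.
  have hsum : ∀ j, ∑ k ∈ Finset.range (τ + j + 1), e k = S (τ + j) ω - S τ ω ∧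
      ∑ k ∈ Finset.range (τ + j + 1), ε k • e k = T (τ + j) ω - T τ ω := by
    intro j
    induction j with
    | zero =>
      simp only [add_zero, sub_self]
      rw [Finset.sum_range_succ, Finset.sum_range_succ]
      rcases Nat.eq_zero_or_pos τ with h0 | h0
      · rw [h0]; simp [e0]
      · obtain ⟨k, hk⟩ : ∃ k, τ = k + 1 := ⟨τ - 1, by omega⟩
        have hk' := hτmin k (by omega)
        rw [hk, e1 k hk', (hz' k hk').1, (hz' k hk').2]
        simp
    | succ j ih =>
      have h1 : ω ∈ A (τ + j) := hmono (Nat.le_add_right _ _) hτA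
      rw [Finset.sum_range_succ, Finset.sum_range_succ, ← add_assoc, ih.1, ih.2, e2 _ h1]
      constructor
      · have : S (τ + j + 1) ω = S (τ + j) ω + d (τ + j + 1) ω := Finset.sum_range_succ _ _
        rw [this]; abel
      · have : T (τ + j + 1) ω = T (τ + j) ω + ε (τ + j + 1) • d (τ + j + 1) ω :=
          Finset.sum_range_succ _ _
        rw [this]; abel
  obtain ⟨j, hj⟩ := Nat.exists_eq_add_of_le hτn
  have hsn := hsum j
  rw [← hj] at hsn
  have hSn := norm_le_runMax S (le_refl n) ω
  have hSτ := norm_le_runMax S hτn ω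
  -- The overshoot at `τ` is controlled: `‖T (τ - 1)‖ < t`, and the jump has the norm of `S τ - S (τ
  -- - 1)`, at most twice the maximum of `‖S‖`. If `τ = 0`, then `T 0 = ± S 0`.
  have hTτ : ‖T τ ω‖ ≤ t + 2 * runMax S n ω ∨ ‖T τ ω‖ ≤ 2 * runMax S n ω := by
    rcases Nat.eq_zero_or_pos τ with h0 | h0
    · right
      have h3 : ‖T 0 ω‖ = ‖S 0 ω‖ := by
        rcases hε 0 with h | h <;> simp [hT, hS, h]
      rw [h0] at hSτ ⊢
      linarith [norm_nonneg (S 0 ω)]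
    · left
      obtain ⟨k, hk⟩ : ∃ k, τ = k + 1 := ⟨τ - 1, by omega⟩
      have hk' := hτmin k (by omega)
      have h4 : ‖T k ω‖ < t := by
        by_contra h
        exact hk' ((hmem k).2 ⟨k, le_rfl, not_lt.1 h⟩)
      have h5 : T τ ω = T k ω + ε τ • d τ ω := by rw [hk]; exact Finset.sum_range_succ _ _
      have h6 : d τ ω = S τ ω - S k ω := by
        rw [hk]
        have : S (k + 1) ω = S k ω + d (k + 1) ω := Finset.sum_range_succ _ _
        rw [this]; abel
      have h7 : ‖ε τ • d τ ω‖ = ‖d τ ω‖ := by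
        rcases hε τ with h | h <;> simp [h]
      have h8 := norm_le_runMax S ((by omega : k ≤ τ).trans hτn) ω
      have h9 := norm_sub_le (S τ ω) (S k ω)
      have h10 := norm_add_le (T k ω) (ε τ • d τ ω)
      rw [h5]
      rw [h7] at h10
      rw [← h6] at h9
      linarith
  have ht : ‖T τ ω‖ ≤ t + 2 * runMax S n ω := by
    rcases hTτ with h | h
    · exact h
    · linarith
  refine ⟨?_, ?_⟩
  · rw [hsn.1]
    linarith [norm_sub_le (S n ω) (S τ ω)]
  · rw [hsn.2]
    have h11 := norm_add_le (T τ ω) (T n ω - T τ ω)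
    rw [add_sub_cancel] at h11
    linarith

/-- One of `a` and `b` is at least `t`, so no convexity constant enters. -/
theorem enorm_add_rpow_le {a b t r : ℝ} (ht : 0 ≤ t) (hr : 0 ≤ r) (h : 2 * t ≤ a + b) :
    ENNReal.ofReal (t ^ r) ≤ ENNReal.ofReal a ^ r + ENNReal.ofReal b ^ r := by
  rw [← ENNReal.ofReal_rpow_of_nonneg ht hr]
  rcases le_total t a with h1 | h1
  · exact le_add_right (by gcongr)
  · exact le_add_left (by gcongr; linarith)

/-- The UMD property extrapolates to larger exponents. -/
theorem UMDAt.mono {X : Type v} [NormedAddCommGroup X] [NormedSpace ℝ X] [CompleteSpace X]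
    {r p : ℝ≥0∞} (hX : UMDAt.{u, v} X r) (hr : 1 ≤ r) (hrp : r < p) (hp : p < ∞) :
    UMDAt.{u, v} X p := by
  obtain ⟨β, hβ⟩ := hX
  have hr0 : r ≠ 0 := (zero_lt_one.trans_le hr).ne'
  have hr1 : r ≠ ∞ := (hrp.trans hp).ne
  have hp0 : p ≠ 0 := (zero_le.trans_lt hrp).ne'
  set ρ := r.toReal with hρ
  set π := p.toReal with hπ
  have hρ1 : 1 ≤ ρ := by
    simpa using ENNReal.toReal_mono hr1 hr
  have hρπ : ρ < π := (ENNReal.toReal_lt_toReal hr1 hp.ne).2 hrp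
  have hπ1 : 1 < π := hρ1.trans_lt hρπ
  have hπ0 : 0 < π := zero_lt_one.trans hπ1
  set D : ℝ≥0∞ := ENNReal.ofReal (π / (π - 1)) ^ π with hD
  -- The first summand comes from the term `2 S*` in the pointwise bound, where `S*` is the running
  -- maximum of `‖S‖`; the second comes from UMD at `r`, applied to a sum bounded by `2 S*`.
  set C : ℝ≥0∞ := 2 ^ ρ + (β : ℝ≥0∞) ^ ρ * 2 ^ ρ with hC
  set C1 : ℝ≥0∞ := ENNReal.ofReal (3 ^ π * π / (π - ρ)) with hC1
  set K : ℝ≥0∞ := C1 * C * (D ^ (ρ / π) * D ^ (1 - ρ / π)) with hK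
  set K' : ℝ≥0∞ := K ^ (ρ / π)⁻¹ with hK'
  have hθ : 0 < ρ / π := by positivity
  have hθ1 : 0 ≤ 1 - ρ / π := sub_nonneg.2 ((div_le_one hπ0).2 hρπ.le)
  have hDt : D ≠ ∞ := ENNReal.rpow_ne_top_of_nonneg hπ0.le ENNReal.ofReal_ne_top
  have hCt : C ≠ ∞ := by
    have h1 : (2 : ℝ≥0∞) ^ ρ ≠ ∞ := ENNReal.rpow_ne_top_of_nonneg (by positivity) (by simp)
    have h2 : (β : ℝ≥0∞) ^ ρ ≠ ∞ := ENNReal.rpow_ne_top_of_nonneg (by positivity) (by simp)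
    exact ENNReal.add_ne_top.2 ⟨h1, ENNReal.mul_ne_top h2 h1⟩
  have hK't : K' ≠ ∞ := by
    refine ENNReal.rpow_ne_top_of_nonneg (by positivity) ?_
    refine ENNReal.mul_ne_top (ENNReal.mul_ne_top ENNReal.ofReal_ne_top hCt) ?_
    exact ENNReal.mul_ne_top (ENNReal.rpow_ne_top_of_nonneg hθ.le hDt)
      (ENNReal.rpow_ne_top_of_nonneg hθ1 hDt)
  refine ⟨(K' ^ π⁻¹).toNNReal, fun Ω m P _ ℱ d hd ε hε n => ?_⟩
  have hKK : (((K' ^ π⁻¹).toNNReal : ℝ≥0) : ℝ≥0∞) = K' ^ π⁻¹ :=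
    ENNReal.coe_toNNReal (ENNReal.rpow_ne_top_of_nonneg (by positivity) hK't)
  rw [hKK, lintegral_enorm_rpow_le_iff hp0 hp.ne, ← hπ, ← ENNReal.rpow_mul,
    inv_mul_cancel₀ hπ0.ne', ENNReal.rpow_one]
  cases n with
  | zero => simp [hπ0]
  | succ n =>
  have hp1 : 1 ≤ p := hr.trans hrp.le
  set S : ℕ → Ω → X := fun n ω => ∑ k ∈ Finset.range (n + 1), d k ω with hS
  set T : ℕ → Ω → X := fun n ω => ∑ k ∈ Finset.range (n + 1), ε k • d k ω with hT
  have hdε : IsMartingaleDiff P ℱ p (fun n ω => ε n • d n ω) := hd.smul ε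
  have hSm : Martingale S ℱ P := hd.martingale hp1
  have hTm : Martingale T ℱ P := hdε.martingale hp1
  have hSfin : ∀ k, ∫⁻ ω, ‖S k ω‖ₑ ^ π ∂P < ∞ := fun k =>
    (eLpNorm_lt_top_iff_lintegral_rpow_enorm_lt_top hp0 hp.ne).1 (hd.memLp_sum (k + 1)).2
  have hTfin : ∀ k, ∫⁻ ω, ‖T k ω‖ₑ ^ π ∂P < ∞ := fun k =>
    (eLpNorm_lt_top_iff_lintegral_rpow_enorm_lt_top hp0 hp.ne).1 (hdε.memLp_sum (k + 1)).2
  have hSsm : ∀ k, StronglyMeasurable (S k) := fun k => (hSm.1 k).mono (ℱ.le k)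
  have hTsm : ∀ k, StronglyMeasurable (T k) := fun k => (hTm.1 k).mono (ℱ.le k)
  have hMS : Measurable (runMax S n) := measurable_runMax fun k _ => hSsm k
  have hMT : Measurable (runMax T n) := measurable_runMax fun k _ => hTsm k
  change ∫⁻ ω, ‖T n ω‖ₑ ^ π ∂P ≤ K' * ∫⁻ ω, ‖S n ω‖ₑ ^ π ∂P
  -- A bound of `T n` by the maxima of both `S` and `T`. Hölder's and Doob's inequalities turn the
  -- latter into a power of the norm of `T n`, which is absorbed.
  have key := lintegral_rpow_le_of_tail_le (P := P) (U := fun ω => ‖T n ω‖) (M := runMax T n)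
    (W := fun ω => C * ENNReal.ofReal (runMax S n ω) ^ ρ) (r := ρ) (p := π) (c := 3)
    (fun ω => norm_nonneg _) (fun ω => runMax_nonneg T n ω) (hTsm n).norm.measurable hMT
    (by fun_prop) (by positivity) hρπ (by norm_num) ?_
  · have hH : ∫⁻ ω, ENNReal.ofReal (runMax S n ω) ^ ρ * ENNReal.ofReal (runMax T n ω) ^ (π - ρ) ∂P
        ≤ (∫⁻ ω, ENNReal.ofReal (runMax S n ω) ^ π ∂P) ^ (ρ / π) *
          (∫⁻ ω, ENNReal.ofReal (runMax T n ω) ^ π ∂P) ^ (1 - ρ / π) := by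
      refine le_trans (le_of_eq ?_) (ENNReal.lintegral_mul_norm_pow_le
        (hMS.ennreal_ofReal.pow_const π).aemeasurable
        (hMT.ennreal_ofReal.pow_const π).aemeasurable hθ.le hθ1 (by ring))
      refine lintegral_congr fun ω => ?_
      rw [← ENNReal.rpow_mul, ← ENNReal.rpow_mul, mul_sub, mul_div_cancel₀ _ hπ0.ne', mul_one]
    have hdS := lintegral_runMax_rpow_le hSm hπ1 hSfin n
    have hdT := lintegral_runMax_rpow_le hTm hπ1 hTfin n
    simp only [ofReal_norm, mul_assoc] at key
    rw [lintegral_const_mul' _ _ hCt] at key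
    refine le_rpow_mul_of_le_mul_rpow (hTfin n).ne hθ (key.trans ?_)
    calc C1 * (C * ∫⁻ ω, ENNReal.ofReal (runMax S n ω) ^ ρ *
          ENNReal.ofReal (runMax T n ω) ^ (π - ρ) ∂P)
        ≤ C1 * (C * ((D * ∫⁻ ω, ‖S n ω‖ₑ ^ π ∂P) ^ (ρ / π) *
          (D * ∫⁻ ω, ‖T n ω‖ₑ ^ π ∂P) ^ (1 - ρ / π))) := by
          gcongr
          exact hH.trans (by gcongr)
      _ = _ := by
          rw [ENNReal.mul_rpow_of_nonneg _ _ hθ.le, ENNReal.mul_rpow_of_nonneg _ _ hθ1, hK]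
          ring
  · intro t ht
    set A : ℕ → Set Ω := fun k => {ω | t ≤ runMax T k ω} with hA
    have hAm : ∀ k, MeasurableSet[ℱ k] (A k) := fun k =>
      (@measurable_runMax _ _ _ (ℱ k) T k fun j hj => (hTm.1 j).mono (ℱ.mono hj))
        measurableSet_Ici
    set e : ℕ → Ω → X := fun n => n.casesOn (fun _ => 0) fun k => (A k).indicator (d (k + 1))
      with he
    -- UMD is applied at the smaller exponent to the part of `d` after the level `t`: its sum
    -- vanishes off `A n` and is at most `2 S*` there, which localizes the estimate to `{t ≤ runMax
    -- T n}`.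
    have hemd : IsMartingaleDiff P ℱ r e := (hd.mono_exponent hrp.le).indicator hr hAm
    have hpt := fun ω => exists_after_level d ε hε ht.le n ω (fun k => e k ω) A rfl (by
      funext k; cases k <;> rfl)
    have hU := hβ Ω P ℱ e hemd ε hε (n + 1)
    rw [lintegral_enorm_rpow_le_iff hr0 hr1, ← hρ] at hU
    have hAn : MeasurableSet (A n) := ℱ.le n _ (hAm n)
    set V : Ω → ℝ≥0∞ := fun ω => ENNReal.ofReal (runMax S n ω) ^ ρ with hV
    have hVm : Measurable V := hMS.ennreal_ofReal.pow_const ρ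
    set R : Ω → ℝ≥0∞ := fun ω => ‖∑ k ∈ Finset.range (n + 1), ε k • e k ω‖ₑ ^ ρ with hR
    have h1 : ∫⁻ ω, ‖∑ k ∈ Finset.range (n + 1), e k ω‖ₑ ^ ρ ∂P
        ≤ 2 ^ ρ * ∫⁻ ω in A n, V ω ∂P := by
      rw [← lintegral_const_mul _ hVm, ← lintegral_indicator hAn]
      refine lintegral_mono fun ω => ?_
      by_cases hω : ω ∈ A n
      · rw [Set.indicator_of_mem hω]
        have := ((hpt ω).2 hω).1
        rw [hV, ← ENNReal.mul_rpow_of_nonneg _ _ (by positivity), ← ofReal_norm,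
          ← ENNReal.ofReal_ofNat 2, ← ENNReal.ofReal_mul (by norm_num)]
        gcongr
      · simp [((hpt ω).1 hω).1, (by positivity : 0 < ρ)]
    -- Why `c = 3`: of the `3 t`, the level at the stopping time uses up `t`, and `2 t` is left for
    -- `2 S*` and the transform of `e`, one of which is then at least `t`.
    have h2 : ∀ ω, {ω | 3 * t ≤ ‖T n ω‖}.indicator (fun _ => ENNReal.ofReal (t ^ ρ)) ω
        ≤ (A n).indicator (fun ω => 2 ^ ρ * V ω) ω + R ω := by
      intro ω
      by_cases h3 : 3 * t ≤ ‖T n ω‖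
      · have hω : ω ∈ A n := by
          change t ≤ runMax T n ω
          linarith [norm_le_runMax T (le_refl n) ω]
        have hm : ω ∈ {ω | 3 * t ≤ ‖T n ω‖} := h3
        rw [Set.indicator_of_mem hm, Set.indicator_of_mem hω]
        have h4 := ((hpt ω).2 hω).2
        have h5 := runMax_nonneg S n ω
        refine (enorm_add_rpow_le (a := 2 * runMax S n ω)
            (b := ‖∑ k ∈ Finset.range (n + 1), ε k • e k ω‖) ht.le (by positivity) ?_).trans (le_of_eq ?_)
        · change ‖T n ω‖ ≤ t + 2 * runMax S n ω + _ at h4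
          linarith
        · rw [ENNReal.ofReal_mul (by norm_num), ENNReal.mul_rpow_of_nonneg _ _ (by positivity),
            ofReal_norm, ENNReal.ofReal_ofNat]
      · have hm : ω ∉ {ω | 3 * t ≤ ‖T n ω‖} := h3
        rw [Set.indicator_of_notMem hm]
        exact zero_le
    have h3 : MeasurableSet {ω | 3 * t ≤ ‖T n ω‖} :=
      measurableSet_le measurable_const (hTsm n).norm.measurable
    calc ENNReal.ofReal (t ^ ρ) * P {ω | 3 * t ≤ ‖T n ω‖}
        = ∫⁻ ω, {ω | 3 * t ≤ ‖T n ω‖}.indicator (fun _ => ENNReal.ofReal (t ^ ρ)) ω ∂P :=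
          (lintegral_indicator_const h3 _).symm
      _ ≤ ∫⁻ ω, (A n).indicator (fun ω => 2 ^ ρ * V ω) ω + R ω ∂P := lintegral_mono h2
      _ = 2 ^ ρ * (∫⁻ ω in A n, V ω ∂P) + ∫⁻ ω, R ω ∂P := by
          rw [lintegral_add_left ((hVm.const_mul _).indicator hAn), lintegral_indicator hAn,
            lintegral_const_mul _ hVm]
      _ ≤ 2 ^ ρ * (∫⁻ ω in A n, V ω ∂P) + β ^ ρ * (2 ^ ρ * ∫⁻ ω in A n, V ω ∂P) := by
          gcongr
          exact hU.trans (by gcongr)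
      _ = ∫⁻ ω in A n, C * V ω ∂P := by
          rw [lintegral_const_mul _ hVm, hC]; ring

/-! ### Duality for UMD spaces. -/

section Duality

variable {Ω : Type*} {m : MeasurableSpace Ω} {P : Measure Ω} {X Y : Type*} [NormedAddCommGroup X]
  [NormedSpace ℝ X] [NormedAddCommGroup Y] [NormedSpace ℝ Y] {p q : ℝ≥0∞}
  [ENNReal.HolderConjugate p q]

theorem integrable_bilin (B : X →L[ℝ] Y →L[ℝ] ℝ) {f : Ω → X} {g : Ω → Y} (hf : MemLp f p P)
    (hg : MemLp g q P) : Integrable (fun ω => B (f ω) (g ω)) P :=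
  memLp_one_iff_integrable.1 (B.memLp_of_bilin (p := p) (q := q) 1 hf hg)

theorem abs_integral_bilin_le (B : X →L[ℝ] Y →L[ℝ] ℝ) (hB : ∀ x y, |B x y| ≤ ‖x‖ * ‖y‖)
    {f : Ω → X} {g : Ω → Y} (hf : MemLp f p P) (hg : MemLp g q P) :
    |∫ ω, B (f ω) (g ω) ∂P| ≤ (eLpNorm f p P).toReal * (eLpNorm g q P).toReal := by
  have h1 : eLpNorm (fun ω => B (f ω) (g ω)) 1 P ≤ (1 : ℝ≥0) * eLpNorm f p P * eLpNorm g q P :=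
    eLpNorm_le_eLpNorm_mul_eLpNorm'_of_norm hf.1 hg.1 (fun x y => B x y) 1
      (ae_of_all _ fun ω => by simpa using hB (f ω) (g ω))
  rw [← Real.norm_eq_abs, ← ENNReal.toReal_mul]
  refine (norm_integral_le_lintegral_norm _).trans
    (ENNReal.toReal_mono (ENNReal.mul_ne_top hf.2.ne hg.2.ne) ?_)
  simp_rw [ofReal_norm]
  simpa [eLpNorm_one_eq_lintegral_enorm] using h1

/-- A function is controlled in `L^p` by its pairings with simple functions. -/
theorem eLpNorm_le_of_forall_simpleFunc [IsFiniteMeasure P] (hp1 : 1 < p) (hp : p < ∞)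
    (hq : q < ∞)
    (B : X →L[ℝ] Y →L[ℝ] ℝ) (hB : ∀ x y, |B x y| ≤ ‖x‖ * ‖y‖)
    (hn : ∀ x, ∃ y, ‖y‖ ≤ 1 ∧ ‖x‖ / 2 ≤ B x y) {f : Ω → X} (hf : MemLp f p P) {K : ℝ}
    (hK : 0 ≤ K)
    (h : ∀ g : SimpleFunc Ω Y, ∫ ω, B (f ω) (g ω) ∂P ≤ K * (eLpNorm g q P).toReal) :
    (eLpNorm f p P).toReal ≤ 8 * K := by
  set a := (eLpNorm f p P).toReal with ha
  have ha0 : 0 ≤ a := ENNReal.toReal_nonneg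
  rcases ha0.eq_or_lt with h0 | h0
  · rw [← h0]; positivity
  have hp0 : p ≠ 0 := (zero_lt_one.trans hp1).ne'
  have hq0 : q ≠ 0 := ENNReal.HolderConjugate.ne_zero q p
  have hπ1 : 1 < p.toReal := by simpa using ENNReal.toReal_strict_mono hp.ne hp1
  have hc : p.toReal.HolderConjugate q.toReal := ENNReal.HolderConjugate.toReal hπ1
  -- A simple function makes the choice of a nearly norming `y x` measurable at no cost. An error of
  -- `a / 8` is small enough to be absorbed at the end.
  obtain ⟨S, hS, hSp⟩ := hf.exists_simpleFunc_eLpNorm_sub_lt hp.ne (ε := ENNReal.ofReal (a / 8))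
    (by simpa using h0)
  choose y hy1 hy2 using hn
  -- The Hölder extremizer up to the factor `1 / 2`: `‖g‖_q ≤ s ^ (p - 1)`, and its pairing with `S`
  -- is at least `s ^ p / 2`.
  set g : SimpleFunc Ω Y := S.map fun x => ‖x‖ ^ (p.toReal - 1) • y x with hg
  set s := (eLpNorm S p P).toReal with hs
  have hgq : MemLp g q P := g.memLp_of_isFiniteMeasure q P
  have hsub : (eLpNorm (⇑S - f) p P).toReal ≤ a / 8 := by
    rw [eLpNorm_sub_comm]
    exact ENNReal.toReal_le_of_le_ofReal (by positivity) hS.le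
  have h1 : ∫ ω, ‖S ω‖ ^ p.toReal ∂P = s ^ p.toReal := by
    rw [hs, hSp.eLpNorm_eq_integral_rpow_norm hp0 hp.ne, ENNReal.toReal_ofReal (by positivity),
      ← Real.rpow_mul (integral_nonneg fun _ => by positivity), inv_mul_cancel₀ (by positivity),
      Real.rpow_one]
  have h2 : (eLpNorm g q P).toReal ≤ s ^ (p.toReal - 1) := by
    rw [hgq.eLpNorm_eq_integral_rpow_norm hq0 hq.ne, ENNReal.toReal_ofReal (by positivity)]
    have h3 : ∫ ω, ‖g ω‖ ^ q.toReal ∂P ≤ ∫ ω, ‖S ω‖ ^ p.toReal ∂P := by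
      refine integral_mono (hgq.integrable_norm_rpow hq0 hq.ne)
        (hSp.integrable_norm_rpow hp0 hp.ne) fun ω => ?_
      have h4 : ‖g ω‖ ≤ ‖S ω‖ ^ (p.toReal - 1) := by
        simp only [hg, SimpleFunc.map_apply, norm_smul]
        rw [Real.norm_of_nonneg (by positivity)]
        exact mul_le_of_le_one_right (by positivity) (hy1 _)
      calc ‖g ω‖ ^ q.toReal ≤ (‖S ω‖ ^ (p.toReal - 1)) ^ q.toReal := by gcongr
        _ = ‖S ω‖ ^ p.toReal := by
          rw [← Real.rpow_mul (norm_nonneg _), hc.sub_one_mul_conj]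
    rw [h1] at h3
    calc (∫ ω, ‖g ω‖ ^ q.toReal ∂P) ^ q.toReal⁻¹ ≤ (s ^ p.toReal) ^ q.toReal⁻¹ := by
          gcongr
      _ = s ^ (p.toReal - 1) := by
          rw [← Real.rpow_mul ENNReal.toReal_nonneg]
          congr 1
          rw [← div_eq_mul_inv, hc.div_conj_eq_sub_one]
  have h3 : s ^ p.toReal / 2 ≤ (K + a / 8) * s ^ (p.toReal - 1) := by
    have h4 : ∫ ω, ‖S ω‖ ^ p.toReal / 2 ∂P ≤ ∫ ω, B (S ω) (g ω) ∂P := by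
      refine integral_mono ((hSp.integrable_norm_rpow hp0 hp.ne).div_const 2)
        (integrable_bilin B hSp hgq) fun ω => ?_
      simp only [hg, SimpleFunc.map_apply, map_smul, smul_eq_mul]
      calc ‖S ω‖ ^ p.toReal / 2 = ‖S ω‖ ^ (p.toReal - 1) * (‖S ω‖ / 2) := by
            rcases eq_or_ne ‖S ω‖ 0 with h5 | h5
            · rw [h5, Real.zero_rpow (by positivity)]; simp
            · rw [mul_div_assoc', ← Real.rpow_add_one h5]; ring_nf
        _ ≤ _ := by gcongr; exact hy2 _
    have h5 : ∫ ω, B (S ω) (g ω) ∂P = ∫ ω, B (f ω) (g ω) ∂P + ∫ ω, B ((⇑S - f) ω) (g ω) ∂P := by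
      rw [← integral_add (integrable_bilin B hf hgq) (integrable_bilin B (hSp.sub hf) hgq)]
      refine integral_congr_ae (ae_of_all _ fun ω => ?_)
      simp
    have h6 := (le_abs_self _).trans (abs_integral_bilin_le B hB (hSp.sub hf) hgq)
    have h7 : (eLpNorm (⇑S - f) p P).toReal * (eLpNorm g q P).toReal
        ≤ a / 8 * (eLpNorm g q P).toReal := by gcongr
    rw [integral_div, h1] at h4
    calc s ^ p.toReal / 2 ≤ (K + a / 8) * (eLpNorm g q P).toReal := by linarith [h g]
      _ ≤ _ := by gcongr
  have h4 : s ≤ 2 * (K + a / 8) := by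
    have hs0 : 0 ≤ s := ENNReal.toReal_nonneg
    rcases hs0.eq_or_lt with h5 | h5
    · rw [← h5]; positivity
    · have h6 : s ^ p.toReal = s ^ (p.toReal - 1) * s := by
        rw [← Real.rpow_add_one h5.ne']; ring_nf
      rw [h6] at h3
      have h7 : 0 < s ^ (p.toReal - 1) := by positivity
      have h8 : s / 2 * s ^ (p.toReal - 1) ≤ (K + a / 8) * s ^ (p.toReal - 1) := by linarith
      linarith [le_of_mul_le_mul_right h8 h7]
  have h5 : a ≤ s + a / 8 := by
    have h6 : eLpNorm f p P ≤ eLpNorm S p P + eLpNorm (f - ⇑S) p P := by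
      have := eLpNorm_add_le hSp.1 (hf.sub hSp).1 hp1.le
      simpa using this
    have h7 := ENNReal.toReal_mono (ENNReal.add_ne_top.2 ⟨hSp.2.ne, (hf.sub hSp).2.ne⟩) h6
    rw [ENNReal.toReal_add hSp.2.ne (hf.sub hSp).2.ne, ← eLpNorm_sub_comm] at h7
    linarith
  linarith

variable {ℱ : Filtration ℕ m}

/-- The martingale differences of a closed martingale. -/
noncomputable def closedDiff (P : Measure Ω) (ℱ : Filtration ℕ m) (g : Ω → Y) (n : ℕ) : Ω → Y :=
  n.casesOn (P[g | ℱ 0]) fun k => P[g | ℱ (k + 1)] - P[g | ℱ k]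

theorem sum_closedDiff (g : Ω → Y) (n : ℕ) (ω : Ω) :
    ∑ k ∈ Finset.range (n + 1), closedDiff P ℱ g k ω = P[g | ℱ n] ω := by
  induction n with
  | zero => simp [closedDiff]
  | succ n ih => rw [Finset.sum_range_succ, ih]; simp [closedDiff]

variable [CompleteSpace X] [CompleteSpace Y]

theorem isMartingaleDiff_closedDiff [IsFiniteMeasure P] {g : Ω → Y} (hq : 1 ≤ q)
    (hg : MemLp g q P) : IsMartingaleDiff P ℱ q (closedDiff P ℱ g) := by
  refine ⟨fun n => ?_, fun n => ?_, fun n => ?_⟩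
  · cases n with
    | zero => exact stronglyMeasurable_condExp
    | succ k =>
      exact stronglyMeasurable_condExp.sub
        (stronglyMeasurable_condExp.mono (ℱ.mono (Nat.le_succ k)))
  · cases n with
    | zero => exact hg.condExp hq
    | succ k => exact (hg.condExp hq).sub (hg.condExp hq)
  · refine (condExp_sub integrable_condExp integrable_condExp (ℱ n)).trans ?_
    have h1 := condExp_condExp_of_le (f := g) (μ := P) (ℱ.mono (Nat.le_succ n)) (ℱ.le (n + 1))
    have h2 := condExp_condExp_of_le (f := g) (μ := P) (le_refl (ℱ n)) (ℱ.le n)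
    filter_upwards [h1, h2] with ω h1 h2
    simp [h1, h2]

/-- If `k ≤ j`, then `d k` is `ℱ j`-measurable and the conditioning on `g` can be dropped. If `k >
j`, conditioning on `ℱ (k - 1)` fixes the second factor and kills `d k`. -/
theorem integral_bilin_condExp [IsFiniteMeasure P] (B : X →L[ℝ] Y →L[ℝ] ℝ) {d : ℕ → Ω → X}
    (hd : IsMartingaleDiff P ℱ p d) {g : Ω → Y} (hg : MemLp g q P) (k j : ℕ) :
    ∫ ω, B (d k ω) (P[g | ℱ j] ω) ∂P = if k ≤ j then ∫ ω, B (d k ω) (g ω) ∂P else 0 := by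
  have hp1 : 1 ≤ p := ENNReal.HolderConjugate.one_le p q
  have hq1 : 1 ≤ q := ENNReal.HolderConjugate.one_le q p
  split_ifs with h
  · rw [← integral_condExp (ℱ.le j) (f := fun ω => B (d k ω) (g ω))]
    exact integral_congr_ae (condExp_bilin_of_stronglyMeasurable_left B
      ((hd.1 k).mono (ℱ.mono h)) (integrable_bilin B (hd.2 k) hg) (hg.integrable hq1)).symm
  · obtain ⟨i, rfl⟩ : ∃ i, k = i + 1 := ⟨k - 1, by omega⟩
    rw [← integral_condExp (ℱ.le i)]
    have h1 := condExp_bilin_of_stronglyMeasurable_right (m := ℱ i) B (f := d (i + 1))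
      (g := P[g | ℱ j]) (stronglyMeasurable_condExp.mono (ℱ.mono (by omega)))
      (integrable_bilin B (hd.2 _) (hg.condExp hq1)) (hd.integrable hp1 _)
    rw [integral_congr_ae h1]
    refine integral_eq_zero_of_ae ?_
    filter_upwards [hd.3 i] with ω h2
    simp [h2]

/-- Differences of distinct index are orthogonal. Only the diagonal of a double sum survives, which
lets signs move from one factor of the pairing to the other. -/
theorem integral_bilin_closedDiff [IsFiniteMeasure P] (B : X →L[ℝ] Y →L[ℝ] ℝ) {d : ℕ → Ω → X}
    (hd : IsMartingaleDiff P ℱ p d) {g : Ω → Y} (hg : MemLp g q P) (k j : ℕ) :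
    ∫ ω, B (d k ω) (closedDiff P ℱ g j ω) ∂P
      = if k = j then ∫ ω, B (d k ω) (g ω) ∂P else 0 := by
  have hq1 : 1 ≤ q := ENNReal.HolderConjugate.one_le q p
  cases j with
  | zero =>
    have := integral_bilin_condExp B hd hg k 0
    simpa [closedDiff] using this
  | succ j =>
    simp only [closedDiff, Pi.sub_apply, map_sub]
    rw [integral_sub (integrable_bilin B (hd.2 _) (hg.condExp hq1))
      (integrable_bilin B (hd.2 _) (hg.condExp hq1)), integral_bilin_condExp B hd hg,
      integral_bilin_condExp B hd hg]
    by_cases h1 : k ≤ j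
    · simp [h1, h1.trans (Nat.le_succ j), (Nat.lt_succ_of_le h1).ne]
    · by_cases h2 : k = j + 1
      · simp [h2]
      · have h3 : ¬ k ≤ j + 1 := by omega
        simp [h1, h2, h3]

end Duality

/-- The UMD property passes through a norming duality. -/
theorem UMDAt.of_norming {X Y : Type v} [NormedAddCommGroup X] [NormedSpace ℝ X] [CompleteSpace X]
    [NormedAddCommGroup Y] [NormedSpace ℝ Y] [CompleteSpace Y] {p q : ℝ≥0∞}
    [ENNReal.HolderConjugate p q] (hp1 : 1 < p) (hp : p < ∞) (hY : UMDAt.{u, v} Y q)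
    (B : X →L[ℝ] Y →L[ℝ] ℝ) (hB : ∀ x y, |B x y| ≤ ‖x‖ * ‖y‖)
    (hn : ∀ x, ∃ y, ‖y‖ ≤ 1 ∧ ‖x‖ / 2 ≤ B x y) : UMDAt.{u, v} X p := by
  obtain ⟨β, hβ⟩ := hY
  have hq : q < ∞ := (ENNReal.HolderConjugate.lt_top_iff_one_lt q p).2 hp1
  have hq1 : 1 ≤ q := ENNReal.HolderConjugate.one_le q p
  refine ⟨8 * β, fun Ω m P _ ℱ d hd ε hε n => ?_⟩
  cases n with
  | zero => simp
  | succ n =>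
  have hT := (hd.smul ε).memLp_sum (n + 1)
  have hS := hd.memLp_sum (n + 1)
  set T : Ω → X := fun ω => ∑ k ∈ Finset.range (n + 1), ε k • d k ω with hTdef
  set S : Ω → X := fun ω => ∑ k ∈ Finset.range (n + 1), d k ω with hSdef
  have key := eLpNorm_le_of_forall_simpleFunc hp1 hp hq B hB hn hT
    (K := β * (eLpNorm S p P).toReal) (by positivity) ?_
  · rw [← ENNReal.ofReal_toReal hT.2.ne, ← ENNReal.ofReal_toReal hS.2.ne]
    refine (ENNReal.ofReal_le_ofReal key).trans (le_of_eq ?_)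
    rw [← mul_assoc, ENNReal.ofReal_mul (by positivity)]
    congr 1
    rw [ENNReal.ofReal_mul (by norm_num)]
    simp
  · intro g
    have hg : MemLp g q P := g.memLp_of_isFiniteMeasure q P
    have he : IsMartingaleDiff P ℱ q (closedDiff P ℱ g) := isMartingaleDiff_closedDiff hq1 hg
    set e := closedDiff P ℱ g with hedef
    have hV := (he.smul ε).memLp_sum (n + 1)
    set V : Ω → Y := fun ω => ∑ k ∈ Finset.range (n + 1), ε k • e k ω with hVdef
    have h1 : ∫ ω, B (T ω) (g ω) ∂P
        = ∑ k ∈ Finset.range (n + 1), ε k * ∫ ω, B (d k ω) (g ω) ∂P := by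
      simp only [hTdef, map_sum, map_smul, sum_apply,
        smul_apply, smul_eq_mul]
      rw [integral_finsetSum _ fun k _ => (integrable_bilin B (hd.2 k) hg).const_mul _]
      simp_rw [integral_const_mul]
    -- The signs now sit on the differences of `g`, where UMD of `Y` applies, and `S` is free of
    -- them.
    have h2 : ∫ ω, B (S ω) (V ω) ∂P
        = ∑ k ∈ Finset.range (n + 1), ε k * ∫ ω, B (d k ω) (g ω) ∂P := by
      simp only [hSdef, hVdef, map_sum, map_smul, sum_apply, smul_eq_mul,
        Finset.mul_sum]
      rw [integral_finsetSum _ fun k _ => integrable_finsetSum _ fun j _ =>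
        (integrable_bilin B (hd.2 j) (he.2 k)).const_mul _]
      refine Finset.sum_congr rfl fun k hk => ?_
      rw [integral_finsetSum _ fun j _ =>
        (integrable_bilin B (hd.2 j) (he.2 k)).const_mul _]
      simp_rw [integral_const_mul, hedef, integral_bilin_closedDiff B hd hg]
      rw [Finset.sum_eq_single k]
      · simp
      · intro j _ hj; simp [hj]
      · intro h; exact absurd hk h
    -- The untransformed sum is a conditional expectation of `g`, hence a contraction of `g` in
    -- `L^q`.
    have h3 : eLpNorm V q P ≤ β * eLpNorm g q P := by
      refine (hβ Ω P ℱ e he ε hε (n + 1)).trans ?_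
      gcongr
      simp_rw [hedef, sum_closedDiff]
      exact eLpNorm_condExp_le_eLpNorm _ hq1
    have h4 : (eLpNorm V q P).toReal ≤ β * (eLpNorm g q P).toReal := by
      have := ENNReal.toReal_mono (ENNReal.mul_ne_top ENNReal.coe_ne_top hg.2.ne) h3
      simpa using this
    rw [h1, ← h2]
    calc ∫ ω, B (S ω) (V ω) ∂P ≤ (eLpNorm S p P).toReal * (eLpNorm V q P).toReal :=
          (le_abs_self _).trans (abs_integral_bilin_le B hB hS hV)
      _ ≤ (eLpNorm S p P).toReal * (β * (eLpNorm g q P).toReal) := by gcongr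
      _ = _ := by ring

/-- A UMD space has the UMD property at every exponent. -/
theorem IsUMD.umdAt {X : Type v} [NormedAddCommGroup X] [NormedSpace ℝ X] [CompleteSpace X]
    (hX : IsUMD.{u, v} X) {p q : ℝ≥0∞} [ENNReal.HolderConjugate p q] (hp1 : 1 < p) (hp : p < ∞) :
    UMDAt.{u, v} X p := by
  obtain ⟨r, hr1, hr, hXr⟩ := hX.exists_umdAt
  rcases lt_trichotomy r p with h | h | h
  · exact hXr.mono hr1.le h hp
  · rwa [← h]
  -- For `p < r`, the dual space is UMD at `s = r'`, which is less than `q`. Extrapolation upwards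
  -- reaches `q`, and duality comes back to `X` at `p`. Reflexivity plays no role, since `X` is
  -- normed by its dual.
  · have : r.HolderConjugate r.conjExponent := ENNReal.HolderConjugate.conjExponent hr1.le
    set s := r.conjExponent with hs
    have hs1 : 1 < s := (ENNReal.HolderConjugate.lt_top_iff_one_lt r s).1 hr
    have hst : s < ∞ := (ENNReal.HolderConjugate.lt_top_iff_one_lt s r).2 hr1
    have hq1 : 1 < q := (ENNReal.HolderConjugate.lt_top_iff_one_lt p q).1 hp
    have hqt : q < ∞ := (ENNReal.HolderConjugate.lt_top_iff_one_lt q p).2 hp1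
    have hsq : s < q := by
      rw [← ENNReal.inv_lt_inv]
      by_contra hc
      have h1 := ENNReal.add_lt_add_of_lt_of_le (ENNReal.inv_ne_top.2
        (zero_lt_one.trans hs1).ne') (ENNReal.inv_lt_inv.2 h) (not_lt.1 hc)
      rw [ENNReal.HolderConjugate.inv_add_inv_eq_one, ENNReal.HolderConjugate.inv_add_inv_eq_one]
        at h1
      exact lt_irrefl _ h1
    have hD : UMDAt.{u, v} (StrongDual ℝ X) s := by
      refine hXr.of_norming (Y := X) hs1 hst (ContinuousLinearMap.id ℝ (StrongDual ℝ X))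
        (fun f x => f.le_opNorm x) fun f => ?_
      rcases (norm_nonneg f).eq_or_lt with h0 | h0
      · exact ⟨0, by simp, by simp [← h0]⟩
      · obtain ⟨x, hx1, hx2⟩ := f.exists_lt_apply_of_lt_opNorm (half_lt_self h0)
        rcases le_total 0 (f x) with h2 | h2
        · refine ⟨x, hx1.le, ?_⟩
          rw [Real.norm_of_nonneg h2] at hx2
          exact hx2.le
        · refine ⟨-x, by simpa using hx1.le, ?_⟩
          rw [Real.norm_of_nonpos h2] at hx2
          simpa using hx2.le
    have hDq : UMDAt.{u, v} (StrongDual ℝ X) q := hD.mono hs1.le hsq hqt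
    refine hDq.of_norming hp1 hp (NormedSpace.inclusionInDoubleDual ℝ X) (fun x f => ?_)
      fun x => ?_
    · rw [mul_comm]; exact f.le_opNorm x
    · obtain ⟨f, hf1, hf2⟩ := exists_dual_vector'' ℝ x
      refine ⟨f, hf1, ?_⟩
      rw [NormedSpace.dual_def, hf2]
      simp

/-! ### Independence over disjoint regions -/

section Region

variable {Ω : Type u} {E : Type w} [MeasurableSpace E] {N : Ω → Measure E}

/-- The σ-algebra generated by the variables `N(B)`, `B ⊆ U`. -/
@[reducible] def regionSigma (N : Ω → Measure E) (U : Set E) : MeasurableSpace Ω :=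
  ⨆ (B : Set E) (_ : MeasurableSet B ∧ B ⊆ U), MeasurableSpace.comap (fun ω => N ω B) inferInstance

theorem measurable_regionSigma {U B : Set E} (hB : MeasurableSet B) (hU : B ⊆ U) :
    Measurable[regionSigma N U] fun ω => N ω B :=
  Measurable.of_comap_le (le_iSup₂_of_le B ⟨hB, hU⟩ le_rfl)

theorem regionSigma_mono {U V : Set E} (h : U ⊆ V) : regionSigma N U ≤ regionSigma N V :=
  iSup₂_le fun _ hB => (measurable_regionSigma hB.1 (hB.2.trans h)).comap_le

/-- A finite family of sets is refined by a finite family of disjoint sets. -/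
theorem exists_atoms {n : ℕ} (B : Fin n → Set E) (hB : ∀ k, MeasurableSet (B k)) :
    ∃ a : (Fin n → Bool) → Set E, (∀ σ, MeasurableSet (a σ)) ∧
      Pairwise (fun σ τ => Disjoint (a σ) (a τ)) ∧ (∀ σ, a σ ⊆ ⋃ k, B k) ∧
      ∀ k, B k = ⋃ σ ∈ Finset.univ.filter (fun σ : Fin n → Bool => σ k = true), a σ := by
  classical
  -- The atom of `σ` consists of the points with membership pattern `σ`. Cutting with the union
  -- empties the all-false pattern, so every atom stays in the union.
  refine ⟨fun σ => {x | x ∈ ⋃ k, B k} ∩ ⋂ k, {x | x ∈ B k ↔ σ k = true}, fun σ => ?_, ?_, ?_, ?_⟩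
  · refine (MeasurableSet.iUnion hB).inter (MeasurableSet.iInter fun k => ?_)
    by_cases h : σ k = true
    · simpa [h] using hB k
    · have : {x | x ∈ B k ↔ σ k = true} = (B k)ᶜ := by ext x; simp [h]
      rw [this]
      exact (hB k).compl
  · intro σ τ hστ
    refine Set.disjoint_left.2 fun x hx hx' => hστ (funext fun k => ?_)
    have h1 := Set.mem_iInter.1 hx.2 k
    have h2 := Set.mem_iInter.1 hx'.2 k
    exact Bool.eq_iff_iff.2 (h1.symm.trans h2)
  · exact fun σ x hx => hx.1
  · intro k
    ext x
    simp only [Finset.mem_filter, Finset.mem_univ, true_and, Set.mem_iUnion, exists_prop]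
    constructor
    · intro hx
      refine ⟨fun j => decide (x ∈ B j), by simpa using hx, ⟨k, hx⟩,
        Set.mem_iInter.2 fun j => ?_⟩
      simp
    · rintro ⟨σ, hσ, -, hx⟩
      exact (Set.mem_iInter.1 hx k).2 hσ

variable [mΩ : MeasurableSpace Ω] {μ : Measure E} {P : Measure Ω}

theorem regionSigma_le (hN : IsPoissonRandomMeasure N μ P) (U : Set E) :
    regionSigma N U ≤ mΩ :=
  iSup₂_le fun B hB => (hN.measurable_apply B hB.1).comap_le

theorem IsPoissonRandomMeasure.iIndepFun_of_fintype (hN : IsPoissonRandomMeasure N μ P)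
    {ι : Type*} [Fintype ι] (B : ι → Set E) (hB : ∀ i, MeasurableSet (B i))
    (hd : Pairwise fun i j => Disjoint (B i) (B j)) : iIndepFun (fun i ω => N ω (B i)) P := by
  have h := hN.indep (Fintype.card ι) (fun i => B ((Fintype.equivFin ι).symm i)) (fun i => hB _)
    fun i j hij => hd fun h => hij ((Fintype.equivFin ι).symm.injective h)
  have h2 := h.precomp (Fintype.equivFin ι).injective
  simpa using h2

/-- The σ-algebras generated by `N` on disjoint regions are independent. -/
theorem IsPoissonRandomMeasure.indep_regionSigma [IsProbabilityMeasure P]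
    (hN : IsPoissonRandomMeasure N μ P) {U V : Set E} (hUV : Disjoint U V) :
    Indep (regionSigma N U) (regionSigma N V) P := by
  classical
  -- Each region σ-algebra is the supremum of those generated by finite families of sets. These are
  -- directed by concatenation, so independence reduces to two finite families.
  let I : Set E → Type w := fun U => Σ n : ℕ, {B : Fin n → Set E //
    ∀ k, MeasurableSet (B k) ∧ B k ⊆ U}
  let σ : ∀ U, I U → MeasurableSpace Ω := fun U i =>
    ⨆ k, MeasurableSpace.comap (fun ω => N ω (i.2.1 k)) inferInstance
  have hσ : ∀ U, regionSigma N U = ⨆ i, σ U i := fun U => by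
    refine le_antisymm (iSup₂_le fun B hB => ?_) (iSup_le fun i => iSup_le fun k => ?_)
    · exact le_iSup_of_le ⟨1, fun _ => B, fun _ => hB⟩ (le_iSup_of_le (0 : Fin 1) le_rfl)
    · exact (measurable_regionSigma (i.2.2 k).1 (i.2.2 k).2).comap_le
  have hle : ∀ U i, σ U i ≤ mΩ := fun U i => iSup_le fun k =>
    (hN.measurable_apply _ (i.2.2 k).1).comap_le
  have hdir : ∀ U, Directed (· ≤ ·) (σ U) := fun U i j => by
    refine ⟨⟨i.1 + j.1, Fin.append i.2.1 j.2.1, fun k => ?_⟩, ?_, ?_⟩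
    · refine Fin.addCases (fun k => ?_) (fun k => ?_) k
      · rw [Fin.append_left]; exact i.2.2 k
      · rw [Fin.append_right]; exact j.2.2 k
    · refine iSup_le fun k => le_iSup_of_le (Fin.castAdd _ k) ?_
      simp only [Fin.append_left]; exact le_rfl
    · refine iSup_le fun k => le_iSup_of_le (Fin.natAdd _ k) ?_
      simp only [Fin.append_right]; exact le_rfl
  -- Refined to atoms, the two families together are pairwise disjoint, so their counts are
  -- independent, and every original count is a sum of atomic ones.
  have hfin : ∀ i j, Indep (σ U i) (σ V j) P := by
    rintro ⟨n, B, hB⟩ ⟨n', B', hB'⟩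
    obtain ⟨a, ha1, ha2, ha3, ha4⟩ := exists_atoms B fun k => (hB k).1
    obtain ⟨a', ha1', ha2', ha3', ha4'⟩ := exists_atoms B' fun k => (hB' k).1
    have haU : ∀ s, a s ⊆ U := fun s => (ha3 s).trans (Set.iUnion_subset fun k => (hB k).2)
    have haV : ∀ s, a' s ⊆ V := fun s => (ha3' s).trans (Set.iUnion_subset fun k => (hB' k).2)
    have hm : ∀ s, MeasurableSet (Sum.elim a a' s) := by rintro (s | s) <;> simp [ha1, ha1']
    have hind := hN.iIndepFun_of_fintype (Sum.elim a a') hm (by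
      rintro (s | s) (t | t) hst
      · exact ha2 fun h => hst (by rw [h])
      · exact hUV.mono (haU s) (haV t)
      · exact (hUV.mono (haU t) (haV s)).symm
      · exact ha2' fun h => hst (by rw [h]))
    have h1 := indep_iSup_of_disjoint (fun s => (hN.measurable_apply _ (hm s)).comap_le) hind
      (S := Set.range Sum.inl) (T := Set.range Sum.inr) (by
        rw [Set.disjoint_left]; rintro _ ⟨x, rfl⟩ ⟨y, hy⟩; cases hy)
    refine indep_of_indep_of_le_right (indep_of_indep_of_le_left h1 ?_) ?_
    · refine iSup_le fun k => Measurable.comap_le ?_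
      have : (fun ω => N ω (B k)) = fun ω =>
          ∑ s ∈ Finset.univ.filter (fun s : Fin n → Bool => s k = true), N ω (a s) := by
        funext ω
        conv_lhs => rw [ha4 k]
        exact measure_biUnion_finset (fun s _ t _ hst => ha2 hst) fun s _ => ha1 s
      simp only [this]
      refine Finset.measurable_fun_sum _ fun s _ => Measurable.of_comap_le ?_
      exact le_iSup₂_of_le (Sum.inl s) ⟨s, rfl⟩ le_rfl
    · refine iSup_le fun k => Measurable.comap_le ?_
      have : (fun ω => N ω (B' k)) = fun ω =>
          ∑ s ∈ Finset.univ.filter (fun s : Fin n' → Bool => s k = true), N ω (a' s) := by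
        funext ω
        conv_lhs => rw [ha4' k]
        exact measure_biUnion_finset (fun s _ t _ hst => ha2' hst) fun s _ => ha1' s
      simp only [this]
      refine Finset.measurable_fun_sum _ fun s _ => Measurable.of_comap_le ?_
      exact le_iSup₂_of_le (Sum.inr s) ⟨s, rfl⟩ le_rfl
  rw [hσ U, hσ V]
  refine indep_iSup_of_directed_le (fun i => ?_) (hle U) (iSup_le (hle V)) (hdir U)
  exact (indep_iSup_of_directed_le (fun j => (hfin i j).symm) (hle V) (hle U i) (hdir V)).symm

end Region

/-! ### Stein's identity for the Poisson distribution -/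

section Stein

variable {Ω : Type u} {m : MeasurableSpace Ω} [mΩ : MeasurableSpace Ω] {P : Measure Ω}
  {Z : Ω → ℕ} {r : ℝ≥0}

/-- On `{Z = k}` the integrand is `h k`, which is independent of that event. -/
theorem lintegral_comp_eq_tsum (hm : m ≤ mΩ) (hZ : Measurable Z)
    (hlaw : P.map Z = poissonMeasure r)
    (hind : Indep (MeasurableSpace.comap Z inferInstance) m P) {h : ℕ → Ω → ℝ≥0∞}
    (hh : ∀ k, Measurable[m] (h k)) :
    ∫⁻ ω, h (Z ω) ω ∂P = ∑' k, poissonMeasure r {k} * ∫⁻ ω, h k ω ∂P := by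
  have hs : ∀ k, MeasurableSet (Z ⁻¹' {k}) := fun k => hZ (measurableSet_singleton k)
  have h1 : ∀ ω, h (Z ω) ω = ∑' k, (Z ⁻¹' {k}).indicator (fun _ => 1) ω * h k ω := fun ω => by
    rw [tsum_eq_single (Z ω)]
    · simp
    · intro k hk
      have : ω ∉ Z ⁻¹' {k} := fun h => hk (by simpa using h.symm)
      simp [this]
  simp_rw [h1]
  rw [lintegral_tsum (f := fun k ω => (Z ⁻¹' {k}).indicator (fun _ => 1) ω * h k ω) fun k =>
    ((measurable_const.indicator (hs k)).mul ((hh k).mono hm le_rfl)).aemeasurable]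
  congr 1
  funext k
  rw [lintegral_mul_eq_lintegral_mul_lintegral_of_independent_measurableSpace hZ.comap_le hm hind
    (measurable_const.indicator ⟨{k}, measurableSet_singleton k, rfl⟩) (hh k),
    lintegral_indicator_const (hs k), one_mul, ← hlaw,
    Measure.map_apply hZ (measurableSet_singleton k)]

/-- This recurrence of the Poisson weights, summed over `k`, is Stein's identity. -/
theorem succ_mul_poissonMeasure_singleton (r : ℝ≥0) (k : ℕ) :
    ((k + 1 : ℕ) : ℝ≥0∞) * poissonMeasure r {k + 1} = r * poissonMeasure r {k} := by
  rw [poissonMeasure_singleton, poissonMeasure_singleton, ← ENNReal.ofReal_natCast,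
    ← ENNReal.ofReal_coe_nnreal, ← ENNReal.ofReal_mul (by positivity),
    ← ENNReal.ofReal_mul (by positivity), Nat.factorial_succ, pow_succ]
  congr 1
  push_cast
  have : (k.factorial : ℝ) ≠ 0 := by positivity
  field_simp

/-- The factor `Z` removes the term `k = 0`, and the recurrence moves the weight of `k + 1` to `k`.
For nonnegative functions no integrability is involved. -/
theorem lintegral_stein (hm : m ≤ mΩ) (hZ : Measurable Z)
    (hlaw : P.map Z = poissonMeasure r)
    (hind : Indep (MeasurableSpace.comap Z inferInstance) m P) {h : ℕ → Ω → ℝ≥0∞}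
    (hh : ∀ k, Measurable[m] (h k)) :
    ∫⁻ ω, (Z ω : ℝ≥0∞) * h (Z ω) ω ∂P = ∫⁻ ω, r * h (Z ω + 1) ω ∂P := by
  rw [lintegral_comp_eq_tsum (h := fun k ω => (k : ℝ≥0∞) * h k ω) hm hZ hlaw hind
      fun k => (hh k).const_mul _,
    lintegral_comp_eq_tsum (h := fun k ω => (r : ℝ≥0∞) * h (k + 1) ω) hm hZ hlaw hind
      fun k => (hh (k + 1)).const_mul _, tsum_eq_zero_add' ENNReal.summable]
  simp only [Nat.cast_zero, zero_mul, lintegral_zero, mul_zero, zero_add]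
  congr 1
  funext k
  rw [lintegral_const_mul _ ((hh _).mono hm le_rfl), lintegral_const_mul _ ((hh _).mono hm le_rfl),
    ← mul_assoc, ← mul_assoc, mul_comm (poissonMeasure r {k + 1}),
    succ_mul_poissonMeasure_singleton, mul_comm (r : ℝ≥0∞)]

/-- **Stein's identity**: `𝔼[Z h_Z] = r 𝔼[h_{Z + 1}]` for `Z` Poisson with parameter `r` and
independent of the random sequence `h`. -/
theorem integral_stein (hm : m ≤ mΩ) (hZ : Measurable Z)
    (hlaw : P.map Z = poissonMeasure r)
    (hind : Indep (MeasurableSpace.comap Z inferInstance) m P) {h : ℕ → Ω → ℝ}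
    (hh : ∀ k, Measurable[m] (h k)) (hi : Integrable (fun ω => (Z ω : ℝ) * h (Z ω) ω) P) :
    Integrable (fun ω => (r : ℝ) * h (Z ω + 1) ω) P ∧
      ∫ ω, (Z ω : ℝ) * h (Z ω) ω ∂P = ∫ ω, (r : ℝ) * h (Z ω + 1) ω ∂P := by
  have hmeas : Measurable fun ω => h (Z ω + 1) ω :=
    measurable_from_prod_countable_right (f := fun x : ℕ × Ω => h (x.1 + 1) x.2)
      (fun k => (hh (k + 1)).mono hm le_rfl) |>.comp (hZ.prodMk measurable_id)
  -- The values `c = 1` and `c = -1` give the positive and the negative parts.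
  have key : ∀ c : ℝ, ∫⁻ ω, ENNReal.ofReal (c * ((Z ω : ℝ) * h (Z ω) ω)) ∂P
      = ∫⁻ ω, ENNReal.ofReal (c * ((r : ℝ) * h (Z ω + 1) ω)) ∂P := fun c => by
    have h1 := lintegral_stein (h := fun k ω => ENNReal.ofReal (c * h k ω)) hm hZ hlaw hind
      fun k => ((hh k).const_mul c).ennreal_ofReal
    have e1 : ∀ (x : ℝ≥0) (y : ℝ), ENNReal.ofReal (c * ((x : ℝ) * y))
        = (x : ℝ≥0∞) * ENNReal.ofReal (c * y) := fun x y => by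
      rw [← ENNReal.ofReal_coe_nnreal, ← ENNReal.ofReal_mul x.coe_nonneg]; ring_nf
    have e2 : ∀ (n : ℕ) (y : ℝ), ENNReal.ofReal (c * ((n : ℝ) * y))
        = (n : ℝ≥0∞) * ENNReal.ofReal (c * y) := fun n y => by
      simpa using e1 n y
    simp_rw [e1, e2]
    exact h1
  -- Integrability of the shifted side is a consequence, by the nonnegative identity for `‖h‖`.
  have hi2 : Integrable (fun ω => (r : ℝ) * h (Z ω + 1) ω) P := by
    refine ⟨(hmeas.const_mul _).aestronglyMeasurable, ?_⟩
    have h1 := lintegral_stein (h := fun k ω => ‖h k ω‖ₑ) hm hZ hlaw hind fun k =>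
      measurable_enorm.comp (hh k)
    have h2 := hi.2
    rw [HasFiniteIntegral] at h2 ⊢
    simp only [enorm_mul] at h2 ⊢
    have e3 : ∀ n : ℕ, ‖(n : ℝ)‖ₑ = n := fun n => by
      rw [← ofReal_norm]; simp
    have e4 : ‖(r : ℝ)‖ₑ = r := by rw [← ofReal_norm]; simp
    simp only [e3, e4] at h2 ⊢
    rw [← h1]
    exact h2
  refine ⟨hi2, ?_⟩
  rw [integral_eq_lintegral_pos_part_sub_lintegral_neg_part hi,
    integral_eq_lintegral_pos_part_sub_lintegral_neg_part hi2]
  have h1 := key 1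
  have h2 := key (-1)
  simp only [one_mul, neg_mul] at h1 h2
  rw [h1, h2]

end Stein

/-! ### Decoupling -/

section CondExpZero

variable {Ω : Type*} {m : MeasurableSpace Ω} [m0 : MeasurableSpace Ω] {P : Measure Ω}
  [IsFiniteMeasure P] {X : Type*} [NormedAddCommGroup X] [NormedSpace ℝ X] [CompleteSpace X]

/-- A conditional expectation vanishes if it does so when tested on a generating π-system. -/
theorem condExp_eq_zero_of_isPiSystem (hm : m ≤ m0) {S : Set (Set Ω)}
    (hS : m = MeasurableSpace.generateFrom S) (hpi : IsPiSystem S) {f : Ω → X}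
    (hf : Integrable f P) (huniv : ∫ ω, f ω ∂P = 0) (h : ∀ s ∈ S, ∫ ω in s, f ω ∂P = 0) :
    P[f | m] =ᵐ[P] 0 := by
  have key : ∀ s, MeasurableSet[m] s → ∫ ω in s, f ω ∂P = 0 := by
    intro s hs
    induction s, hs using MeasurableSpace.induction_on_inter hS hpi with
    | empty => simp
    | basic t ht => exact h t ht
    | compl t ht ih =>
      have := integral_add_compl (hm t ht) hf
      rw [ih, huniv, zero_add] at this
      exact this
    | iUnion g hd hg ih =>
      rw [integral_iUnion (fun i => hm _ (hg i)) hd hf.integrableOn]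
      simp [ih]
  refine (ae_eq_condExp_of_forall_setIntegral_eq hm hf (g := 0)
    (fun s _ _ => integrable_zero _ _ _ |>.integrableOn) (fun s hs _ => ?_)
    stronglyMeasurable_zero.aestronglyMeasurable).symm
  rw [key s hs]
  simp

end CondExpZero

section Step

variable {Ω : Type u} {m : MeasurableSpace Ω} {T S : Type*} [MeasurableSpace T] [MeasurableSpace S]

/-- The σ-algebra generated by two copies of the past and by a function of the product space. -/
@[reducible] def doubledSigma (m : MeasurableSpace Ω) (η : Ω × Ω → T) : MeasurableSpace (Ω × Ω) :=
  (m.comap Prod.fst ⊔ m.comap Prod.snd) ⊔ MeasurableSpace.comap η inferInstance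

theorem measurable_fst_doubledSigma (η : Ω × Ω → T) :
    Measurable[doubledSigma m η, m] (Prod.fst : Ω × Ω → Ω) :=
  @Measurable.of_comap_le _ _ (doubledSigma m η) m _ (le_sup_left.trans le_sup_left)

theorem measurable_snd_doubledSigma (η : Ω × Ω → T) :
    Measurable[doubledSigma m η, m] (Prod.snd : Ω × Ω → Ω) :=
  @Measurable.of_comap_le _ _ (doubledSigma m η) m _ (le_sup_right.trans le_sup_left)

variable [m0 : MeasurableSpace Ω] {P : Measure Ω} [IsProbabilityMeasure P]

/-- Fubini's theorem, with the independence of `ξ` and the past used once in each copy. -/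
theorem integral_prod_mul_of_indep (hm : m ≤ m0) {ξ : Ω → S} (hξ : Measurable ξ)
    (hind : Indep (MeasurableSpace.comap ξ inferInstance) m P) {f g : Ω → ℝ}
    (hf : Measurable[m] f) (hg : Measurable[m] g) {w : S × S → ℝ} (hw : Measurable w)
    (hi : Integrable (fun z : Ω × Ω => f z.1 * (g z.2 * w (ξ z.1, ξ z.2))) (P.prod P))
    (hiw : Integrable (fun z : Ω × Ω => w (ξ z.1, ξ z.2)) (P.prod P)) :
    ∫ z, f z.1 * (g z.2 * w (ξ z.1, ξ z.2)) ∂(P.prod P)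
      = (∫ ω, f ω ∂P) * (∫ ω, g ω ∂P) * ∫ z, w (ξ z.1, ξ z.2) ∂(P.prod P) := by
  have hif : ∀ {a : Ω → ℝ} {b : S → ℝ}, Measurable[m] a → Measurable b →
      ∫ ω, a ω * b (ξ ω) ∂P = (∫ ω, a ω ∂P) * ∫ ω, b (ξ ω) ∂P := fun {a b} ha hb => by
    refine IndepFun.integral_fun_mul_eq_mul_integral ?_ (ha.mono hm le_rfl).aestronglyMeasurable
      (hb.comp hξ).aestronglyMeasurable
    rw [IndepFun_iff_Indep]
    refine indep_of_indep_of_le_left (indep_of_indep_of_le_right hind.symm ?_) ha.comap_le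
    exact (hb.comp (comap_measurable ξ)).comap_le
  rw [integral_prod _ hi, integral_prod _ hiw]
  have h1 : ∀ ω, ∫ ω', f ω * (g ω' * w (ξ ω, ξ ω')) ∂P
      = (∫ ω, g ω ∂P) * (f ω * ∫ ω', w (ξ ω, ξ ω') ∂P) := fun ω => by
    rw [integral_const_mul, hif hg (b := fun y => w (ξ ω, y)) (by fun_prop)]; ring
  simp_rw [h1]
  have hW : Measurable fun y => ∫ ω', w (y, ξ ω') ∂P :=
    (StronglyMeasurable.integral_prod_right (f := fun (y : S) (ω' : Ω) => w (y, ξ ω'))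
      (by apply Measurable.stronglyMeasurable; fun_prop)).measurable
  rw [integral_const_mul, hif hf hW]
  ring

theorem doubledSigma_le (hm : m ≤ m0) {η : Ω × Ω → T} (hη : Measurable η) :
    doubledSigma m η ≤ Prod.instMeasurableSpace :=
  sup_le (sup_le (MeasurableSpace.comap_mono hm |>.trans measurable_fst.comap_le)
    (MeasurableSpace.comap_mono hm |>.trans measurable_snd.comap_le)) hη.comap_le

variable {X : Type*} [NormedAddCommGroup X] [NormedSpace ℝ X] [CompleteSpace X]

/-- Indicators of past events in either copy factor out by independence, so it is enough that `w a`
has mean zero on the events of `η`. -/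
theorem condExp_doubledSigma_eq_zero (hm : m ≤ m0) {ξ : Ω → S} (hξ : Measurable ξ)
    (hind : Indep (MeasurableSpace.comap ξ inferInstance) m P) {η : S × S → T}
    (hη : Measurable η) {ι : Type*} [Fintype ι] {F : ι → Ω → ℝ} (hF : ∀ a, Measurable[m] (F a))
    (hFb : ∀ a, ∃ C : ℝ, ∀ ω, |F a ω| ≤ C) {w : ι → S × S → ℝ} (hw : ∀ a, Measurable (w a))
    (hiw : ∀ a, Integrable (fun z : Ω × Ω => w a (ξ z.1, ξ z.2)) (P.prod P))
    (h0 : ∀ a (A : Set T), MeasurableSet A → ∫ z : Ω × Ω,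
      (η ⁻¹' A).indicator (w a) (ξ z.1, ξ z.2) ∂(P.prod P) = 0) (x : ι → X) :
    (P.prod P)[fun z : Ω × Ω => ∑ a, (F a z.1 * w a (ξ z.1, ξ z.2)) • x a |
      doubledSigma m fun z : Ω × Ω => η (ξ z.1, ξ z.2)] =ᵐ[P.prod P] 0 := by
  set ζ : Ω × Ω → T := fun z => η (ξ z.1, ξ z.2) with hζ
  have hζm : Measurable ζ := by fun_prop
  -- Rectangles of past events cut with events of `ζ` form a generating π-system.
  set Q : Set (Set (Ω × Ω)) := {s | ∃ C C' A, MeasurableSet[m] C ∧ MeasurableSet[m] C' ∧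
    MeasurableSet A ∧ s = (C ×ˢ C') ∩ ζ ⁻¹' A} with hQ
  have hint : ∀ a, Integrable (fun z : Ω × Ω => F a z.1 * w a (ξ z.1, ξ z.2)) (P.prod P) :=
    fun a => by
      obtain ⟨C, hC⟩ := hFb a
      exact (hiw a).bdd_mul (c := C) ((hF a).mono hm le_rfl |>.comp measurable_fst).aestronglyMeasurable
        (ae_of_all _ fun z => hC z.1)
  have hgen : doubledSigma m ζ = MeasurableSpace.generateFrom Q := by
    refine le_antisymm (sup_le (sup_le ?_ ?_) ?_) (MeasurableSpace.generateFrom_le ?_)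
    · rintro _ ⟨C, hC, rfl⟩
      exact MeasurableSpace.measurableSet_generateFrom
        ⟨C, Set.univ, Set.univ, hC, MeasurableSet.univ, MeasurableSet.univ, by ext; simp⟩
    · rintro _ ⟨C, hC, rfl⟩
      exact MeasurableSpace.measurableSet_generateFrom
        ⟨Set.univ, C, Set.univ, MeasurableSet.univ, hC, MeasurableSet.univ, by ext; simp⟩
    · rintro _ ⟨A, hA, rfl⟩
      exact MeasurableSpace.measurableSet_generateFrom
        ⟨Set.univ, Set.univ, A, MeasurableSet.univ, MeasurableSet.univ, hA, by ext; simp⟩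
    · rintro _ ⟨C, C', A, hC, hC', hA, rfl⟩
      have h1 : MeasurableSet[doubledSigma m ζ] (Prod.fst ⁻¹' C : Set (Ω × Ω)) :=
        measurable_fst_doubledSigma ζ hC
      have h2 : MeasurableSet[doubledSigma m ζ] (Prod.snd ⁻¹' C' : Set (Ω × Ω)) :=
        measurable_snd_doubledSigma ζ hC'
      have h3 : MeasurableSet[doubledSigma m ζ] (ζ ⁻¹' A) :=
        (le_sup_right : MeasurableSpace.comap ζ inferInstance ≤ _) _ ⟨A, hA, rfl⟩
      exact (h1.inter h2).inter h3
  have hpi : IsPiSystem Q := by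
    rintro _ ⟨C, C', A, hC, hC', hA, rfl⟩ _ ⟨D, D', B, hD, hD', hB, rfl⟩ -
    exact ⟨C ∩ D, C' ∩ D', A ∩ B, hC.inter hD, hC'.inter hD', hA.inter hB, by
      ext z; simp only [Set.mem_inter_iff, Set.mem_prod, Set.mem_preimage]; tauto⟩
  have hvan : ∀ s ∈ Q, ∫ z in s, ∑ a, (F a z.1 * w a (ξ z.1, ξ z.2)) • x a ∂(P.prod P) = 0 := by
    rintro _ ⟨C, C', A, hC, hC', hA, rfl⟩
    have hs : MeasurableSet ((C ×ˢ C') ∩ ζ ⁻¹' A) := ((hm _ hC).prod (hm _ hC')).inter (hζm hA)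
    rw [integral_finsetSum _ fun a _ => ((hint a).smul_const (x a)).integrableOn]
    refine Finset.sum_eq_zero fun a _ => ?_
    rw [integral_smul_const, ← integral_indicator hs]
    have h1 : ((C ×ˢ C') ∩ ζ ⁻¹' A).indicator (fun z : Ω × Ω => F a z.1 * w a (ξ z.1, ξ z.2))
        = fun z => C.indicator (F a) z.1 * (C'.indicator (fun _ => (1 : ℝ)) z.2 *
          (η ⁻¹' A).indicator (w a) (ξ z.1, ξ z.2)) := by
      funext z
      by_cases h1 : z.1 ∈ C <;> by_cases h2 : z.2 ∈ C' <;> by_cases h3 : η (ξ z.1, ξ z.2) ∈ A <;>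
        simp [Set.indicator, h1, h2, h3, hζ]
    have hi1 := (hint a).indicator hs
    rw [h1] at hi1 ⊢
    have hi2 := (hiw a).indicator (hζm hA)
    rw [integral_prod_mul_of_indep hm hξ hind ((hF a).indicator hC)
      (measurable_const.indicator hC') ((hw a).indicator (hη hA)) hi1 hi2, h0 a A hA]
    simp
  refine condExp_eq_zero_of_isPiSystem (doubledSigma_le hm hζm) hgen hpi
    (integrable_finsetSum _ fun a _ => (hint a).smul_const (x a)) ?_ hvan
  have := hvan Set.univ ⟨Set.univ, Set.univ, Set.univ, MeasurableSet.univ, MeasurableSet.univ,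
    MeasurableSet.univ, by simp⟩
  simpa using this

end Step

section Decoupling

variable {Ω : Type u} [m : MeasurableSpace Ω] {ι : Type*}

/-- The doubled filtration: the past of both copies, and then in addition the sum of the next
increments of the copies. -/
def doubledFiltration (𝒢 : Filtration ℕ m) (ξ : ℕ → Ω → ι → ℝ)
    (hξ : ∀ k, Measurable[𝒢 (k + 1)] (ξ k)) :
    Filtration ℕ (Prod.instMeasurableSpace : MeasurableSpace (Ω × Ω)) where
  seq n := if n % 2 = 0 then doubledSigma (𝒢 (n / 2)) fun z => ξ (n / 2) z.1 + ξ (n / 2) z.2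
    else doubledSigma (𝒢 (n / 2 + 1)) fun _ => ()
  mono' := by
    refine monotone_nat_of_le_succ fun n => ?_
    rcases Nat.even_or_odd' n with ⟨k, rfl | rfl⟩
    · have h1 : (2 * k + 1) / 2 = k := by omega
      have h2 : (2 * k) / 2 = k := by omega
      simp only [Nat.mul_mod_right, if_true, Nat.mul_add_mod, Nat.one_mod, one_ne_zero, if_false,
        h1, h2]
      refine sup_le (le_sup_of_le_left (sup_le_sup ?_ ?_)) ?_
      · exact MeasurableSpace.comap_mono (𝒢.mono (Nat.le_succ k))
      · exact MeasurableSpace.comap_mono (𝒢.mono (Nat.le_succ k))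
      · refine Measurable.comap_le (Measurable.add ?_ ?_)
        · exact (hξ k).comp (measurable_fst_doubledSigma _)
        · exact (hξ k).comp (measurable_snd_doubledSigma _)
    · have h1 : (2 * k + 1) / 2 = k := by omega
      have h2 : (2 * k + 1 + 1) / 2 = k + 1 := by omega
      have h3 : (2 * k + 1 + 1) % 2 = 0 := by omega
      simp only [Nat.mul_add_mod, Nat.one_mod, one_ne_zero, if_false, if_true, h1, h2, h3]
      refine sup_le (le_sup_of_le_left le_rfl) ?_
      exact Measurable.comap_le measurable_const
  le' n := by
    split_ifs
    · refine doubledSigma_le (𝒢.le _) (Measurable.add ?_ ?_)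
      · exact ((hξ _).mono (𝒢.le _) le_rfl).comp measurable_fst
      · exact ((hξ _).mono (𝒢.le _) le_rfl).comp measurable_snd
    · exact doubledSigma_le (𝒢.le _) measurable_const

theorem doubledFiltration_even (𝒢 : Filtration ℕ m) (ξ : ℕ → Ω → ι → ℝ)
    (hξ : ∀ k, Measurable[𝒢 (k + 1)] (ξ k)) (k : ℕ) :
    doubledFiltration 𝒢 ξ hξ (2 * k) = doubledSigma (𝒢 k) fun z => ξ k z.1 + ξ k z.2 := by
  have h2 : (2 * k) / 2 = k := by omega
  change (if (2 * k) % 2 = 0 then _ else _) = _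
  rw [if_pos (by omega), h2]

theorem doubledFiltration_odd (𝒢 : Filtration ℕ m) (ξ : ℕ → Ω → ι → ℝ)
    (hξ : ∀ k, Measurable[𝒢 (k + 1)] (ξ k)) (k : ℕ) :
    doubledFiltration 𝒢 ξ hξ (2 * k + 1) = doubledSigma (𝒢 (k + 1)) fun _ => () := by
  have h2 : (2 * k + 1) / 2 = k := by omega
  change (if (2 * k + 1) % 2 = 0 then _ else _) = _
  rw [if_neg (by omega), h2]

variable [Fintype ι] {X : Type v} [NormedAddCommGroup X] [NormedSpace ℝ X]

/-- The terms of the doubled martingale: half the sums and half the differences of the copies. -/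
noncomputable def doubledDiff (ξ : ℕ → Ω → ι → ℝ) (F : ℕ → ι → Ω → ℝ) (x : ι → X) (n : ℕ) (z : Ω × Ω) : X :=
  ∑ a, (F (n / 2) a z.1 *
    ((ξ (n / 2) z.2 a + (if n % 2 = 0 then 1 else -1) * ξ (n / 2) z.1 a) / 2)) • x a

theorem doubledDiff_even (ξ : ℕ → Ω → ι → ℝ) (F : ℕ → ι → Ω → ℝ) (x : ι → X) (k : ℕ) :
    doubledDiff ξ F x (2 * k) =
      fun z => ∑ a, (F k a z.1 * ((ξ k z.2 a + ξ k z.1 a) / 2)) • x a := by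
  have h2 : (2 * k) / 2 = k := by omega
  funext z
  simp [doubledDiff, h2]

theorem doubledDiff_odd (ξ : ℕ → Ω → ι → ℝ) (F : ℕ → ι → Ω → ℝ) (x : ι → X) (k : ℕ) :
    doubledDiff ξ F x (2 * k + 1) =
      fun z => ∑ a, (F k a z.1 * ((ξ k z.2 a - ξ k z.1 a) / 2)) • x a := by
  have h2 : (2 * k + 1) / 2 = k := by omega
  have h3 : (2 * k + 1) % 2 = 1 := by omega
  funext z
  simp [doubledDiff, h2, h3, sub_eq_add_neg]

/-- Half sum plus half difference is the increment of the second copy; half sum minus half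
difference is that of the first. The coefficients always come from the first copy, so the sum is
decoupled and its alternating transform is not. -/
theorem sum_doubledDiff (ξ : ℕ → Ω → ι → ℝ) (F : ℕ → ι → Ω → ℝ) (x : ι → X) (n : ℕ)
    (z : Ω × Ω) :
    ∑ k ∈ Finset.range (2 * n), doubledDiff ξ F x k z
        = ∑ k ∈ Finset.range n, ∑ a, (F k a z.1 * ξ k z.2 a) • x a ∧
      ∑ k ∈ Finset.range (2 * n), (-1 : ℝ) ^ k • doubledDiff ξ F x k z
        = ∑ k ∈ Finset.range n, ∑ a, (F k a z.1 * ξ k z.1 a) • x a := by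
  induction n with
  | zero => simp
  | succ n ih =>
    have e : 2 * (n + 1) = 2 * n + 1 + 1 := by ring
    rw [e, Finset.sum_range_succ, Finset.sum_range_succ, Finset.sum_range_succ,
      Finset.sum_range_succ, Finset.sum_range_succ, Finset.sum_range_succ, ih.1, ih.2,
      doubledDiff_even, doubledDiff_odd]
    constructor
    · rw [add_assoc, ← Finset.sum_add_distrib]
      congr 1
      refine Finset.sum_congr rfl fun a _ => ?_
      rw [← add_smul]
      ring_nf
    · rw [add_assoc, pow_succ, pow_mul]
      simp only [neg_one_sq, one_pow, one_smul, one_mul, neg_smul, ← Finset.sum_neg_distrib,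
        ← Finset.sum_add_distrib]
      congr 1
      refine Finset.sum_congr rfl fun a _ => ?_
      rw [← neg_smul, ← add_smul]
      ring_nf

variable {P : Measure Ω} [IsProbabilityMeasure P] [CompleteSpace X]

/-- A half difference is odd under the exchange of the two copies, while the sum added to the
filtration just before it is invariant. A half sum is centred and independent of both pasts. -/
theorem isMartingaleDiff_doubledDiff (𝒢 : Filtration ℕ m) {ξ : ℕ → Ω → ι → ℝ}
    (hξ : ∀ k, Measurable[𝒢 (k + 1)] (ξ k))
    (hind : ∀ k, Indep (MeasurableSpace.comap (ξ k) inferInstance) (𝒢 k) P)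
    {p : ℝ≥0∞} (hp : 1 ≤ p)
    (hLp : ∀ k a, MemLp (fun ω => ξ k ω a) p P) (h0 : ∀ k a, ∫ ω, ξ k ω a ∂P = 0)
    {F : ℕ → ι → Ω → ℝ} (hF : ∀ k a, Measurable[𝒢 k] (F k a))
    (hFb : ∀ k a, ∃ C : ℝ, ∀ ω, |F k a ω| ≤ C) (x : ι → X) :
    IsMartingaleDiff (P.prod P) (doubledFiltration 𝒢 ξ hξ) p (doubledDiff ξ F x) := by
  have hξm : ∀ k, Measurable (ξ k) := fun k => (hξ k).mono (𝒢.le _) le_rfl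
  have hl1 : ∀ k a, MemLp (fun z : Ω × Ω => ξ k z.1 a) p (P.prod P) := fun k a =>
    (hLp k a).comp_measurePreserving measurePreserving_fst
  have hl2 : ∀ k a, MemLp (fun z : Ω × Ω => ξ k z.2 a) p (P.prod P) := fun k a =>
    (hLp k a).comp_measurePreserving measurePreserving_snd
  have hi1 : ∀ k a, ∫ z : Ω × Ω, ξ k z.1 a ∂(P.prod P) = 0 := fun k a => by
    rw [integral_fun_fst (fun ω => ξ k ω a), h0]; simp
  have hi2 : ∀ k a, ∫ z : Ω × Ω, ξ k z.2 a ∂(P.prod P) = 0 := fun k a => by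
    rw [integral_fun_snd (fun ω => ξ k ω a), h0]; simp
  refine ⟨fun n => ?_, fun n => ?_, fun n => ?_⟩
  · rcases Nat.even_or_odd' n with ⟨k, rfl | rfl⟩
    · rw [doubledFiltration_even, doubledDiff_even]
      refine Finset.stronglyMeasurable_fun_sum _ fun a _ => ?_
      refine StronglyMeasurable.smul_const (Measurable.stronglyMeasurable ?_) _
      have h1 := (hF k a).comp (measurable_fst_doubledSigma fun z => ξ k z.1 + ξ k z.2)
      have h2 : Measurable[doubledSigma (𝒢 k) fun z : Ω × Ω => ξ k z.1 + ξ k z.2]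
          fun z : Ω × Ω => (ξ k z.2 a + ξ k z.1 a) / 2 := by
        have h3 : Measurable[doubledSigma (𝒢 k) fun z : Ω × Ω => ξ k z.1 + ξ k z.2]
            fun z : Ω × Ω => ξ k z.1 + ξ k z.2 := Measurable.of_comap_le le_sup_right
        have h4 : Measurable fun y : ι → ℝ => y a / 2 := by fun_prop
        have h5 := h4.comp h3
        have h6 : (fun z : Ω × Ω => (ξ k z.2 a + ξ k z.1 a) / 2)
            = (fun y : ι → ℝ => y a / 2) ∘ fun z : Ω × Ω => ξ k z.1 + ξ k z.2 := by
          funext z; simp [add_comm]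
        rw [h6]
        exact h5
      exact h1.mul h2
    · rw [doubledFiltration_odd, doubledDiff_odd]
      refine Finset.stronglyMeasurable_fun_sum _ fun a _ => ?_
      refine StronglyMeasurable.smul_const (Measurable.stronglyMeasurable ?_) _
      have hc : Measurable fun y : ι → ℝ => y a := by fun_prop
      have h1 := ((hF k a).mono (𝒢.mono (Nat.le_succ k)) le_rfl).comp
        (measurable_fst_doubledSigma fun _ : Ω × Ω => ())
      have h2 := hc.comp ((hξ k).comp (measurable_fst_doubledSigma fun _ : Ω × Ω => ()))
      have h3 := hc.comp ((hξ k).comp (measurable_snd_doubledSigma fun _ : Ω × Ω => ()))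
      exact h1.mul ((h3.sub h2).div_const 2)
  · refine memLp_finsetSum _ fun a _ => ?_
    have h1 : MemLp (fun z : Ω × Ω => (ξ (n / 2) z.2 a +
        (if n % 2 = 0 then 1 else -1) * ξ (n / 2) z.1 a) / 2) p (P.prod P) := by
      simp_rw [div_eq_inv_mul]
      exact ((hl2 _ a).add ((hl1 _ a).const_mul _)).const_mul _
    obtain ⟨C, hC⟩ := hFb (n / 2) a
    have h2 : MemLp (fun z : Ω × Ω => F (n / 2) a z.1 * ((ξ (n / 2) z.2 a +
        (if n % 2 = 0 then 1 else -1) * ξ (n / 2) z.1 a) / 2)) p (P.prod P) := by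
      refine MemLp.of_le_mul (c := C) h1 ?_ (ae_of_all _ fun z => ?_)
      · exact (((hF _ a).mono (𝒢.le _) le_rfl).comp measurable_fst).aestronglyMeasurable.mul h1.1
      · rw [norm_mul]
        exact mul_le_mul_of_nonneg_right (hC z.1) (norm_nonneg _)
    exact (ContinuousLinearMap.toSpanSingleton ℝ (x a)).comp_memLp' h2
  · have hints : ∀ k a (c : ℝ), Integrable (fun z : Ω × Ω => (ξ k z.2 a + c * ξ k z.1 a) / 2)
        (P.prod P) := fun k a c =>
      (((hl2 k a).integrable hp).add (((hl1 k a).integrable hp).const_mul c)).div_const 2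
    rcases Nat.even_or_odd' n with ⟨k, rfl | rfl⟩
    · rw [doubledFiltration_even, doubledDiff_odd]
      refine condExp_doubledSigma_eq_zero (𝒢.le k) (hξm k) (hind k)
        (η := fun y : (ι → ℝ) × (ι → ℝ) => y.1 + y.2) (by fun_prop) (hF k) (hFb k)
        (w := fun a y => (y.2 a - y.1 a) / 2) (fun a => by fun_prop) (fun a => ?_)
        (fun a A hA => ?_) x
      · have := hints k a (-1)
        simpa [sub_eq_add_neg] using this
      · set J := ∫ z : Ω × Ω, ((fun y : (ι → ℝ) × (ι → ℝ) => y.1 + y.2) ⁻¹' A).indicator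
          (fun y => (y.2 a - y.1 a) / 2) (ξ k z.1, ξ k z.2) ∂(P.prod P) with hJ
        -- The exchange of the copies preserves the product measure and the event, and changes the
        -- sign of the integrand.
        have h1 : J = -J := by
          conv_lhs => rw [hJ, ← integral_prod_swap]
          rw [hJ, ← integral_neg]
          refine integral_congr_ae (ae_of_all _ fun z => ?_)
          by_cases h : ξ k z.1 + ξ k z.2 ∈ A
          · have h' : ξ k z.2 + ξ k z.1 ∈ A := by rwa [add_comm]
            simp only [Prod.fst_swap, Prod.snd_swap, Set.indicator, Set.mem_preimage, h, h',
              if_true]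
            ring
          · have h' : ξ k z.2 + ξ k z.1 ∉ A := by rwa [add_comm]
            simp [Set.indicator, h, h']
        linarith
    · have e : 2 * k + 1 + 1 = 2 * (k + 1) := by ring
      rw [e, doubledFiltration_odd, doubledDiff_even]
      refine condExp_doubledSigma_eq_zero (𝒢.le (k + 1)) (hξm (k + 1)) (hind (k + 1))
        (η := fun _ : (ι → ℝ) × (ι → ℝ) => ()) (by fun_prop) (hF (k + 1)) (hFb (k + 1))
        (w := fun a y => (y.2 a + y.1 a) / 2) (fun a => by fun_prop) (fun a => ?_)
        (fun a A hA => ?_) x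
      · simpa using hints (k + 1) a 1
      · by_cases h : () ∈ A
        · have h1 : (fun _ : (ι → ℝ) × (ι → ℝ) => ()) ⁻¹' A = Set.univ := by
            ext; simpa using h
          rw [h1]
          simp only [Set.indicator_univ]
          rw [integral_div, integral_add ((hl2 _ a).integrable hp) ((hl1 _ a).integrable hp), hi1,
            hi2]
          simp
        · have h1 : (fun _ : (ι → ℝ) × (ι → ℝ) => ()) ⁻¹' A = ∅ := by
            ext; simpa using h
          simp [h1]

end Decoupling

/-- The decoupling inequality in UMD spaces. -/
theorem UMDAt.exists_decoupling {X : Type v} [NormedAddCommGroup X] [NormedSpace ℝ X]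
    [CompleteSpace X] {p : ℝ≥0∞} (hX : UMDAt.{u, v} X p) (hp : 1 ≤ p) :
    ∃ β : ℝ≥0, ∀ (Ω : Type u) [m : MeasurableSpace Ω] (P : Measure Ω) [IsProbabilityMeasure P]
      (𝒢 : Filtration ℕ m) (ι : Type) [Fintype ι] (ξ : ℕ → Ω → ι → ℝ) (F : ℕ → ι → Ω → ℝ)
      (x : ι → X), (∀ k, Measurable[𝒢 (k + 1)] (ξ k)) →
      (∀ k, Indep (MeasurableSpace.comap (ξ k) inferInstance) (𝒢 k) P) →
      (∀ k a, MemLp (fun ω => ξ k ω a) p P) → (∀ k a, ∫ ω, ξ k ω a ∂P = 0) →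
      (∀ k a, Measurable[𝒢 k] (F k a)) → (∀ k a, ∃ C : ℝ, ∀ ω, |F k a ω| ≤ C) → ∀ n : ℕ,
      eLpNorm (fun ω => ∑ k ∈ Finset.range n, ∑ a, (F k a ω * ξ k ω a) • x a) p P
        ≤ β * eLpNorm (fun z : Ω × Ω => ∑ k ∈ Finset.range n, ∑ a, (F k a z.1 * ξ k z.2 a) • x a)
          p (P.prod P) := by
  obtain ⟨β, hβ⟩ := hX
  refine ⟨β, fun Ω m P _ 𝒢 ι _ ξ F x hξ hind hLp h0 hF hFb n => ?_⟩
  have hd := isMartingaleDiff_doubledDiff 𝒢 hξ hind hp hLp h0 hF hFb x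
  -- UMD is used on the doubled space, with signs alternating between half sums and half
  -- differences.
  have key := hβ (Ω × Ω) (P.prod P) _ _ hd (fun n => (-1) ^ n) (fun n => neg_one_pow_eq_or ℝ n)
    (2 * n)
  simp_rw [(sum_doubledDiff ξ F x n _).1, (sum_doubledDiff ξ F x n _).2] at key
  refine le_trans (le_of_eq ?_) key
  refine (eLpNorm_comp_measurePreserving (g := fun ω => ∑ k ∈ Finset.range n,
    ∑ a, (F k a ω * ξ k ω a) • x a) ?_ measurePreserving_fst).symm
  refine Finset.aestronglyMeasurable_fun_sum _ fun k _ =>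
    Finset.aestronglyMeasurable_fun_sum _ fun a _ => ?_
  have h1 : Measurable (F k a) := (hF k a).mono (𝒢.le _) le_rfl
  have h2 : Measurable fun ω => ξ k ω a :=
    (measurable_pi_apply a).comp ((hξ k).mono (𝒢.le _) le_rfl)
  exact (h1.mul h2).aestronglyMeasurable.smul_const _

/-! ### The counting variables and the compensated random measure -/

section Count

variable {Ω : Type u} [mΩ : MeasurableSpace Ω] {E : Type w} [MeasurableSpace E]
  {N : Ω → Measure E} {μ : Measure E} {P : Measure Ω}

theorem measurable_floor_toReal : Measurable fun x : ℝ≥0∞ => ⌊x.toReal⌋₊ :=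
  Nat.measurable_floor.comp ENNReal.measurable_toReal

theorem measurable_count (hN : IsPoissonRandomMeasure N μ P) {B : Set E} (hB : MeasurableSet B) :
    Measurable (count N B) :=
  measurable_floor_toReal.comp (hN.measurable_apply B hB)

theorem measurable_compensated (hN : IsPoissonRandomMeasure N μ P) {B : Set E}
    (hB : MeasurableSet B) : Measurable (compensated N μ B) :=
  (hN.measurable_apply B hB).ennreal_toReal.sub_const _

theorem measurable_count_regionSigma {U B : Set E} (hB : MeasurableSet B) (hU : B ⊆ U) :
    Measurable[regionSigma N U] (count N B) :=
  measurable_floor_toReal.comp (measurable_regionSigma hB hU)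

theorem measurable_compensated_regionSigma {U B : Set E} (hB : MeasurableSet B) (hU : B ⊆ U) :
    Measurable[regionSigma N U] (compensated N μ B) :=
  (measurable_regionSigma hB hU).ennreal_toReal.sub_const _

theorem ae_lt_top (hN : IsPoissonRandomMeasure N μ P) {B : Set E} (hB : MeasurableSet B)
    (hμ : μ B < ∞) : ∀ᵐ ω ∂P, N ω B < ∞ := by
  have h1 : ∀ᵐ x ∂(P.map fun ω => N ω B), x < ∞ := by
    rw [hN.law_of_lt_top B hB hμ, ae_map_iff (measurable_of_countable _).aemeasurable
      measurableSet_Iio]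
    exact ae_of_all _ fun n => ENNReal.natCast_lt_top n
  exact ae_of_ae_map (hN.measurable_apply B hB).aemeasurable h1

theorem ae_eq_count (hN : IsPoissonRandomMeasure N μ P) {B : Set E} (hB : MeasurableSet B)
    (hμ : μ B < ∞) : ∀ᵐ ω ∂P, N ω B = (count N B ω : ℝ≥0∞) := by
  filter_upwards [ae_lt_top hN hB hμ] with ω hω
  obtain ⟨n, hn⟩ := hN.integer_valued ω B hB
  rw [hn] at hω
  have hn' : n ≠ ⊤ := by rintro rfl; simp at hω
  lift n to ℕ using hn'
  simp [count, hn]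

theorem ae_compensated_eq (hN : IsPoissonRandomMeasure N μ P) {B : Set E} (hB : MeasurableSet B)
    (hμ : μ B < ∞) : ∀ᵐ ω ∂P, compensated N μ B ω = (count N B ω : ℝ) - (μ B).toNNReal := by
  filter_upwards [ae_eq_count hN hB hμ] with ω hω
  simp [compensated, hω, ENNReal.toReal]

theorem map_count (hN : IsPoissonRandomMeasure N μ P) {B : Set E} (hB : MeasurableSet B)
    (hμ : μ B < ∞) : P.map (count N B) = poissonMeasure (μ B).toNNReal := by
  have h1 : P.map (count N B) = (P.map fun ω => N ω B).map fun x => ⌊x.toReal⌋₊ :=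
    (Measure.map_map measurable_floor_toReal (hN.measurable_apply B hB)).symm
  rw [h1, hN.law_of_lt_top B hB hμ,
    Measure.map_map measurable_floor_toReal (measurable_of_countable _)]
  convert Measure.map_id
  ext n
  simp

/-- Additivity holds only almost surely, because `toReal` sends an infinite count to `0`. -/
theorem compensated_biUnion_ae (hN : IsPoissonRandomMeasure N μ P) {ι : Type*} (s : Finset ι)
    {B : ι → Set E} (hd : (s : Set ι).PairwiseDisjoint B) (hB : ∀ i, MeasurableSet (B i))
    (hμ : ∀ i, μ (B i) < ∞) :
    compensated N μ (⋃ i ∈ s, B i) =ᵐ[P] fun ω => ∑ i ∈ s, compensated N μ (B i) ω := by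
  have h : ∀ᵐ ω ∂P, ∀ i ∈ s, N ω (B i) < ∞ :=
    (ae_ball_iff s.countable_toSet).2 fun i _ => ae_lt_top hN (hB i) (hμ i)
  filter_upwards [h] with ω hω
  simp only [compensated, Finset.sum_sub_distrib]
  rw [measure_biUnion_finset hd fun i _ => hB i, measure_biUnion_finset hd fun i _ => hB i,
    ENNReal.toReal_sum fun i hi => (hω i hi).ne, ENNReal.toReal_sum fun i _ => (hμ i).ne]

theorem count_eq_add_ae (hN : IsPoissonRandomMeasure N μ P) {B C : Set E} (hB : MeasurableSet B)
    (hC : MeasurableSet C) (hμ : μ B < ∞) :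
    ∀ᵐ ω ∂P, count N B ω = count N (B ∩ C) ω + count N (B \ C) ω := by
  filter_upwards [ae_eq_count hN hB hμ,
    ae_eq_count hN (hB.inter hC) ((measure_mono Set.inter_subset_left).trans_lt hμ),
    ae_eq_count hN (hB.diff hC) ((measure_mono Set.sdiff_subset).trans_lt hμ)] with ω h1 h2 h3
  have h4 := measure_inter_add_sdiff (μ := N ω) B hC
  rw [h1, h2, h3] at h4
  exact_mod_cast h4.symm

variable [IsProbabilityMeasure P]

theorem memLp_count (hN : IsPoissonRandomMeasure N μ P) {B : Set E} (hB : MeasurableSet B)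
    (hμ : μ B < ∞) {p : ℝ≥0∞} (hp : p ≠ ∞) : MemLp (fun ω => (count N B ω : ℝ)) p P := by
  refine ((memLp_compensated hN hB hμ hp).add (memLp_const ((μ B).toNNReal : ℝ))).ae_eq ?_
  filter_upwards [ae_compensated_eq hN hB hμ] with ω hω
  simp [hω]

theorem integral_compensated (hN : IsPoissonRandomMeasure N μ P) {B : Set E}
    (hB : MeasurableSet B) (hμ : μ B < ∞) : ∫ ω, compensated N μ B ω ∂P = 0 := by
  have hi : Integrable (fun ω => (count N B ω : ℝ)) P :=
    (memLp_count hN hB hμ (p := 1) (by simp)).integrable le_rfl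
  -- Stein's identity with `h = 1` and the trivial σ-algebra is `𝔼 Z = r`.
  have h1 := (integral_stein (m := ⊥) bot_le (measurable_count hN hB) (map_count hN hB hμ)
    (indep_bot_right _) (h := fun _ _ => 1) (fun _ => measurable_const) (by simpa using hi)).2
  rw [integral_congr_ae (ae_compensated_eq hN hB hμ), integral_sub hi (integrable_const _)]
  simp at h1 ⊢
  linarith

theorem indep_comap_count (hN : IsPoissonRandomMeasure N μ P) {B : Set E} (hB : MeasurableSet B) :
    Indep (MeasurableSpace.comap (count N B) inferInstance) (regionSigma N Bᶜ) P :=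
  indep_of_indep_of_le_left (hN.indep_regionSigma (disjoint_compl_right : Disjoint B Bᶜ))
    (measurable_count_regionSigma hB le_rfl).comap_le

theorem coeFn_sum_smul_nuIndicator (hN : IsPoissonRandomMeasure N μ P) {p : ℝ≥0∞} [Fact (1 ≤ p)]
    (hp : p ≠ ∞) {X : Type v} [NormedAddCommGroup X] [NormedSpace ℝ X] {ι : Type*} (s : Finset ι)
    (c : ι → ℝ) {B : ι → Set E} (hB : ∀ i, MeasurableSet (B i)) (hμ : ∀ i, μ (B i) < ∞)
    (x : ι → X) :
    (((∑ i ∈ s, c i • nuIndicator N μ P p (B i) (x i) : nuSpace N μ P p X) : Lp X p P) : Ω → X)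
      =ᵐ[P] fun ω => ∑ i ∈ s, (c i * compensated N μ (B i) ω) • x i := by
  classical
  induction s using Finset.induction_on with
  | empty =>
    simp only [Finset.sum_empty]
    exact Lp.coeFn_zero X p P
  | insert a s ha ih =>
    rw [Finset.sum_insert ha, Submodule.coe_add, Submodule.coe_smul]
    filter_upwards [ih, Lp.coeFn_add (c a • (nuIndicator N μ P p (B a) (x a) : Lp X p P))
      ((∑ i ∈ s, c i • nuIndicator N μ P p (B i) (x i) : nuSpace N μ P p X) : Lp X p P),
      Lp.coeFn_smul (c a) (nuIndicator N μ P p (B a) (x a) : Lp X p P),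
      coeFn_nuIndicator hN hp (hB a) (hμ a) (x a)] with ω h1 h2 h3 h4
    rw [h2, Pi.add_apply, h1, h3, Pi.smul_apply, h4, Finset.sum_insert ha, smul_smul]

end Count

/-! ### Adapted integrands -/

section Past

variable {Ω : Type u} {J : Type w} [MeasurableSpace J] {N : Ω → Measure (ℝ≥0 × J)}

theorem pastSigma_mono (N : Ω → Measure (ℝ≥0 × J)) {s t : ℝ≥0} (h : s ≤ t) :
    pastSigma N s ≤ pastSigma N t :=
  iSup_mono fun _ => iSup_mono fun _ => iSup_mono fun _ =>
    iSup_mono' fun hA => ⟨⟨hA.1, hA.2.1.trans h, hA.2.2⟩, le_rfl⟩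

theorem measurable_pastSigma {s u t : ℝ≥0} (h : u ≤ t) {A : Set J} (hA : MeasurableSet A) :
    Measurable[pastSigma N t] fun ω => N ω (Set.Ioc s u ×ˢ A) := by
  rcases lt_or_ge s u with hs | hs
  · exact Measurable.of_comap_le (le_iSup_of_le s (le_iSup_of_le u (le_iSup_of_le A
      (le_iSup_of_le ⟨hs, h, hA⟩ le_rfl))))
  · simp [Set.Ioc_eq_empty (not_lt.2 hs)]

/-- The past up to `t` sees `N` on `[0, t] × J` only, hence is independent of the increments after
`t`. -/
theorem pastSigma_le_regionSigma (t : ℝ≥0) :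
    pastSigma N t ≤ regionSigma N (Set.Iic t ×ˢ Set.univ) := by
  refine iSup_le fun s => iSup_le fun u => iSup_le fun A => iSup_le fun h => ?_
  exact (measurable_regionSigma (measurableSet_Ioc.prod h.2.2)
    (Set.prod_mono (fun x hx => hx.2.trans h.2.1) (Set.subset_univ _))).comap_le

variable [mΩ : MeasurableSpace Ω] {ν : Measure J} {P : Measure Ω}

theorem pastSigma_le (hN : IsPoissonRandomMeasure N (timeProd ν) P) (t : ℝ≥0) :
    pastSigma N t ≤ mΩ :=
  (pastSigma_le_regionSigma t).trans (regionSigma_le hN _)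

theorem timeProd_lt_top [SigmaFinite ν] (s u : ℝ≥0) {A : Set J} (hA : ν A < ∞) :
    timeProd ν (Set.Ioc s u ×ˢ A) < ∞ := by
  rw [timeProd, Measure.prod_prod]
  refine ENNReal.mul_lt_top ?_ hA
  refine (Measure.comap_apply_le _ _ measurableSet_Ioc.nullMeasurableSet).trans_lt ?_
  refine (measure_mono (t := Set.Icc (s : ℝ) u) ?_).trans_lt (by simp)
  rintro _ ⟨x, hx, rfl⟩
  exact ⟨NNReal.coe_le_coe.2 hx.1.le, NNReal.coe_le_coe.2 hx.2⟩

end Past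

/-- A finite family of weighted rectangles `F a 1_{(s a, u a] × A a} x a` with `F a` bounded and
`ℱ_{s a}`-measurable. -/
structure AdaptedFamily {Ω : Type u} [MeasurableSpace Ω] {J : Type w} [MeasurableSpace J]
    (N : Ω → Measure (ℝ≥0 × J)) (ν : Measure J) (X : Type v) where
  ι : Type
  fintype : Fintype ι
  s : ι → ℝ≥0
  u : ι → ℝ≥0
  lt : ∀ a, s a < u a
  A : ι → Set J
  measurableSet_A : ∀ a, MeasurableSet (A a)
  measure_A_lt_top : ∀ a, ν (A a) < ∞
  F : ι → Ω → ℝ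
  measurable_F : ∀ a, Measurable[pastSigma N (s a)] (F a)
  bounded_F : ∀ a, ∃ C : ℝ, ∀ ω, |F a ω| ≤ C
  x : ι → X

attribute [instance] AdaptedFamily.fintype

section Family

variable {Ω : Type u} [mΩ : MeasurableSpace Ω] {J : Type w} [MeasurableSpace J]
  {N : Ω → Measure (ℝ≥0 × J)} {ν : Measure J} {X : Type v} [NormedAddCommGroup X] [NormedSpace ℝ X]

namespace AdaptedFamily

/-- The rectangle `(s a, u a] × A a`. -/
def cell (f : AdaptedFamily N ν X) (a : f.ι) : Set (ℝ≥0 × J) := Set.Ioc (f.s a) (f.u a) ×ˢ f.A a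

/-- The process `∑ a, F a 1_{(s a, u a] × A a} x a`. -/
noncomputable def process (f : AdaptedFamily N ν X) (P : Measure Ω) (p : ℝ≥0∞) [Fact (1 ≤ p)]
    (ω : Ω) : nuSpace N (timeProd ν) P p X :=
  ∑ a, f.F a ω • nuIndicator N (timeProd ν) P p (f.cell a) (f.x a)

/-- The integral `∑ a, F a Ñ((s a, u a] × A a) x a`. -/
noncomputable def integral (f : AdaptedFamily N ν X) (ω : Ω) : X :=
  ∑ a, (f.F a ω * compensated N (timeProd ν) (f.cell a) ω) • f.x a

theorem measurableSet_cell (f : AdaptedFamily N ν X) (a : f.ι) : MeasurableSet (f.cell a) :=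
  measurableSet_Ioc.prod (f.measurableSet_A a)

theorem measure_cell_lt_top [SigmaFinite ν] (f : AdaptedFamily N ν X) (a : f.ι) :
    timeProd ν (f.cell a) < ∞ :=
  timeProd_lt_top _ _ (f.measure_A_lt_top a)

/-- The juxtaposition of two families. -/
def add (f g : AdaptedFamily N ν X) : AdaptedFamily N ν X where
  ι := f.ι ⊕ g.ι
  fintype := inferInstance
  s := Sum.elim f.s g.s
  u := Sum.elim f.u g.u
  lt := by rintro (a | a); exacts [f.lt a, g.lt a]
  A := Sum.elim f.A g.A
  measurableSet_A := by rintro (a | a); exacts [f.measurableSet_A a, g.measurableSet_A a]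
  measure_A_lt_top := by rintro (a | a); exacts [f.measure_A_lt_top a, g.measure_A_lt_top a]
  F := Sum.elim f.F g.F
  measurable_F := by rintro (a | a); exacts [f.measurable_F a, g.measurable_F a]
  bounded_F := by rintro (a | a); exacts [f.bounded_F a, g.bounded_F a]
  x := Sum.elim f.x g.x

/-- A scalar multiple of a family. -/
def smul (c : ℝ) (f : AdaptedFamily N ν X) : AdaptedFamily N ν X where
  ι := f.ι
  fintype := inferInstance
  s := f.s
  u := f.u
  lt := f.lt
  A := f.A
  measurableSet_A := f.measurableSet_A
  measure_A_lt_top := f.measure_A_lt_top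
  F a ω := c * f.F a ω
  measurable_F a := (f.measurable_F a).const_mul c
  bounded_F a := by
    obtain ⟨C, hC⟩ := f.bounded_F a
    exact ⟨|c| * C, fun ω => by rw [abs_mul]; gcongr; exact hC ω⟩
  x := f.x

/-- The empty family. -/
def empty : AdaptedFamily N ν X where
  ι := PEmpty
  fintype := inferInstance
  s := PEmpty.elim
  u := PEmpty.elim
  lt a := a.elim
  A := PEmpty.elim
  measurableSet_A a := a.elim
  measure_A_lt_top a := a.elim
  F := PEmpty.elim
  measurable_F a := a.elim
  bounded_F a := a.elim
  x := PEmpty.elim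

theorem process_add (f g : AdaptedFamily N ν X) (P : Measure Ω) (p : ℝ≥0∞) [Fact (1 ≤ p)]
    (ω : Ω) : (f.add g).process P p ω = f.process P p ω + g.process P p ω :=
  Fintype.sum_sum_type _

theorem integral_add (f g : AdaptedFamily N ν X) (ω : Ω) :
    (f.add g).integral ω = f.integral ω + g.integral ω :=
  Fintype.sum_sum_type _

theorem process_smul (c : ℝ) (f : AdaptedFamily N ν X) (P : Measure Ω) (p : ℝ≥0∞) [Fact (1 ≤ p)]
    (ω : Ω) : (f.smul c).process P p ω = c • f.process P p ω := by
  simp only [process, Finset.smul_sum, smul_smul]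
  rfl

theorem integral_smul (c : ℝ) (f : AdaptedFamily N ν X) (ω : Ω) :
    (f.smul c).integral ω = c • f.integral ω := by
  simp only [integral, Finset.smul_sum, smul_smul, ← mul_assoc]
  rfl

end AdaptedFamily

/-- A simple adapted process as a family of weighted rectangles. -/
def SimpleAdapted.toFamily (s : SimpleAdapted N ν X) : AdaptedFamily N ν X where
  ι := Fin s.l × Fin s.m × Fin s.n
  fintype := inferInstance
  s a := s.t a.1.castSucc
  u a := s.t a.1.succ
  lt a := s.strictMono_t a.1.castSucc_lt_succ
  A a := s.A a.2.1
  measurableSet_A a := s.measurableSet_A a.2.1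
  measure_A_lt_top a := s.measure_A_lt_top a.2.1
  F a := s.F a.1 a.2.1 a.2.2
  measurable_F a := s.measurable_F a.1 a.2.1 a.2.2
  bounded_F a := s.bounded_F a.1 a.2.1 a.2.2
  x a := s.x a.1 a.2.1 a.2.2

theorem SimpleAdapted.process_toFamily (s : SimpleAdapted N ν X) (P : Measure Ω) (p : ℝ≥0∞)
    [Fact (1 ≤ p)] (ω : Ω) : s.toFamily.process P p ω = s.process P p ω := by
  simp only [AdaptedFamily.process, SimpleAdapted.process]
  exact (Fintype.sum_prod_type _).trans (Finset.sum_congr rfl fun i _ => Fintype.sum_prod_type _)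

theorem SimpleAdapted.integral_toFamily (s : SimpleAdapted N ν X) (ω : Ω) :
    s.toFamily.integral ω = s.integral ω := by
  simp only [AdaptedFamily.integral, SimpleAdapted.integral]
  exact (Fintype.sum_prod_type _).trans (Finset.sum_congr rfl fun i _ => Fintype.sum_prod_type _)

variable {P : Measure Ω} [IsProbabilityMeasure P] [SigmaFinite ν]

theorem AdaptedFamily.memLp_integral (hN : IsPoissonRandomMeasure N (timeProd ν) P)
    (f : AdaptedFamily N ν X) {p : ℝ≥0∞} (hp : p ≠ ∞) : MemLp f.integral p P := by
  refine memLp_finsetSum _ fun a _ => ?_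
  obtain ⟨C, hC⟩ := f.bounded_F a
  have h1 := memLp_compensated hN (f.measurableSet_cell a) (f.measure_cell_lt_top a) hp
  have h2 : MemLp (fun ω => f.F a ω * compensated N (timeProd ν) (f.cell a) ω) p P := by
    refine MemLp.of_le_mul (c := C) h1 ?_ (ae_of_all _ fun ω => ?_)
    · exact ((f.measurable_F a).mono (pastSigma_le hN _) le_rfl).aestronglyMeasurable.mul h1.1
    · rw [norm_mul]
      exact mul_le_mul_of_nonneg_right (hC ω) (norm_nonneg _)
  exact (ContinuousLinearMap.toSpanSingleton ℝ (f.x a)).comp_memLp' h2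

/-- Finitely many times lie on a monotone sequence. -/
theorem exists_monotone_enumeration (T : Finset ℝ≥0) :
    ∃ (t : ℕ → ℝ≥0) (n : ℕ), Monotone t ∧ ∀ x ∈ T, ∃ k ≤ n, t k = x := by
  classical
  induction T using Finset.induction_on_max with
  | empty => exact ⟨fun _ => 0, 0, monotone_const, by simp⟩
  | insert a T ha ih =>
    obtain ⟨t, n, ht, h⟩ := ih
    -- Old values outside `T` may exceed the new maximum `a`. Capping at `a` restores monotonicity
    -- and leaves the points of `T`, all below `a`, in place.
    refine ⟨fun k => if k ≤ n then min (t k) a else a, n + 1, fun i j hij => ?_, fun x hx => ?_⟩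
    · by_cases h1 : j ≤ n
      · simp only [hij.trans h1, h1, if_true]
        exact min_le_min_right _ (ht hij)
      · simp only [h1, if_false]
        split_ifs
        · exact min_le_right _ _
        · exact le_rfl
    · rcases Finset.mem_insert.1 hx with rfl | hx
      · exact ⟨n + 1, le_rfl, by simp⟩
      · obtain ⟨k, hk, rfl⟩ := h x hx
        exact ⟨k, hk.trans (Nat.le_succ n), by simp [hk, (ha _ hx).le]⟩

theorem compensated_Ioc_ae (hN : IsPoissonRandomMeasure N (timeProd ν) P) {t : ℕ → ℝ≥0}
    (ht : Monotone t) (i j : ℕ) {A : Set J} (hA : MeasurableSet A) (hν : ν A < ∞) :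
    compensated N (timeProd ν) (Set.Ioc (t i) (t j) ×ˢ A) =ᵐ[P]
      fun ω => ∑ k ∈ Finset.Ico i j,
        compensated N (timeProd ν) (Set.Ioc (t k) (t (k + 1)) ×ˢ A) ω := by
  have h1 : Set.Ioc (t i) (t j) ×ˢ A
      = ⋃ k ∈ Finset.Ico i j, Set.Ioc (t k) (t (k + 1)) ×ˢ A := by
    have h2 := ht.biUnion_Ico_Ioc_map_succ i j
    simp only [Nat.succ_eq_succ, Nat.succ_eq_add_one] at h2
    rw [← h2]
    ext z
    simp only [Set.mem_prod, Set.mem_iUnion, Finset.mem_Ico, Set.mem_Ico, exists_prop]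
    constructor
    · rintro ⟨⟨k, hk, hz⟩, hA⟩; exact ⟨k, hk, hz, hA⟩
    · rintro ⟨k, hk, hz, hA⟩; exact ⟨⟨k, hk, hz⟩, hA⟩
  rw [h1]
  refine compensated_biUnion_ae hN _ (fun k _ l _ hkl => ?_)
    (fun k => measurableSet_Ioc.prod hA) fun k => timeProd_lt_top _ _ hν
  exact Set.Disjoint.set_prod_left (ht.pairwise_disjoint_on_Ioc_succ hkl) _ _

/-- The norm of an adapted process, as an iterated integral. -/
theorem AdaptedFamily.eLpNorm_process (hN : IsPoissonRandomMeasure N (timeProd ν) P)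
    (f : AdaptedFamily N ν X) {p : ℝ≥0∞} [Fact (1 ≤ p)] (hp : p ≠ ∞) :
    eLpNorm (f.process P p) p P = eLpNorm (fun z : Ω × Ω => ∑ a,
      (f.F a z.1 * compensated N (timeProd ν) (f.cell a) z.2) • f.x a) p (P.prod P) := by
  have h0 : p ≠ 0 := (zero_lt_one.trans_le (Fact.out : 1 ≤ p)).ne'
  have hp0 : 0 < p.toReal := ENNReal.toReal_pos h0 hp
  rw [eLpNorm_eq_lintegral_rpow_enorm_toReal h0 hp, eLpNorm_eq_lintegral_rpow_enorm_toReal h0 hp]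
  congr 1
  rw [lintegral_prod]
  · refine lintegral_congr fun ω => ?_
    have h1 := coeFn_sum_smul_nuIndicator hN (p := p) hp Finset.univ (fun a => f.F a ω)
      f.measurableSet_cell f.measure_cell_lt_top f.x
    -- The norm of `ν_p` is an `L^p` norm in `ω'`; Fubini combines it with the one in `ω`, the
    -- exponent being the same.
    have h2 : ‖f.process P p ω‖ₑ = eLpNorm (fun ω' => ∑ a,
      (f.F a ω * compensated N (timeProd ν) (f.cell a) ω') • f.x a) p P := by
      rw [← eLpNorm_congr_ae h1]
      exact Lp.enorm_def _
    rw [h2, eLpNorm_eq_lintegral_rpow_enorm_toReal h0 hp, ← ENNReal.rpow_mul, one_div,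
      inv_mul_cancel₀ hp0.ne', ENNReal.rpow_one]
  · refine (StronglyMeasurable.enorm ?_).pow_const _ |>.aemeasurable
    refine Finset.stronglyMeasurable_fun_sum _ fun a _ => ?_
    refine StronglyMeasurable.smul_const (Measurable.stronglyMeasurable ?_) _
    exact (((f.measurable_F a).mono (pastSigma_le hN _) le_rfl).comp measurable_fst).mul
      ((measurable_compensated hN (f.measurableSet_cell a)).comp measurable_snd)

/-- On a grid containing all endpoints, the increment vector over a grid interval is centred and
independent of the past, so the decoupling inequality applies. Independence between the components
of the vector is not required, which is why overlapping rectangles are harmless. -/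
theorem AdaptedFamily.exists_eLpNorm_integral_le [CompleteSpace X] {p : ℝ≥0∞} [Fact (1 ≤ p)]
    (hp : p ≠ ∞) (hX : UMDAt.{u, v} X p) :
    ∃ β : ℝ≥0, ∀ (N : Ω → Measure (ℝ≥0 × J)), IsPoissonRandomMeasure N (timeProd ν) P →
      ∀ f : AdaptedFamily N ν X, eLpNorm f.integral p P ≤ β * eLpNorm (f.process P p) p P := by
  classical
  obtain ⟨β, hβ⟩ := hX.exists_decoupling Fact.out
  refine ⟨β, fun N hN f => ?_⟩
  obtain ⟨t, n, ht, htn⟩ := exists_monotone_enumeration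
    (Finset.univ.image f.s ∪ Finset.univ.image f.u)
  choose i hi his using fun a => htn (f.s a) (by simp)
  choose j hj hju using fun a => htn (f.u a) (by simp)
  set 𝒢 : Filtration ℕ mΩ := ⟨fun k => pastSigma N (t k), fun k l hkl => pastSigma_mono N (ht hkl),
    fun k => pastSigma_le hN _⟩ with h𝒢
  set ξ : ℕ → Ω → f.ι → ℝ := fun k ω a =>
    compensated N (timeProd ν) (Set.Ioc (t k) (t (k + 1)) ×ˢ f.A a) ω with hξ
  -- `F a` is active exactly on the grid intervals inside `(s a, u a]`; these start no earlier than
  -- `s a`, so `G` is adapted.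
  set G : ℕ → f.ι → Ω → ℝ := fun k a => if i a ≤ k ∧ k < j a then f.F a else 0 with hG
  have hms : ∀ k a, MeasurableSet (Set.Ioc (t k) (t (k + 1)) ×ˢ f.A a) := fun k a =>
    measurableSet_Ioc.prod (f.measurableSet_A a)
  have hfin : ∀ k a, timeProd ν (Set.Ioc (t k) (t (k + 1)) ×ˢ f.A a) < ∞ := fun k a =>
    timeProd_lt_top _ _ (f.measure_A_lt_top a)
  have hGm : ∀ k a, Measurable[𝒢 k] (G k a) := fun k a => by
    simp only [hG]
    split_ifs with h
    · refine (f.measurable_F a).mono (pastSigma_mono N ?_) le_rfl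
      rw [← his]
      exact ht h.1
    · exact measurable_const
  have hGb : ∀ k a, ∃ C : ℝ, ∀ ω, |G k a ω| ≤ C := fun k a => by
    simp only [hG]
    split_ifs with h
    · exact f.bounded_F a
    · exact ⟨0, fun ω => by simp⟩
  have hind : ∀ k, Indep (MeasurableSpace.comap (ξ k) inferInstance) (𝒢 k) P := fun k => by
    refine indep_of_indep_of_le_left (indep_of_indep_of_le_right (hN.indep_regionSigma
      (U := Set.Ioi (t k) ×ˢ Set.univ) (V := Set.Iic (t k) ×ˢ Set.univ) ?_)
      (pastSigma_le_regionSigma (t k))) ?_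
    · rw [Set.disjoint_left]
      rintro z ⟨h1, -⟩ ⟨h2, -⟩
      exact absurd (Set.mem_Ioi.1 h1) (not_lt.2 h2)
    · refine Measurable.comap_le ?_
      refine @measurable_pi_lambda _ _ _ (regionSigma N (Set.Ioi (t k) ×ˢ Set.univ)) _ _ fun a => ?_
      exact measurable_compensated_regionSigma (hms k a)
        (Set.prod_mono (fun x hx => hx.1) (Set.subset_univ _))
  have key := hβ Ω P 𝒢 f.ι ξ G f.x (fun k => ?_) hind
    (fun k a => memLp_compensated hN (hms k a) (hfin k a) hp)
    (fun k a => integral_compensated hN (hms k a) (hfin k a)) hGm hGb n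
  · have hsum : ∀ ω ω', (∀ a, compensated N (timeProd ν) (f.cell a) ω' = ∑ k ∈ Finset.Ico (i a) (j a),
        ξ k ω' a) → ∑ k ∈ Finset.range n, ∑ a, (G k a ω * ξ k ω' a) • f.x a =
        ∑ a, (f.F a ω * compensated N (timeProd ν) (f.cell a) ω') • f.x a := fun ω ω' h => by
      rw [Finset.sum_comm]
      refine Finset.sum_congr rfl fun a _ => ?_
      rw [h a, Finset.mul_sum, Finset.sum_smul]
      have h1 : Finset.Ico (i a) (j a) = (Finset.range n).filter fun k => i a ≤ k ∧ k < j a := by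
        ext k
        simp only [Finset.mem_Ico, Finset.mem_filter, Finset.mem_range]
        exact ⟨fun h => ⟨h.2.trans_le (hj a), h⟩, fun h => h.2⟩
      rw [h1, Finset.sum_filter]
      refine Finset.sum_congr rfl fun k _ => ?_
      simp only [hG]
      split_ifs <;> simp
    have hae : ∀ᵐ ω ∂P, ∀ a, compensated N (timeProd ν) (f.cell a) ω
        = ∑ k ∈ Finset.Ico (i a) (j a), ξ k ω a := ae_all_iff.2 fun a => by
      have := compensated_Ioc_ae hN ht (i a) (j a) (f.measurableSet_A a)
        (f.measure_A_lt_top a)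
      rw [his, hju] at this
      exact this
    have e1 : eLpNorm f.integral p P
        = eLpNorm (fun ω => ∑ k ∈ Finset.range n, ∑ a, (G k a ω * ξ k ω a) • f.x a) p P := by
      refine eLpNorm_congr_ae ?_
      filter_upwards [hae] with ω h
      exact (hsum ω ω h).symm
    rw [e1, f.eLpNorm_process hN hp]
    refine key.trans (le_of_eq ?_)
    congr 1
    refine eLpNorm_congr_ae ?_
    -- The splitting of the cells along the grid is almost sure, and is transported to the second
    -- copy.
    have := (Measure.quasiMeasurePreserving_snd (μ := P) (ν := P)).ae hae
    filter_upwards [this] with z h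
    exact hsum z.1 z.2 h
  · refine @measurable_pi_lambda _ _ _ (𝒢 (k + 1)) _ _ fun a => ?_
    exact (measurable_pastSigma le_rfl (f.measurableSet_A a)).ennreal_toReal.sub_const _

end Family

/-! ### The past is generated by the noise up to null sets -/

section Noise

/-- Measurability with respect to `m` enlarged by null sets reduces to simple functions, and then to
a limit. -/
theorem exists_measurable_ae_eq {Ω : Type*} {m : MeasurableSpace Ω} [MeasurableSpace Ω]
    {P : Measure Ω} {F : Ω → ℝ} (hF : Measurable[eventuallyMeasurableSpace m (ae P)] F) :
    ∃ G : Ω → ℝ, Measurable[m] G ∧ F =ᵐ[P] G := by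
  classical
  set m' := eventuallyMeasurableSpace m (ae P) with hm'
  have key : ∀ s : @SimpleFunc Ω m' ℝ, ∃ G : Ω → ℝ, Measurable[m] G ∧ ⇑s =ᵐ[P] G := by
    intro s
    induction s using SimpleFunc.induction with
    | @const c s hs =>
      obtain ⟨t, ht, hst⟩ := hs
      refine ⟨t.indicator fun _ => c, measurable_const.indicator ht, ?_⟩
      filter_upwards [hst] with ω hω
      have h1 : (ω ∈ s) = (ω ∈ t) := hω
      by_cases h : ω ∈ t
      · rw [Set.indicator_of_mem h]
        exact Set.piecewise_eq_of_mem _ _ _ (h1.mpr h)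
      · rw [Set.indicator_of_notMem h]
        exact Set.piecewise_eq_of_notMem _ _ _ fun h' => h (h1.mp h')
    | add _ hf hg =>
      obtain ⟨G, hG, hfG⟩ := hf
      obtain ⟨H, hH, hgH⟩ := hg
      exact ⟨G + H, hG.add hH, hfG.add hgH⟩
  have hs : StronglyMeasurable[m'] F := hF.stronglyMeasurable
  choose G hG hGe using fun n => key (hs.approx n)
  -- The upper limit is `m`-measurable even though convergence may fail on a null set.
  refine ⟨fun ω => Filter.limsup (fun n => G n ω) Filter.atTop, Measurable.limsup hG, ?_⟩
  filter_upwards [ae_all_iff.2 hGe] with ω hω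
  have h1 := hs.tendsto_approx ω
  simp_rw [hω] at h1
  exact h1.limsup_eq.symm

variable {Ω : Type u} {E : Type w} [MeasurableSpace E] {N : Ω → Measure E} {μ : Measure E}

theorem measurable_compensated_noiseSigma {B : Set E} (hB : MeasurableSet B) (hμ : μ B < ∞) :
    Measurable[noiseSigma N μ] (compensated N μ B) :=
  Measurable.of_comap_le (le_iSup₂_of_le B ⟨hB, hμ⟩ le_rfl)

variable [mΩ : MeasurableSpace Ω] {P : Measure Ω}

theorem noiseSigma_le (hN : IsPoissonRandomMeasure N μ P) : noiseSigma N μ ≤ mΩ :=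
  iSup₂_le fun _ hB => (measurable_compensated hN hB.1).comap_le

/-- The past involves sets of infinite measure, and `𝒢` does not. On such sets `N` is almost surely
the constant `∞`; on the others it is recovered from `Ñ` by adding the measure, almost surely. -/
theorem regionSigma_le_eventuallyMeasurableSpace (hN : IsPoissonRandomMeasure N μ P) (U : Set E) :
    regionSigma N U ≤ eventuallyMeasurableSpace (noiseSigma N μ) (ae P) := by
  refine iSup₂_le fun B hB => ?_
  rintro _ ⟨S, hS, rfl⟩
  rcases lt_or_eq_of_le (le_top : μ B ≤ ∞) with hμ | hμ
  · refine ⟨(fun ω => ENNReal.ofReal (compensated N μ B ω + (μ B).toReal)) ⁻¹' S,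
      measurable_compensated_noiseSigma hB.1 hμ
        ((by fun_prop : Measurable fun x : ℝ => ENNReal.ofReal (x + (μ B).toReal)) hS), ?_⟩
    filter_upwards [ae_lt_top hN hB.1 hμ] with ω hω
    have h1 : ENNReal.ofReal (compensated N μ B ω + (μ B).toReal) = N ω B := by
      simp [compensated, ENNReal.ofReal_toReal hω.ne]
    change (N ω B ∈ S) = (ENNReal.ofReal (compensated N μ B ω + (μ B).toReal) ∈ S)
    rw [h1]
  · by_cases h : ∞ ∈ S
    · refine ⟨Set.univ, @MeasurableSet.univ _ (_), ?_⟩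
      filter_upwards [hN.ae_eq_top B hB.1 hμ] with ω hω
      change (N ω B ∈ S) = True
      simp [hω, h]
    · refine ⟨∅, @MeasurableSet.empty _ (_), ?_⟩
      filter_upwards [hN.ae_eq_top B hB.1 hμ] with ω hω
      change (N ω B ∈ S) = False
      simp [hω, h]

end Noise

section FamilyNoise

variable {Ω : Type u} [mΩ : MeasurableSpace Ω] {J : Type w} [MeasurableSpace J]
  {N : Ω → Measure (ℝ≥0 × J)} {ν : Measure J} {X : Type v} [NormedAddCommGroup X] [NormedSpace ℝ X]
  {P : Measure Ω} [SigmaFinite ν]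

/-- The coefficients are replaced by almost surely equal `𝒢`-measurable ones; this gives the
measurability required of a value of the divergence. -/
theorem AdaptedFamily.aestronglyMeasurable_integral
    (hN : IsPoissonRandomMeasure N (timeProd ν) P) (f : AdaptedFamily N ν X) :
    AEStronglyMeasurable[noiseSigma N (timeProd ν)] f.integral P := by
  choose G hG hFG using fun a => exists_measurable_ae_eq ((f.measurable_F a).mono
    ((pastSigma_le_regionSigma _).trans (regionSigma_le_eventuallyMeasurableSpace hN _)) le_rfl)
  refine ⟨fun ω => ∑ a, (G a ω * compensated N (timeProd ν) (f.cell a) ω) • f.x a, ?_, ?_⟩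
  · refine Finset.stronglyMeasurable_fun_sum _ fun a _ =>
      StronglyMeasurable.smul_const (Measurable.stronglyMeasurable ?_) _
    exact (hG a).mul (measurable_compensated_noiseSigma (f.measurableSet_cell a)
      (f.measure_cell_lt_top a))
  · filter_upwards [ae_all_iff.2 hFG] with ω hω
    exact Finset.sum_congr rfl fun a _ => by rw [hω]

end FamilyNoise

/-! ### Integration by parts -/

section Parts

variable {Ω : Type u} [mΩ : MeasurableSpace Ω] {E : Type w} [MeasurableSpace E]
  {N : Ω → Measure E} {μ : Measure E} {P : Measure Ω} [IsProbabilityMeasure P]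

theorem integrable_bdd_mul_mul {F Z G : Ω → ℝ} {p q : ℝ≥0∞} [ENNReal.HolderConjugate p q]
    (hF : AEStronglyMeasurable F P) {C : ℝ} (hC : ∀ ω, |F ω| ≤ C) (hZ : MemLp Z p P)
    (hG : MemLp G q P) : Integrable (fun ω => Z ω * (F ω * G ω)) P := by
  have h1 : Integrable (fun ω => F ω * (Z ω * G ω)) P :=
    (hZ.integrable_mul hG).bdd_mul (c := C) hF (ae_of_all _ hC)
  refine h1.congr (ae_of_all _ fun ω => ?_)
  ring

/-- Integration by parts on a set `C ∩ B m`. -/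
theorem integral_compensated_inter_mul (hN : IsPoissonRandomMeasure N μ P) {p q : ℝ≥0∞}
    [ENNReal.HolderConjugate p q] (hp : p ≠ ∞) {C : Set E} (hC : MeasurableSet C)
    {F : Ω → ℝ} (hF : Measurable[regionSigma N Cᶜ] F) {K : ℝ} (hK : ∀ ω, |F ω| ≤ K) {M : ℕ}
    {B : Fin M → Set E} (hB : ∀ l, MeasurableSet (B l)) (hμ : ∀ l, μ (B l) < ∞)
    (hd : Pairwise fun l l' => Disjoint (B l) (B l')) (f : (Fin M → ℕ) → ℝ)
    (hf : MemLp (fun ω => f fun l => count N (B l) ω) q P) (j : Fin M) :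
    Integrable (fun ω => (μ (C ∩ B j)).toReal * (F ω * (f ((fun l => count N (B l) ω) +
      Pi.single j 1) - f fun l => count N (B l) ω))) P ∧
    ∫ ω, compensated N μ (C ∩ B j) ω * (F ω * f fun l => count N (B l) ω) ∂P
      = ∫ ω, (μ (C ∩ B j)).toReal * (F ω * (f ((fun l => count N (B l) ω) + Pi.single j 1)
        - f fun l => count N (B l) ω)) ∂P := by
  classical
  set D := C ∩ B j with hD
  have hDm : MeasurableSet D := hC.inter (hB j)
  have hDμ : μ D < ∞ := (measure_mono Set.inter_subset_right).trans_lt (hμ j)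
  have hFm : Measurable F := hF.mono (regionSigma_le hN _) le_rfl
  set r : ℝ≥0 := (μ D).toNNReal with hr
  have hr' : (μ D).toReal = (r : ℝ) := rfl
  set Z := count N D with hZ
  -- The count of `B j` is replaced by `k` plus the count of `B j \ C`, so `h k` depends only on `N`
  -- off `D` and is independent of `Z`. Raising `k` by one is the shift by `Pi.single j 1`.
  set h : ℕ → Ω → ℝ := fun k ω => F ω * f fun l =>
    if l = j then count N (B l \ C) ω + k else count N (B l) ω with hh
  have hhm : ∀ k, Measurable[regionSigma N Dᶜ] (h k) := fun k => by
    refine (hF.mono (regionSigma_mono ?_) le_rfl).mul ((measurable_of_countable f).comp ?_)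
    · exact Set.compl_subset_compl.2 Set.inter_subset_left
    · refine @measurable_pi_lambda _ _ _ (regionSigma N Dᶜ) _ _ fun l => ?_
      by_cases hl : l = j
      · simp only [hl, if_true]
        refine Measurable.add_const (measurable_count_regionSigma ((hB j).diff hC) ?_) k
        exact fun x hx hx' => hx.2 hx'.1
      · simp only [hl, if_false]
        refine measurable_count_regionSigma (hB l) fun x hx hx' => ?_
        exact Set.disjoint_left.1 (hd hl) hx hx'.2
  have hcount : ∀ᵐ ω ∂P, count N (B j) ω = Z ω + count N (B j \ C) ω := by
    filter_upwards [count_eq_add_ae hN (hB j) hC (hμ j)] with ω hω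
    rw [hω, hZ, hD, Set.inter_comm]
  have e1 : (fun ω => h (Z ω) ω) =ᵐ[P] fun ω => F ω * f fun l => count N (B l) ω := by
    filter_upwards [hcount] with ω hω
    simp only [hh]
    congr 2
    funext l
    by_cases hl : l = j
    · subst hl; simp [hω, add_comm]
    · simp [hl]
  have e2 : (fun ω => h (Z ω + 1) ω)
      =ᵐ[P] fun ω => F ω * f ((fun l => count N (B l) ω) + Pi.single j 1) := by
    filter_upwards [hcount] with ω hω
    simp only [hh]
    congr 2
    funext l
    by_cases hl : l = j
    · subst hl; simp [hω]; ring
    · simp [hl]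
  have hi0 : Integrable (fun ω => F ω * f fun l => count N (B l) ω) P :=
    (hf.integrable (ENNReal.HolderConjugate.one_le q p)).bdd_mul (c := K)
      hFm.aestronglyMeasurable (ae_of_all _ hK)
  have hi1 : Integrable (fun ω => (Z ω : ℝ) * h (Z ω) ω) P := by
    refine (integrable_bdd_mul_mul hFm.aestronglyMeasurable hK (memLp_count hN hDm hDμ hp) hf).congr
      ?_
    filter_upwards [e1] with ω hω
    rw [hω]
  obtain ⟨hi2, hS⟩ := integral_stein (regionSigma_le hN _) (measurable_count hN hDm)
    (map_count hN hDm hDμ) (indep_comap_count hN hDm) hhm hi1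
  have e3 : (fun ω => (μ D).toReal * (F ω * (f ((fun l => count N (B l) ω) + Pi.single j 1)
      - f fun l => count N (B l) ω))) =ᵐ[P] fun ω => (r : ℝ) * h (Z ω + 1) ω -
        (r : ℝ) * (F ω * f fun l => count N (B l) ω) := by
    filter_upwards [e2] with ω hω
    rw [hω, hr']; ring
  refine ⟨(hi2.sub (hi0.const_mul _)).congr e3.symm, ?_⟩
  rw [integral_congr_ae e3, integral_sub hi2 (hi0.const_mul _), ← hS,
    ← integral_sub hi1 (hi0.const_mul _)]
  refine integral_congr_ae ?_
  filter_upwards [e1, ae_compensated_eq hN hDm hDμ] with ω h1 h2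
  rw [h1, h2]; ring

/-- Integration by parts for the compensated random measure and functions of the counting
variables. -/
theorem integral_compensated_mul (hN : IsPoissonRandomMeasure N μ P) {p q : ℝ≥0∞}
    [ENNReal.HolderConjugate p q] (hp : p ≠ ∞) {C : Set E} (hC : MeasurableSet C) (hCμ : μ C < ∞)
    {F : Ω → ℝ} (hF : Measurable[regionSigma N Cᶜ] F) {K : ℝ} (hK : ∀ ω, |F ω| ≤ K) {M : ℕ}
    {B : Fin M → Set E} (hB : ∀ l, MeasurableSet (B l)) (hμ : ∀ l, μ (B l) < ∞)
    (hd : Pairwise fun l l' => Disjoint (B l) (B l')) (f : (Fin M → ℕ) → ℝ)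
    (hf : MemLp (fun ω => f fun l => count N (B l) ω) q P) :
    Integrable (fun ω => ∑ j, (μ (C ∩ B j)).toReal * (F ω * (f ((fun l => count N (B l) ω) +
      Pi.single j 1) - f fun l => count N (B l) ω))) P ∧
    ∫ ω, compensated N μ C ω * (F ω * f fun l => count N (B l) ω) ∂P
      = ∫ ω, ∑ j, (μ (C ∩ B j)).toReal * (F ω * (f ((fun l => count N (B l) ω) + Pi.single j 1)
        - f fun l => count N (B l) ω)) ∂P := by
  classical
  have key := integral_compensated_inter_mul hN hp hC hF hK hB hμ hd f hf
  refine ⟨integrable_finsetSum _ fun j _ => (key j).1, ?_⟩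
  have hFm : Measurable F := hF.mono (regionSigma_le hN _) le_rfl
  have hgm : ∀ U : Set E, (∀ l, B l ⊆ U) → Measurable[regionSigma N U] fun ω =>
      f fun l => count N (B l) ω := fun U hU =>
    (measurable_of_countable f).comp (@measurable_pi_lambda _ _ _ (regionSigma N U) _ _ fun l =>
      measurable_count_regionSigma (hB l) (hU l))
  set G : Ω → ℝ := fun ω => F ω * f fun l => count N (B l) ω with hG
  -- `C` is cut into the pieces `C ∩ B l` and, at `none`, the remainder outside all `B l`.
  set D : Option (Fin M) → Set E := fun o => o.elim (C \ ⋃ l, B l) fun l => C ∩ B l with hD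
  have hDm : ∀ o, MeasurableSet (D o) := by
    rintro (_ | l)
    · exact hC.diff (MeasurableSet.iUnion hB)
    · exact hC.inter (hB l)
  have hDC : ∀ o, D o ⊆ C := by
    rintro (_ | l)
    · exact Set.sdiff_subset
    · exact Set.inter_subset_left
  have hDμ : ∀ o, μ (D o) < ∞ := fun o => (measure_mono (hDC o)).trans_lt hCμ
  have hDd : (↑(Finset.univ : Finset (Option (Fin M))) : Set (Option (Fin M))).PairwiseDisjoint
      D := by
    rintro (_ | l) - (_ | l') - h
    · exact absurd rfl h
    · exact Set.disjoint_left.2 fun x hx hx' => hx.2 (Set.mem_iUnion.2 ⟨l', hx'.2⟩)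
    · exact Set.disjoint_left.2 fun x hx hx' => hx'.2 (Set.mem_iUnion.2 ⟨l, hx.2⟩)
    · exact (hd fun h' => h (by rw [h'])).mono Set.inter_subset_right Set.inter_subset_right
  have hDU : C = ⋃ o ∈ (Finset.univ : Finset (Option (Fin M))), D o := by
    refine Set.Subset.antisymm (fun x hx => ?_) (Set.iUnion₂_subset fun o _ => hDC o)
    by_cases h : x ∈ ⋃ l, B l
    · obtain ⟨l, hl⟩ := Set.mem_iUnion.1 h
      exact Set.mem_biUnion (Finset.mem_univ (some l)) ⟨hx, hl⟩
    · exact Set.mem_biUnion (Finset.mem_univ none) ⟨hx, h⟩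
  have hsum := compensated_biUnion_ae hN Finset.univ hDd hDm hDμ
  rw [← hDU] at hsum
  have hi : ∀ o, Integrable (fun ω => compensated N μ (D o) ω * G ω) P := fun o =>
    integrable_bdd_mul_mul hFm.aestronglyMeasurable hK (memLp_compensated hN (hDm o) (hDμ o) hp) hf
  have e1 : ∫ ω, compensated N μ C ω * G ω ∂P
      = ∑ o, ∫ ω, compensated N μ (D o) ω * G ω ∂P := by
    rw [← integral_finsetSum _ fun o _ => hi o]
    refine integral_congr_ae ?_
    filter_upwards [hsum] with ω hω
    rw [hω, Finset.sum_mul]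
  -- Nothing in `G` sees the remainder, so its centred noise is independent of `G` and contributes
  -- zero.
  have e2 : ∫ ω, compensated N μ (D none) ω * G ω ∂P = 0 := by
    have h1 : Measurable[regionSigma N (D none)ᶜ] G := by
      refine (hF.mono (regionSigma_mono ?_) le_rfl).mul (hgm _ fun l x hx hx' => ?_)
      · exact Set.compl_subset_compl.2 (hDC none)
      · exact hx'.2 (Set.mem_iUnion.2 ⟨l, hx⟩)
    have h2 := measurable_compensated_regionSigma (N := N) (μ := μ) (hDm none) (le_refl (D none))
    have hind : IndepFun (compensated N μ (D none)) G P := by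
      rw [IndepFun_iff_Indep]
      exact indep_of_indep_of_le_left (indep_of_indep_of_le_right
        (hN.indep_regionSigma disjoint_compl_right) h1.comap_le) h2.comap_le
    rw [hind.integral_fun_mul_eq_mul_integral
      (measurable_compensated hN (hDm none)).aestronglyMeasurable
      (h1.mono (regionSigma_le hN _) le_rfl).aestronglyMeasurable,
      integral_compensated hN (hDm none) (hDμ none), zero_mul]
  rw [e1, Fintype.sum_option, e2, zero_add, integral_finsetSum _ fun j _ => (key j).1]
  exact Finset.sum_congr rfl fun j _ => (key j).2

/-- The covariance of the compensated random measure. -/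
theorem integral_compensated_mul_compensated (hN : IsPoissonRandomMeasure N μ P)
    {B C : Set E} (hB : MeasurableSet B) (hBμ : μ B < ∞) (hC : MeasurableSet C) (hCμ : μ C < ∞) :
    ∫ ω, compensated N μ C ω * compensated N μ B ω ∂P = (μ (C ∩ B)).toReal := by
  -- Integration by parts against the count of `B` itself, whose difference operator is `1`.
  have h1 := (integral_compensated_mul hN (p := 2) (q := 2) (by simp) hC hCμ (F := fun _ => 1)
    measurable_const (K := 1) (by simp) (M := 1) (B := fun _ => B) (fun _ => hB) (fun _ => hBμ)
    (fun i j h => absurd (Subsingleton.elim i j) h) (fun k => (k 0 : ℝ))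
    (memLp_count hN hB hBμ (by simp))).2
  simp only [one_mul, Finset.univ_unique, Finset.sum_singleton, Pi.add_apply, Fin.default_eq_zero,
    Pi.single_eq_same, Nat.cast_add, Nat.cast_one, add_sub_cancel_left, mul_one,
    integral_const, probReal_univ, smul_eq_mul] at h1
  rw [← h1]
  have h2 : (fun ω => compensated N μ C ω * compensated N μ B ω) =ᵐ[P] fun ω =>
      compensated N μ C ω * count N B ω - compensated N μ C ω * (μ B).toNNReal := by
    filter_upwards [ae_compensated_eq hN hB hBμ] with ω hω
    rw [hω, mul_sub]
  rw [integral_congr_ae h2, integral_sub, integral_mul_const, integral_compensated hN hC hCμ]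
  · ring
  · exact (memLp_compensated hN hC hCμ (p := 2) (by simp)).integrable_mul
      (memLp_count hN hB hBμ (p := 2) (by simp))
  · exact ((memLp_compensated hN hC hCμ (p := 1) (by simp)).integrable le_rfl).mul_const _

end Parts

/-! ### Linear relations tested on spanning sets. -/

theorem eq_of_mem_closure_span {A B : Type*} [NormedAddCommGroup A] [NormedSpace ℝ A]
    [NormedAddCommGroup B] [NormedSpace ℝ B] (f : A →L[ℝ] ℝ) (g : B →L[ℝ] ℝ) {S : Set (A × B)}
    (h : ∀ z ∈ S, f z.1 = g z.2) (z : A × B) (hz : z ∈ (Submodule.span ℝ S).topologicalClosure) :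
    f z.1 = g z.2 := by
  set T : A × B →L[ℝ] ℝ := f.comp (ContinuousLinearMap.fst ℝ A B) -
    g.comp (ContinuousLinearMap.snd ℝ A B) with hT
  have h1 : (Submodule.span ℝ S).topologicalClosure ≤ LinearMap.ker T.toLinearMap :=
    Submodule.topologicalClosure_minimal _
      (Submodule.span_le.2 fun z hz => sub_eq_zero.2 (h z hz)) T.isClosed_ker
  exact sub_eq_zero.1 (h1 hz)

theorem bilinear_sum_smul_sum_smul {A B : Type*} [NormedAddCommGroup A] [NormedSpace ℝ A]
    [NormedAddCommGroup B] [NormedSpace ℝ B] (L : A →L[ℝ] B →L[ℝ] ℝ) {ι κ κ' : Type*} [Fintype ι]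
    [Fintype κ] [Fintype κ'] (α : ι → ℝ) (u : ι → A) (β : κ → κ' → ℝ) (v : κ → κ' → B) :
    L (∑ a, α a • u a) (∑ i, ∑ m, β i m • v i m)
      = ∑ a, ∑ i, ∑ m, α a * (β i m * L (u a) (v i m)) := by
  simp only [map_sum, sum_apply, map_smul, smul_apply, smul_eq_mul, Finset.mul_sum]
  refine (Finset.sum_congr rfl fun i _ => Finset.sum_comm).trans (Finset.sum_comm.trans ?_)
  exact Finset.sum_congr rfl fun a _ => Finset.sum_congr rfl fun i _ =>
    Finset.sum_congr rfl fun m _ => mul_left_comm _ _ _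

theorem isClosed_eq_bilinear {A A' B B' : Type*} [NormedAddCommGroup A] [NormedSpace ℝ A]
    [NormedAddCommGroup B] [NormedSpace ℝ B] [NormedAddCommGroup A'] [NormedSpace ℝ A']
    [NormedAddCommGroup B'] [NormedSpace ℝ B'] (f : A →L[ℝ] A' →L[ℝ] ℝ) (g : B →L[ℝ] B' →L[ℝ] ℝ)
    (a : A') (b : B') : IsClosed {z : A × B | g z.2 b = f z.1 a} :=
  isClosed_eq ((g.flip b).continuous.comp continuous_snd)
    ((f.flip a).continuous.comp continuous_fst)

/-! ### The pairing as a bounded bilinear form -/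

section Pairing

variable {Ω : Type u} [mΩ : MeasurableSpace Ω] {E : Type w} [MeasurableSpace E]
  (N : Ω → Measure E) (μ : Measure E) (P : Measure Ω)
  (p q : ℝ≥0∞) [Fact (1 ≤ p)] [Fact (1 ≤ q)] [ENNReal.HolderConjugate p q]
  (X : Type v) [NormedAddCommGroup X] [NormedSpace ℝ X]

/-- The duality of `L^p(Ω; X)` and `L^q(Ω; X*)`. -/
noncomputable def dualPairing : Lp X p P →L[ℝ] Lp (StrongDual ℝ X) q P →L[ℝ] ℝ :=
  (NormedSpace.inclusionInDoubleDual ℝ X).lpPairing P p q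

/-- The duality of `ν_p(E; X)` and `ν_q(E; X*)`. -/
noncomputable def nuPairing :
    nuSpace N μ P p X →L[ℝ] nuSpace N μ P q (StrongDual ℝ X) →L[ℝ] ℝ :=
  (dualPairing P p q X).bilinearComp (nuSpace N μ P p X).subtypeL
    (nuSpace N μ P q (StrongDual ℝ X)).subtypeL

/-- The duality of `L^p(Ω; ν_p(E; X))` and `L^q(Ω; ν_q(E; X*))`. -/
noncomputable def processPairing : Lp (nuSpace N μ P p X) p P →L[ℝ]
    Lp (nuSpace N μ P q (StrongDual ℝ X)) q P →L[ℝ] ℝ :=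
  (nuPairing N μ P p q X).lpPairing P p q

variable {N μ P p q X}

theorem dualPairing_apply (ψ : Lp X p P) (G : Lp (StrongDual ℝ X) q P) :
    dualPairing P p q X ψ G = ∫ ω, (G ω) (ψ ω) ∂P :=
  ContinuousLinearMap.lpPairing_eq_integral _ _ _

theorem nuPairing_apply (u : nuSpace N μ P p X) (v : nuSpace N μ P q (StrongDual ℝ X)) :
    nuPairing N μ P p q X u v = dualPairing P p q X u v :=
  rfl

theorem processPairing_apply (φ : Lp (nuSpace N μ P p X) p P)
    (Ψ : Lp (nuSpace N μ P q (StrongDual ℝ X)) q P) :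
    processPairing N μ P p q X φ Ψ = ∫ ω, nuPairing N μ P p q X (φ ω) (Ψ ω) ∂P :=
  ContinuousLinearMap.lpPairing_eq_integral _ _ _

theorem processPairing_eq_pairing (φ : Lp (nuSpace N μ P p X) p P)
    (Ψ : Lp (nuSpace N μ P q (StrongDual ℝ X)) q P) :
    processPairing N μ P p q X φ Ψ = pairing φ Ψ := by
  rw [processPairing_apply]
  exact integral_congr_ae (ae_of_all _ fun ω => (nuPairing_apply _ _).trans (dualPairing_apply _ _))

/-- With continuous bilinear forms on both sides, the condition for a fixed `G` is visibly closed
and linear in the pair. -/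
theorem isDivergence_iff {φ : Lp (nuSpace N μ P p X) p P} {ψ : Lp X p P} :
    IsDivergence q φ ψ ↔ AEStronglyMeasurable[noiseSigma N μ] ψ P ∧
      ∀ G ∈ malliavinGraph N μ P q (StrongDual ℝ X),
        dualPairing P p q X ψ G.1 = processPairing N μ P p q X φ G.2 := by
  simp only [IsDivergence, mem_lpMeas_iff_aestronglyMeasurable, processPairing_eq_pairing,
    dualPairing_apply, eq_comm]

attribute [irreducible] dualPairing nuPairing processPairing

variable [IsProbabilityMeasure P]

/-- The covariance of `Ñ` turns the abstract duality into integration over `E`; this is where `ν_p`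
meets the measure `μ`. -/
theorem nuPairing_nuIndicator (hN : IsPoissonRandomMeasure N μ P) (hp : p ≠ ∞) (hq : q ≠ ∞)
    {B C : Set E} (hB : MeasurableSet B) (hBμ : μ B < ∞) (hC : MeasurableSet C) (hCμ : μ C < ∞)
    (x : X) (y : StrongDual ℝ X) :
    nuPairing N μ P p q X (nuIndicator N μ P p B x) (nuIndicator N μ P q C y)
      = (μ (B ∩ C)).toReal * y x := by
  rw [nuPairing_apply, dualPairing_apply]
  rw [← integral_compensated_mul_compensated hN hC hCμ hB hBμ, ← integral_mul_const]
  refine integral_congr_ae ?_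
  filter_upwards [coeFn_nuIndicator hN hp hB hBμ x, coeFn_nuIndicator hN hq hC hCμ y] with ω h1 h2
  rw [h1, h2]
  simp only [smul_apply, map_smul, smul_eq_mul]
  ring

end Pairing

/-! ### Adjointness of the Itô integral and the Malliavin derivative. -/

section Duality

variable {Ω : Type u} [mΩ : MeasurableSpace Ω] {P : Measure Ω} [IsProbabilityMeasure P]
  {J : Type w} [MeasurableSpace J] {ν : Measure J} [SigmaFinite ν] {N : Ω → Measure (ℝ≥0 × J)}
  {X : Type v} [NormedAddCommGroup X] [NormedSpace ℝ X]
  {p q : ℝ≥0∞} [Fact (1 ≤ p)] [Fact (1 ≤ q)] [ENNReal.HolderConjugate p q]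

/-- The coefficient depends on `N` up to time `s a` and the cell begins after it. This is the only
use of adaptedness in the integration by parts. -/
theorem AdaptedFamily.measurable_F_regionSigma (f : AdaptedFamily N ν X) (a : f.ι) :
    Measurable[regionSigma N (f.cell a)ᶜ] (f.F a) := by
  refine (f.measurable_F a).mono ((pastSigma_le_regionSigma _).trans (regionSigma_mono ?_)) le_rfl
  rintro ⟨t, j⟩ h1 h2
  exact absurd h1.1 (not_le.2 h2.1.1)

/-- The real cylindrical function `∑ i, ⟨x i, x⟩ f i`. -/
def CylindricalData.eval {E : Type w} [MeasurableSpace E]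
    {μ : Measure E} (c : CylindricalData μ (StrongDual ℝ X)) (x : X) (k : Fin c.M → ℕ) : ℝ :=
  ∑ i, c.f i k * c.x i x

theorem AdaptedFamily.nuPairing_process_deriv (hN : IsPoissonRandomMeasure N (timeProd ν) P)
    (hp : p ≠ ∞) (hq : q ≠ ∞) (f : AdaptedFamily N ν X)
    (c : CylindricalData (timeProd ν) (StrongDual ℝ X)) (ω : Ω) :
    nuPairing N (timeProd ν) P p q X (f.process P p ω) (c.deriv N P q ω)
      = ∑ a, ∑ m, (timeProd ν (f.cell a ∩ c.B m)).toReal *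
        (f.F a ω * (c.eval (f.x a) ((fun l => count N (c.B l) ω) + Pi.single m 1) -
          c.eval (f.x a) fun l => count N (c.B l) ω)) := by
  rw [AdaptedFamily.process, CylindricalData.deriv]
  refine (bilinear_sum_smul_sum_smul (A := nuSpace N (timeProd ν) P p X)
    (B := nuSpace N (timeProd ν) P q (StrongDual ℝ X)) _ _ _ _ _).trans ?_
  refine Finset.sum_congr rfl fun a _ => ?_
  rw [Finset.sum_comm]
  refine Finset.sum_congr rfl fun m _ => ?_
  rw [CylindricalData.eval, CylindricalData.eval, ← Finset.sum_sub_distrib, Finset.mul_sum,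
    Finset.mul_sum]
  refine Finset.sum_congr rfl fun i _ => ?_
  rw [nuPairing_nuIndicator hN hp hq (f.measurableSet_cell a) (f.measure_cell_lt_top a)
    (c.measurableSet_B m) (c.measure_B_lt_top m)]
  ring

theorem AdaptedFamily.apply_integral (f : AdaptedFamily N ν X)
    (c : CylindricalData (timeProd ν) (StrongDual ℝ X)) (ω : Ω) :
    c.toFun N ω (f.integral ω) = ∑ a, compensated N (timeProd ν) (f.cell a) ω *
      (f.F a ω * c.eval (f.x a) fun l => count N (c.B l) ω) := by
  simp only [AdaptedFamily.integral, CylindricalData.toFun, map_sum, sum_apply, map_smul,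
    smul_apply, smul_eq_mul, CylindricalData.eval, Finset.mul_sum]
  exact Finset.sum_congr rfl fun a _ => Finset.sum_congr rfl fun i _ => by ring

theorem CylindricalData.memLp_eval {c : CylindricalData (timeProd ν) (StrongDual ℝ X)}
    {G : Lp (StrongDual ℝ X) q P} (hG : G =ᵐ[P] c.toFun N) (x : X) :
    MemLp (fun ω => c.eval x fun l => count N (c.B l) ω) q P := by
  have h1 : MemLp (fun ω => G ω x) q P :=
    (NormedSpace.inclusionInDoubleDual ℝ X x).comp_memLp' (Lp.memLp G)
  refine h1.ae_eq ?_
  filter_upwards [hG] with ω hω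
  rw [hω]
  simp [CylindricalData.toFun, CylindricalData.eval]

/-- The stochastic integral is adjoint to the Malliavin derivative on elementary elements. -/
theorem AdaptedFamily.processPairing_eq (hN : IsPoissonRandomMeasure N (timeProd ν) P)
    (hp : p ≠ ∞) (hq : q ≠ ∞) (f : AdaptedFamily N ν X)
    (c : CylindricalData (timeProd ν) (StrongDual ℝ X))
    {φ : Lp (nuSpace N (timeProd ν) P p X) p P} (hφ : φ =ᵐ[P] f.process P p)
    {ψ : Lp X p P} (hψ : ψ =ᵐ[P] f.integral) {G : Lp (StrongDual ℝ X) q P}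
    (hG : G =ᵐ[P] c.toFun N) {D : Lp (nuSpace N (timeProd ν) P q (StrongDual ℝ X)) q P}
    (hD : D =ᵐ[P] c.deriv N P q) :
    dualPairing P p q X ψ G = processPairing N (timeProd ν) P p q X φ D := by
  choose C hC using f.bounded_F
  have hgL := fun a => CylindricalData.memLp_eval hG (f.x a)
  have key := fun a => integral_compensated_mul hN hp (f.measurableSet_cell a)
    (f.measure_cell_lt_top a) (f.measurable_F_regionSigma a) (hC a) c.measurableSet_B
    c.measure_B_lt_top c.disjoint_B (c.eval (f.x a)) (hgL a)
  have e1 := processPairing_apply φ D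
  have e2 := dualPairing_apply ψ G
  have e3 := (hφ.comp₂ (fun u v => nuPairing N (timeProd ν) P p q X u v) hD).trans
    (ae_of_all _ (f.nuPairing_process_deriv hN hp hq c))
  have e4 := (hG.comp₂ (fun (y : StrongDual ℝ X) x => y x) hψ).trans
    (ae_of_all _ (f.apply_integral c))
  rw [e1, e2, integral_congr_ae e3, integral_congr_ae e4,
    integral_finsetSum _ fun a _ => (key a).1, integral_finsetSum]
  · exact Finset.sum_congr rfl fun a _ => (key a).2
  · exact fun a _ => integrable_bdd_mul_mul
      ((f.measurable_F a).mono (pastSigma_le hN _) le_rfl).aestronglyMeasurable (hC a)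
      (memLp_compensated hN (f.measurableSet_cell a) (f.measure_cell_lt_top a) hp) (hgL a)

theorem AdaptedFamily.isDivergence (hN : IsPoissonRandomMeasure N (timeProd ν) P)
    (hp : p ≠ ∞) (hq : q ≠ ∞) (f : AdaptedFamily N ν X)
    {φ : Lp (nuSpace N (timeProd ν) P p X) p P} (hφ : φ =ᵐ[P] f.process P p)
    {ψ : Lp X p P} (hψ : ψ =ᵐ[P] f.integral) : IsDivergence q φ ψ := by
  refine isDivergence_iff.2 ⟨(f.aestronglyMeasurable_integral hN).congr hψ.symm, ?_⟩
  refine eq_of_mem_closure_span (A := Lp (StrongDual ℝ X) q P)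
    (B := Lp (nuSpace N (timeProd ν) P q (StrongDual ℝ X)) q P) (dualPairing P p q X ψ)
    (processPairing N (timeProd ν) P p q X φ) (S := {G | ∃ c : CylindricalData _ _,
      G.1 =ᵐ[P] c.toFun N ∧ G.2 =ᵐ[P] c.deriv N P q}) ?_
  rintro G ⟨c, hG1, hG2⟩
  exact f.processPairing_eq hN hp hq c hφ hψ hG1 hG2

end Duality

section Closed

variable {Ω : Type u} [mΩ : MeasurableSpace Ω] {P : Measure Ω} {E : Type w} [MeasurableSpace E]
  {μ : Measure E} {N : Ω → Measure E} {X : Type v} [NormedAddCommGroup X] [NormedSpace ℝ X]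
  {p q : ℝ≥0∞} [Fact (1 ≤ p)] [Fact (1 ≤ q)] [ENNReal.HolderConjugate p q]

/-- An adjoint is closed: its graph is an intersection of closed conditions, one for each test pair,
and `𝒢`-measurability is a closed condition too. -/
theorem isClosed_isDivergence [CompleteSpace X] (hN : IsPoissonRandomMeasure N μ P) :
    IsClosed {z : Lp (nuSpace N μ P p X) p P × Lp X p P | IsDivergence q z.1 z.2} := by
  simp only [isDivergence_iff, Set.ofPred_and, Set.ofPred_forall]
  refine ((isClosed_aestronglyMeasurable (noiseSigma_le hN)).preimage continuous_snd).inter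
    (isClosed_biInter fun G _ => ?_)
  exact isClosed_eq_bilinear (A := Lp (nuSpace N μ P p X) p P) (B := Lp X p P)
    (A' := Lp (nuSpace N μ P q (StrongDual ℝ X)) q P) (B' := Lp (StrongDual ℝ X) q P)
    (processPairing N μ P p q X) (dualPairing P p q X) G.2 G.1

end Closed

/-! ### Operators whose graph lies in the closure of a bounded linear relation -/

section Relation

variable {A B : Type*} [NormedAddCommGroup A] [NormedSpace ℝ A] [NormedAddCommGroup B]
  [NormedSpace ℝ B]

theorem norm_le_of_mem_topologicalClosure {R : Submodule ℝ (A × B)} {β : ℝ≥0}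
    (hR : ∀ z ∈ R, ‖z.2‖ ≤ β * ‖z.1‖) {z : A × B} (hz : z ∈ R.topologicalClosure) :
    ‖z.2‖ ≤ β * ‖z.1‖ :=
  closure_minimal hR (isClosed_le continuous_snd.norm (continuous_const.mul continuous_fst.norm)) hz

/-- The bound survives the closure, so two values at the same point differ by a vector of norm at
most `β * 0`. -/
theorem eq_of_mem_topologicalClosure {R : Submodule ℝ (A × B)} {β : ℝ≥0}
    (hR : ∀ z ∈ R, ‖z.2‖ ≤ β * ‖z.1‖) {a : A} {b b' : B} (h : (a, b) ∈ R.topologicalClosure)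
    (h' : (a, b') ∈ R.topologicalClosure) : b = b' := by
  have h1 := norm_le_of_mem_topologicalClosure hR (sub_mem h h')
  rw [← sub_eq_zero, ← norm_le_zero_iff]
  simpa using h1

/-- The bound makes the values along a convergent sequence of arguments a Cauchy sequence. -/
theorem exists_mem_topologicalClosure [CompleteSpace B] {R : Submodule ℝ (A × B)} {β : ℝ≥0}
    (hR : ∀ z ∈ R, ‖z.2‖ ≤ β * ‖z.1‖) {S : Set A} (hS : ∀ a ∈ S, ∃ b, (a, b) ∈ R) {a : A}
    (ha : a ∈ (Submodule.span ℝ S).topologicalClosure) : ∃ b, (a, b) ∈ R.topologicalClosure := by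
  have h1 : ∀ a ∈ Submodule.span ℝ S, ∃ b, (a, b) ∈ R := by
    intro a ha
    have h2 : Submodule.span ℝ S ≤ R.map (LinearMap.fst ℝ A B) := Submodule.span_le.2 fun a ha => by
      obtain ⟨b, hb⟩ := hS a ha
      exact ⟨(a, b), hb, rfl⟩
    obtain ⟨⟨_, b⟩, hb, rfl⟩ := h2 ha
    exact ⟨b, hb⟩
  obtain ⟨u, hu, hua⟩ := mem_closure_iff_seq_limit.1 (show a ∈ closure (Submodule.span ℝ S : Set A)
    from ha)
  choose y hy using fun n => h1 (u n) (hu n)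
  have hc : CauchySeq y := by
    rw [Metric.cauchySeq_iff]
    intro ε hε
    -- Dividing by `β + 1` also covers `β = 0`.
    obtain ⟨n, hn⟩ := Metric.cauchySeq_iff.1 hua.cauchySeq (ε / (β + 1)) (by positivity)
    refine ⟨n, fun i hi j hj => ?_⟩
    have h2 := hR _ (sub_mem (hy i) (hy j))
    have h3 := hn i hi j hj
    rw [dist_eq_norm] at h3 ⊢
    calc ‖y i - y j‖ ≤ β * ‖u i - u j‖ := h2
      _ ≤ (β + 1) * ‖u i - u j‖ := by gcongr; simp
      _ < ε := by rwa [lt_div_iff₀' (by positivity)] at h3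
  obtain ⟨b, hb⟩ := cauchySeq_tendsto_of_complete hc
  exact ⟨b, mem_closure_of_tendsto (hua.prodMk_nhds hb) (Filter.Eventually.of_forall hy)⟩

theorem exists_continuousLinearMap_mem_topologicalClosure [CompleteSpace B]
    {R : Submodule ℝ (A × B)} {β : ℝ≥0} (hR : ∀ z ∈ R, ‖z.2‖ ≤ β * ‖z.1‖) {S : Set A}
    (hS : ∀ a ∈ S, ∃ b, (a, b) ∈ R) :
    ∃ I : (Submodule.span ℝ S).topologicalClosure →L[ℝ] B,
      ∀ a : (Submodule.span ℝ S).topologicalClosure, ((a : A), I a) ∈ R.topologicalClosure := by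
  choose I hI using fun a : (Submodule.span ℝ S).topologicalClosure =>
    exists_mem_topologicalClosure hR hS a.2
  refine ⟨LinearMap.mkContinuous (⟨⟨I, fun a b => ?_⟩, fun c a => ?_⟩ :
    (Submodule.span ℝ S).topologicalClosure →ₗ[ℝ] B) β fun a => ?_, hI⟩
  · exact eq_of_mem_topologicalClosure hR (hI (a + b)) (add_mem (hI a) (hI b))
  · exact eq_of_mem_topologicalClosure hR (hI (c • a)) (Submodule.smul_mem _ c (hI a))
  · exact norm_le_of_mem_topologicalClosure hR (hI a)

/-- A bounded linear relation extends to a bounded linear operator on the closed span of a set on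
which it is defined. -/
theorem exists_extension_of_relation [CompleteSpace B] {r : A → B → Prop} (h0 : r 0 0)
    (hadd : ∀ {a b a' b'}, r a b → r a' b' → r (a + a') (b + b'))
    (hsmul : ∀ (c : ℝ) {a b}, r a b → r (c • a) (c • b)) {β : ℝ≥0}
    (hr : ∀ {a b}, r a b → ‖b‖ ≤ β * ‖a‖) {S : Set A} (hS : ∀ a ∈ S, ∃ b, r a b) :
    ∃ I : (Submodule.span ℝ S).topologicalClosure →L[ℝ] B,
      (∀ a : (Submodule.span ℝ S).topologicalClosure, ((a : A), I a) ∈ closure {z | r z.1 z.2}) ∧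
      ∀ (a : (Submodule.span ℝ S).topologicalClosure) (b : B), r a b → I a = b := by
  set R : Submodule ℝ (A × B) := ⟨⟨⟨{z | r z.1 z.2}, hadd⟩, h0⟩, fun c _ => hsmul c⟩ with hR
  obtain ⟨I, hI⟩ := exists_continuousLinearMap_mem_topologicalClosure (R := R) (fun z hz => hr hz)
    (S := S) hS
  exact ⟨I, hI, fun a b hab => eq_of_mem_topologicalClosure (fun z hz => hr hz) (hI a)
    (Submodule.le_topologicalClosure R hab)⟩

theorem ContinuousLinearMap.eq_of_eq_on_span {S : Set A}
    {I I' : (Submodule.span ℝ S).topologicalClosure →L[ℝ] B}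
    (h : ∀ a : (Submodule.span ℝ S).topologicalClosure, (a : A) ∈ S → I a = I' a) : I = I' := by
  have hle := Submodule.le_topologicalClosure (Submodule.span ℝ S)
  have h1 : ∀ a (ha : a ∈ Submodule.span ℝ S), I ⟨a, hle ha⟩ = I' ⟨a, hle ha⟩ := by
    intro a ha
    induction ha using Submodule.span_induction with
    | mem a ha => exact h _ ha
    | zero => exact (map_zero I).trans (map_zero I').symm
    | add a b ha hb h2 h3 =>
      exact (map_add I ⟨a, hle ha⟩ ⟨b, hle hb⟩).trans
        ((congrArg₂ _ h2 h3).trans (map_add I' ⟨a, hle ha⟩ ⟨b, hle hb⟩).symm)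
    | smul c a ha h2 =>
      exact (map_smul I c ⟨a, hle ha⟩).trans
        ((congrArg _ h2).trans (map_smul I' c ⟨a, hle ha⟩).symm)
  ext ⟨a, ha⟩
  obtain ⟨u, hu, hua⟩ := mem_closure_iff_seq_limit.1 (show a ∈ closure (Submodule.span ℝ S : Set A)
    from ha)
  have h2 : Filter.Tendsto (fun n => (⟨u n, hle (hu n)⟩ : (Submodule.span ℝ S).topologicalClosure))
      Filter.atTop (nhds ⟨a, ha⟩) := tendsto_subtype_rng.2 hua
  refine tendsto_nhds_unique ((I.continuous.tendsto _).comp h2) ?_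
  refine ((I'.continuous.tendsto _).comp h2).congr fun n => ?_
  exact (h1 _ (hu n)).symm

end Relation

/-! ### The Itô integral on the closure of the simple adapted processes. -/

section Ito

variable {Ω : Type u} [mΩ : MeasurableSpace Ω] {J : Type w} [MeasurableSpace J]

/-- `φ` is an elementary adapted process and `ψ` is its stochastic integral. -/
def IsElementaryIntegral {N : Ω → Measure (ℝ≥0 × J)} {ν : Measure J} {P : Measure Ω} {p : ℝ≥0∞}
    [Fact (1 ≤ p)] {X : Type v} [NormedAddCommGroup X] [NormedSpace ℝ X]
    (φ : Lp (nuSpace N (timeProd ν) P p X) p P) (ψ : Lp X p P) : Prop :=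
  ∃ f : AdaptedFamily N ν X, φ =ᵐ[P] f.process P p ∧ ψ =ᵐ[P] f.integral

namespace IsElementaryIntegral

variable {N : Ω → Measure (ℝ≥0 × J)} {ν : Measure J} {P : Measure Ω} {p : ℝ≥0∞}
  [Fact (1 ≤ p)] {X : Type v} [NormedAddCommGroup X] [NormedSpace ℝ X]
  {φ φ' : Lp (nuSpace N (timeProd ν) P p X) p P} {ψ ψ' : Lp X p P}

theorem zero : IsElementaryIntegral (0 : Lp (nuSpace N (timeProd ν) P p X) p P) 0 :=
  ⟨AdaptedFamily.empty, Lp.coeFn_zero _ _ _, Lp.coeFn_zero _ _ _⟩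

theorem add (h : IsElementaryIntegral φ ψ) (h' : IsElementaryIntegral φ' ψ') :
    IsElementaryIntegral (φ + φ') (ψ + ψ') := by
  obtain ⟨f, hφ, hψ⟩ := h
  obtain ⟨f', hφ', hψ'⟩ := h'
  refine ⟨f.add f', (Lp.coeFn_add φ φ').trans ((hφ.add hφ').trans (ae_of_all _ fun ω => ?_)),
    (Lp.coeFn_add ψ ψ').trans ((hψ.add hψ').trans (ae_of_all _ fun ω => ?_))⟩
  · exact (f.process_add f' P p ω).symm
  · exact (f.integral_add f' ω).symm

theorem smul (c : ℝ) (h : IsElementaryIntegral φ ψ) :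
    IsElementaryIntegral (c • φ) (c • ψ) := by
  obtain ⟨f, hφ, hψ⟩ := h
  refine ⟨f.smul c, (Lp.coeFn_smul c φ).trans ((hφ.const_smul c).trans
    (ae_of_all _ fun ω => ?_)), (Lp.coeFn_smul c ψ).trans ((hψ.const_smul c).trans
    (ae_of_all _ fun ω => ?_))⟩
  · exact (f.process_smul c P p ω).symm
  · exact (f.integral_smul c ω).symm

theorem exists_family (h : IsElementaryIntegral φ ψ) :
    ∃ f : AdaptedFamily N ν X, φ =ᵐ[P] f.process P p ∧ ψ =ᵐ[P] f.integral :=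
  h

end IsElementaryIntegral

variable (ν : Measure J) (P : Measure Ω) [IsProbabilityMeasure P] [SigmaFinite ν] {p : ℝ≥0∞}
  [Fact (1 ≤ p)] {X : Type v} [NormedAddCommGroup X] [NormedSpace ℝ X]

theorem exists_norm_le_of_isElementaryIntegral [CompleteSpace X] (hp : p ≠ ∞)
    (hX : UMDAt.{u, v} X p) : ∃ β : ℝ≥0, ∀ N : Ω → Measure (ℝ≥0 × J),
      IsPoissonRandomMeasure N (timeProd ν) P →
      ∀ (φ : Lp (nuSpace N (timeProd ν) P p X) p P) (ψ : Lp X p P),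
        IsElementaryIntegral φ ψ → ‖ψ‖ ≤ β * ‖φ‖ := by
  obtain ⟨β, hβ⟩ := AdaptedFamily.exists_eLpNorm_integral_le (Ω := Ω) (J := J) (ν := ν) (P := P)
    hp hX
  refine ⟨β, fun N hN φ ψ ⟨f, hφ, hψ⟩ => ?_⟩
  have h1 := hβ N hN f
  rw [← eLpNorm_congr_ae hφ, ← eLpNorm_congr_ae hψ] at h1
  rw [Lp.norm_def, Lp.norm_def, ← ENNReal.coe_toReal β, ← ENNReal.toReal_mul]
  exact ENNReal.toReal_mono (ENNReal.mul_ne_top ENNReal.coe_ne_top (Lp.eLpNorm_ne_top φ)) h1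

variable {N : Ω → Measure (ℝ≥0 × J)} {ν P}

theorem SimpleAdapted.exists_isElementaryIntegral (hN : IsPoissonRandomMeasure N (timeProd ν) P)
    (hp : p ≠ ∞) (s : SimpleAdapted N ν X) {φ : Lp (nuSpace N (timeProd ν) P p X) p P}
    (hφ : φ =ᵐ[P] s.process P p) :
    ∃ ψ : Lp X p P, ψ =ᵐ[P] s.integral ∧ IsElementaryIntegral φ ψ := by
  have h1 := (s.toFamily.memLp_integral hN hp).coeFn_toLp
  refine ⟨_, h1.trans (ae_of_all _ s.integral_toFamily), s.toFamily, ?_, h1⟩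
  exact hφ.trans (ae_of_all _ fun ω => (s.process_toFamily P p ω).symm)

attribute [irreducible] IsElementaryIntegral

variable (N ν P) in
/-- The stochastic integral on the closure of the adapted processes. -/
theorem exists_integral [CompleteSpace X] (hN : IsPoissonRandomMeasure N (timeProd ν) P)
    (hp : p ≠ ∞) (hX : UMDAt.{u, v} X p) : ∃ I : adaptedSpace N ν P p X →L[ℝ] Lp X p P,
      ExtendsSimpleIntegral I ∧ ∀ φ : adaptedSpace N ν P p X,
        ((φ : Lp (nuSpace N (timeProd ν) P p X) p P), I φ)
          ∈ closure {z : Lp (nuSpace N (timeProd ν) P p X) p P × Lp X p P |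
            IsElementaryIntegral z.1 z.2} := by
  obtain ⟨β, hβ⟩ := exists_norm_le_of_isElementaryIntegral (Ω := Ω) ν P hp hX
  have h1 := exists_extension_of_relation (A := Lp (nuSpace N (timeProd ν) P p X) p P)
    (B := Lp X p P) (r := IsElementaryIntegral) IsElementaryIntegral.zero
    (fun h h' => h.add h') (fun c _ _ h => h.smul c) (hβ N hN _ _)
    (S := {φ | ∃ s : SimpleAdapted N ν X, φ =ᵐ[P] s.process P p})
    (fun φ hφ => hφ.elim fun s hs => (s.exists_isElementaryIntegral hN hp hs).imp fun ψ h => h.2)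
  refine h1.elim fun I hI => ⟨I, fun s φ hφ => ?_, hI.1⟩
  refine (s.exists_isElementaryIntegral hN hp hφ).elim fun ψ h => ?_
  exact (Filter.EventuallyEq.of_eq (congrArg (fun g : Lp X p P => (g : Ω → X))
    (hI.2 φ ψ h.2))).trans h.1

theorem ExtendsSimpleIntegral.unique {I I' : adaptedSpace N ν P p X →L[ℝ] Lp X p P}
    (h : ExtendsSimpleIntegral I) (h' : ExtendsSimpleIntegral I') : I = I' := by
  refine ContinuousLinearMap.eq_of_eq_on_span (A := Lp (nuSpace N (timeProd ν) P p X) p P)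
    (B := Lp X p P) ?_
  rintro φ ⟨s, hs⟩
  exact Lp.ext ((h s φ hs).trans (h' s φ hs).symm)

end Ito

/-! ### Cylindrical functions determine the divergence -/

section Cylinder

variable {Ω : Type u} {E : Type w} [MeasurableSpace E] (N : Ω → Measure E) (μ : Measure E)

/-- The events described by finitely many variables `Ñ(B)`. -/
def cylinderEvents : Set (Set Ω) :=
  {A | ∃ (n : ℕ) (B : Fin n → Set E) (T : Set (Fin n → ℝ)), (∀ k, MeasurableSet (B k)) ∧
    (∀ k, μ (B k) < ∞) ∧ MeasurableSet T ∧ A = {ω | (fun k => compensated N μ (B k) ω) ∈ T}}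

theorem isPiSystem_cylinderEvents : IsPiSystem (cylinderEvents N μ) := by
  rintro _ ⟨n, B, T, hB, hμ, hT, rfl⟩ _ ⟨n', B', T', hB', hμ', hT', rfl⟩ -
  refine ⟨n + n', Fin.append B B', {x | (fun k => x (Fin.castAdd n' k)) ∈ T ∧
    (fun k => x (Fin.natAdd n k)) ∈ T'}, fun k => ?_, fun k => ?_, ?_, ?_⟩
  · exact Fin.addCases (fun i => by simpa using hB i) (fun i => by simpa using hB' i) k
  · exact Fin.addCases (fun i => by simpa using hμ i) (fun i => by simpa using hμ' i) k
  · exact ((measurable_pi_lambda _ fun k => measurable_pi_apply _) hT).inter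
      ((measurable_pi_lambda _ fun k => measurable_pi_apply _) hT')
  · ext ω
    simp

theorem univ_mem_cylinderEvents : Set.univ ∈ cylinderEvents N μ :=
  ⟨0, fun _ => ∅, Set.univ, fun _ => MeasurableSet.empty, by simp, MeasurableSet.univ, by simp⟩

theorem noiseSigma_eq_generateFrom :
    noiseSigma N μ = MeasurableSpace.generateFrom (cylinderEvents N μ) := by
  refine le_antisymm (iSup₂_le fun B hB => ?_) (MeasurableSpace.generateFrom_le ?_)
  · rintro _ ⟨T, hT, rfl⟩
    refine MeasurableSpace.measurableSet_generateFrom ⟨1, fun _ => B, {x | x 0 ∈ T},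
      fun _ => hB.1, fun _ => hB.2, measurable_pi_apply 0 hT, rfl⟩
  · rintro _ ⟨n, B, T, hB, hμ, hT, rfl⟩
    exact (@measurable_pi_lambda _ _ _ (noiseSigma N μ) _ _ fun k =>
      measurable_compensated_noiseSigma (hB k) (hμ k)) hT

variable {N μ} [mΩ : MeasurableSpace Ω] {P : Measure Ω} [IsProbabilityMeasure P]

/-- The sets of a cylinder event may overlap, while cylindrical functions require disjoint ones;
passing to atoms expresses each `Ñ(B k)` as a sum of atomic terms. -/
theorem exists_indicator_ae_eq (hN : IsPoissonRandomMeasure N μ P) {A : Set Ω}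
    (hA : A ∈ cylinderEvents N μ) :
    ∃ (M : ℕ) (D : Fin M → Set E) (f : (Fin M → ℕ) → ℝ), (∀ m, MeasurableSet (D m)) ∧
      (∀ m, μ (D m) < ∞) ∧ (Pairwise fun m m' => Disjoint (D m) (D m')) ∧ (∀ k, |f k| ≤ 1) ∧
      (fun ω => f fun m => count N (D m) ω) =ᵐ[P] A.indicator 1 := by
  classical
  obtain ⟨n, B, T, hB, hμ, hT, rfl⟩ := hA
  obtain ⟨a, ham, had, haU, haB⟩ := exists_atoms B hB
  have haμ : ∀ σ, μ (a σ) < ∞ := fun σ => (measure_mono (haU σ)).trans_lt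
    ((measure_iUnion_le _).trans_lt (by simpa using hμ))
  set e := Fintype.equivFin (Fin n → Bool) with he
  refine ⟨_, fun m => a (e.symm m), fun c => if (fun k => ∑ σ with σ k = true,
    ((c (e σ) : ℝ) - (μ (a σ)).toNNReal)) ∈ T then 1 else 0, fun m => ham _, fun m => haμ _,
    fun m m' h => had (e.symm.injective.ne h), fun k => ?_, ?_⟩
  · dsimp only
    split_ifs <;> simp
  · have h1 : ∀ᵐ ω ∂P, ∀ k, compensated N μ (B k) ω
        = ∑ σ with σ k = true, compensated N μ (a σ) ω := ae_all_iff.2 fun k => by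
      have h2 := compensated_biUnion_ae hN (Finset.univ.filter fun σ : Fin n → Bool => σ k = true)
        (fun σ _ τ _ h => had h) ham haμ
      rwa [← haB k] at h2
    have h3 := ae_all_iff.2 fun σ => ae_compensated_eq hN (ham σ) (haμ σ)
    filter_upwards [h1, h3] with ω h1 h3
    simp only [Set.indicator_apply, Set.mem_ofPred_eq, Equiv.symm_apply_apply, h1, h3, Pi.one_apply]

end Cylinder

section Unique

variable {Ω : Type u} [mΩ : MeasurableSpace Ω] {P : Measure Ω} [IsProbabilityMeasure P]
  {E : Type w} [MeasurableSpace E] {μ : Measure E} {N : Ω → Measure E}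
  {X : Type v} [NormedAddCommGroup X] [NormedSpace ℝ X]
  {p q : ℝ≥0∞} [Fact (1 ≤ p)] [Fact (1 ≤ q)] [ENNReal.HolderConjugate p q]

/-- The functions `1_A ⊗ y` with `A` a cylinder event belong to the domain of the Malliavin
derivative. -/
theorem exists_mem_malliavinGraph_indicator (hN : IsPoissonRandomMeasure N μ P) {A : Set Ω}
    (hA : A ∈ cylinderEvents N μ) {Y : Type v} [NormedAddCommGroup Y] [NormedSpace ℝ Y] (y : Y) :
    ∃ G ∈ malliavinGraph N μ P q Y, G.1 =ᵐ[P] A.indicator fun _ => y := by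
  obtain ⟨M, D, f, hD, hμ, hd, hf, hfA⟩ := exists_indicator_ae_eq hN hA
  set c : CylindricalData μ Y := ⟨M, D, hD, hμ, hd, 1, fun _ => f, fun _ => y⟩ with hc
  have hcount : Measurable fun ω m => count N (D m) ω :=
    measurable_pi_lambda _ fun m => measurable_count hN (hD m)
  have h1 : MemLp (fun ω => f fun m => count N (D m) ω) q P :=
    MemLp.of_bound ((measurable_of_countable f).comp hcount).aestronglyMeasurable 1
      (ae_of_all _ fun ω => hf _)
  have h2 : MemLp (c.toFun N) q P := by
    refine memLp_finsetSum _ fun i _ => ?_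
    exact (ContinuousLinearMap.toSpanSingleton ℝ y).comp_memLp' h1
  -- The bound on `f` holds at every argument, in particular at the shifted ones, about which the
  -- almost sure identity with the indicator says nothing.
  have h3 : MemLp (c.deriv N P q) q P := by
    refine memLp_finsetSum _ fun i _ => memLp_finsetSum _ fun m _ => ?_
    have hshift : Measurable fun ω => f ((fun m => count N (D m) ω) + Pi.single m 1) :=
      (measurable_of_countable f).comp (hcount.add_const _)
    have h4 : MemLp (fun ω => f ((fun m => count N (D m) ω) + Pi.single m 1)) q P :=
      MemLp.of_bound hshift.aestronglyMeasurable 1 (ae_of_all _ fun ω => hf _)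
    exact (ContinuousLinearMap.toSpanSingleton ℝ
      (nuIndicator N μ P q (D m) y)).comp_memLp' (h4.sub h1)
  refine ⟨(h2.toLp _, h3.toLp _), Submodule.le_topologicalClosure _
    (Submodule.subset_span ⟨c, h2.coeFn_toLp, h3.coeFn_toLp⟩), h2.coeFn_toLp.trans ?_⟩
  filter_upwards [hfA] with ω hω
  have h4 : c.toFun N ω = (f fun m => count N (D m) ω) • y := Fin.sum_univ_one _
  rw [h4, hω]
  by_cases h : ω ∈ A <;> simp [h]

theorem IsDivergence.dualPairing_sub_eq_zero
    {φ : Lp (nuSpace N μ P p X) p P} {ψ ψ' : Lp X p P} (h : IsDivergence q φ ψ)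
    (h' : IsDivergence q φ ψ') {G} (hG : G ∈ malliavinGraph N μ P q (StrongDual ℝ X)) :
    dualPairing P p q X (ψ - ψ') G.1 = 0 := by
  have h1 := (isDivergence_iff.1 h).2 G hG
  have h2 := (isDivergence_iff.1 h').2 G hG
  exact (ContinuousLinearMap.map_sub₂ _ ψ ψ' G.1).trans (sub_eq_zero.2 (h1.trans h2.symm))

/-- Testing against `1_A ⊗ y` for a π-system of events `A` generating `𝒢` is enough, so density of
cylindrical functions in `L^q` does not enter. -/
theorem eq_zero_of_dualPairing_eq_zero [CompleteSpace X] (hN : IsPoissonRandomMeasure N μ P)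
    {χ : Lp X p P} (hχm : AEStronglyMeasurable[noiseSigma N μ] χ P)
    (h : ∀ G ∈ malliavinGraph N μ P q (StrongDual ℝ X), dualPairing P p q X χ G.1 = 0) : χ = 0 := by
  have hi : Integrable χ P := (Lp.memLp χ).integrable Fact.out
  have key : ∀ A ∈ cylinderEvents N μ, ∫ ω in A, χ ω ∂P = 0 := by
    intro A hA
    have hAm : MeasurableSet A := noiseSigma_le hN _ (by
      rw [noiseSigma_eq_generateFrom]
      exact MeasurableSpace.measurableSet_generateFrom hA)
    refine SeparatingDual.eq_zero_of_forall_dual_eq_zero (R := ℝ) fun y => ?_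
    obtain ⟨G, hG, hGA⟩ := exists_mem_malliavinGraph_indicator (q := q) hN hA y
    have h1 := h G hG
    rw [dualPairing_apply] at h1
    rw [← ContinuousLinearMap.integral_comp_comm y hi.integrableOn, ← integral_indicator hAm, ← h1]
    refine integral_congr_ae ?_
    filter_upwards [hGA] with ω hω
    rw [hω]
    by_cases h : ω ∈ A <;> simp [h]
  have h0 : P[χ|noiseSigma N μ] =ᵐ[P] 0 :=
    condExp_eq_zero_of_isPiSystem (noiseSigma_le hN) (noiseSigma_eq_generateFrom N μ)
      (isPiSystem_cylinderEvents N μ) hi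
      (by simpa using key _ (univ_mem_cylinderEvents N μ)) key
  -- Since `χ` is `𝒢`-measurable up to null sets, it is its own conditional expectation; without
  -- this the divergence would be determined only modulo variables orthogonal to `𝒢`.
  have h1 := (condExp_of_aestronglyMeasurable' (noiseSigma_le hN) hχm hi).symm.trans h0
  exact (Lp.eq_zero_iff_ae_eq_zero).2 h1

theorem IsDivergence.unique [CompleteSpace X] (hN : IsPoissonRandomMeasure N μ P)
    {φ : Lp (nuSpace N μ P p X) p P} {ψ ψ' : Lp X p P} (h : IsDivergence q φ ψ)
    (h' : IsDivergence q φ ψ') : ψ = ψ' := by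
  have h1 := (isDivergence_iff.1 h).1
  have h2 := (isDivergence_iff.1 h').1
  exact sub_eq_zero.1 (eq_zero_of_dualPairing_eq_zero hN
    ((h1.sub h2).congr (Lp.coeFn_sub ψ ψ').symm) fun G hG => h.dualPairing_sub_eq_zero h' hG)

end Unique

/-! ### From elementary processes to the closure. -/

section Closure

variable {Ω : Type u} [mΩ : MeasurableSpace Ω] {P : Measure Ω} [IsProbabilityMeasure P]
  {J : Type w} [MeasurableSpace J] {ν : Measure J} [SigmaFinite ν] {N : Ω → Measure (ℝ≥0 × J)}
  {X : Type v} [NormedAddCommGroup X] [NormedSpace ℝ X]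
  {p q : ℝ≥0∞} [Fact (1 ≤ p)] [Fact (1 ≤ q)] [ENNReal.HolderConjugate p q]

theorem isDivergence_of_mem_closure [CompleteSpace X]
    (hN : IsPoissonRandomMeasure N (timeProd ν) P) (hp : p ≠ ∞) (hq : q ≠ ∞)
    {φ : Lp (nuSpace N (timeProd ν) P p X) p P} {ψ : Lp X p P}
    (h : (φ, ψ) ∈ closure {z : Lp (nuSpace N (timeProd ν) P p X) p P × Lp X p P |
      IsElementaryIntegral z.1 z.2}) : IsDivergence q φ ψ := by
  have h1 : {z : Lp (nuSpace N (timeProd ν) P p X) p P × Lp X p P | IsElementaryIntegral z.1 z.2} ⊆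
      {z | IsDivergence q z.1 z.2} := fun z hz =>
    (IsElementaryIntegral.exists_family hz).elim fun f h => f.isDivergence hN hp hq h.1 h.2
  exact closure_minimal h1 (isClosed_isDivergence hN) h

end Closure


end PoissonSkorokhod

theorem mainTheorem5 {Ω : Type u} [MeasurableSpace Ω] (P : Measure Ω) [IsProbabilityMeasure P]
    {J : Type w} [MeasurableSpace J] (ν : Measure J) [SigmaFinite ν]
    (N : Ω → Measure (ℝ≥0 × J)) (hN : IsPoissonRandomMeasure N (timeProd ν) P)
    (X : Type v) [NormedAddCommGroup X] [NormedSpace ℝ X] [CompleteSpace X]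
    (hX : IsUMD.{u, v} X)
    (p q : ℝ≥0∞) [Fact (1 ≤ p)] [Fact (1 ≤ q)] [ENNReal.HolderConjugate p q]
    (hp : 1 < p) (hp' : p < ∞) :
    (∃! I : adaptedSpace N ν P p X →L[ℝ] Lp X p P, ExtendsSimpleIntegral I) ∧
      (adaptedSpace N ν P p X : Set (Lp (nuSpace N (timeProd ν) P p X) p P))
        ⊆ divergenceDomain N (timeProd ν) P p q X ∧
      ∀ I : adaptedSpace N ν P p X →L[ℝ] Lp X p P, ExtendsSimpleIntegral I →
        ∀ (φ : adaptedSpace N ν P p X) (ψ : Lp X p P),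
          IsDivergence q (φ : Lp (nuSpace N (timeProd ν) P p X) p P) ψ ↔ ψ = I φ := by
  have hq : q ≠ ∞ := by
    rintro rfl
    have h1 := ENNReal.HolderConjugate.inv_add_inv_eq_one p ∞
    rw [ENNReal.inv_top, add_zero, ENNReal.inv_eq_one] at h1
    exact hp.ne' h1
  refine (exists_integral ν P N hN hp'.ne (hX.umdAt (q := q) hp hp')).elim fun I₀ h => ?_
  have hdiv : ∀ φ : adaptedSpace N ν P p X,
      IsDivergence q (φ : Lp (nuSpace N (timeProd ν) P p X) p P) (I₀ φ) := fun φ =>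
    isDivergence_of_mem_closure hN hp'.ne hq (h.2 φ)
  refine ⟨⟨I₀, h.1, fun I hI => hI.unique h.1⟩, fun φ hφ => ⟨I₀ ⟨φ, hφ⟩, hdiv ⟨φ, hφ⟩⟩,
    fun I hI φ ψ => ?_⟩
  rw [hI.unique h.1]
  exact ⟨fun h' => h'.unique hN (hdiv φ), fun h' => h' ▸ hdiv φ⟩
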